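/- Let $d\ge 2$ be an even integer, $L,M,r>0$, $Q\in\mathbb R$. Let $A_1,\dots,A_d$ and $\xi$ be smooth real-valued functions on the torus $\mathbb T^d=(\mathbb R/L\mathbb Z)^d$, and let $\gamma_1,\dots,\gamma_d$ be anti-hermitian complex $2^{d/2}\times 2^{d/2}$ matrices with $\gamma_\mu\gamma_\nu+\gamma_\nu\gamma_\mu=-2\delta_{\mu\nu}I$; put $\gamma_{d+1}=i^{d/2}\gamma_1\gamma_2\cdots\gamma_d$. For $a=L/N$ with $N\in\{1,2,\dots\}$ let $\mathbb V_a^d$ be the space of functions $u:(a\mathbb Z/L\mathbb Z)^d\to\mathbb C^{2^{d/2}}$ with anti-periodic boundary condition, with inner product $(v,u)=a^d\sum_x\sum_s\overline{v_s(x)}u_s(x)$. On $\mathbb V_a^d$ define $$T_\mu u(x)=U_\mu(x)\,u(x+ae_\mu),\qquad U_\mu(x)=\exp\Bigl(-iQ\int_0^aA_\mu(x+se_\mu)\,ds\Bigr),$$ $$D_\mu=\tfrac1{2a}(T_\mu-T_\mu^*),\quad W=-\sum_{\mu=1}^d(2I-T_\mu-T_\mu^*),\quad \mathcal L=MI-\tfrac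 r{2a}W,$$ $$X_{\mu\nu}=D_\mu \mathcal L^{-1}D_\nu-D_\nu \mathcal L^{-1}D_\mu,\quad B=\tfrac12\sum_{\mu,\nu=1}^d\gamma_\mu\gamma_\nu X_{\mu\nu},\quad C=\mathcal L-\sum_{\mu=1}^dD_\mu \mathcal L^{-1}D_\mu ,$$ where the $\gamma$'s act on the values, and let $\xi$ also denote multiplication by $\xi$. Put $$\langle Y(\xi)\rangle=-i\,\mathrm{Tr}_{\mathbb V_a^d}\Bigl[\tfrac r{2a}(\xi W+W\xi)(C+B)^{-1}\gamma_{d+1}\Bigr],$$ and let $$z^{(j)}=-i\,\mathrm{Tr}_{\mathbb V_a^d}\Bigl[\tfrac r{2a}(\xi W+W\xi)\,C^{-1}(-BC^{-1})^j\gamma_{d+1}\Bigr],\qquad j=0,1,2,\dots,$$ be the terms of the formal expansion of $\langle Y(\xi)\rangle$ in powers of $BC^{-1}$. Then $\mathcal L$, $C$ and $C+B$ are invertible for every $a=L/N$, and the terms with $j>d/2$ are irrelevant in the continuum limit, i.e. $$\lim_{a\to0}\Bigl(\langle Y(\xi)\rangle-\sum_{j=0}^{d/2}z^{(j)}\Bigr)=0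 ,$$ the limit being taken along $a=L/N$, $N\to\infty$; moreover the difference is $O(a)$. -/

import Mathlib

open Filter Topology Asymptotics
open scoped Matrix Kronecker ContDiff

noncomputable section

namespace WilsonFermion

/-- Spin index of the fibre `ℂ^(2^(d/2))`. -/
abbrev Spin (d : ℕ) : Type := Fin (2 ^ (d / 2))

/-- Sites of the discrete torus `(aℤ/Lℤ)^d` with `N = L/a` sites per direction; the index `x`
stands for the point with coordinates `a * x μ`, `0 ≤ x μ < N`. -/
abbrev Site (d N : ℕ) : Type := Fin d → Fin N

/-- Operators on the complex-valued functions on the discrete torus, as matrices in the site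
basis. The weight `a^d` of the inner product is constant, so the adjoint is `ᴴ`. -/
abbrev ScalarOp (d N : ℕ) : Type := Matrix (Site d N) (Site d N) ℂ

/-- Operators on the `ℂ^(2^(d/2))`-valued functions on the discrete torus. -/
abbrev SpinorOp (d N : ℕ) : Type := Matrix (Site d N × Spin d) (Site d N × Spin d) ℂ

/-- Lattice spacing `a = L/N`. -/
def spacing (L : ℝ) (N : ℕ) : ℝ := L / N

/-- The point of `[0,L)^d` represented by a site. -/
def point {d : ℕ} (L : ℝ) (N : ℕ) (x : Site d N) : Fin d → ℝ :=
  fun μ => spacing L N * ((x μ : ℕ) : ℝ)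

/-- The neighbour `x + a e_μ` on the discrete torus (the index wraps around modulo `N`). -/
def next {d N : ℕ} (μ : Fin d) (x : Site d N) : Site d N :=
  Function.update x μ (finRotate N (x μ))

/-- Sign of the anti-periodic boundary condition: `-1` on the links that wrap around. -/
def bcSign {d N : ℕ} (μ : Fin d) (x : Site d N) : ℂ :=
  if (x μ : ℕ) + 1 = N then -1 else 1

/-- Link variable `U_μ(x) = exp(-iQ ∫₀^a A_μ(x + s e_μ) ds)`. -/
def link {d : ℕ} (L Q : ℝ) (A : Fin d → (Fin d → ℝ) → ℝ) (N : ℕ) (μ : Fin d)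
    (x : Site d N) : ℂ :=
  Complex.exp (-Complex.I * (Q : ℂ) *
    ((∫ s in (0 : ℝ)..spacing L N, A μ (point L N x + Pi.single μ s) : ℝ) : ℂ))

/-- Free translation `(T_{μ0} u)(x) = u(x + a e_μ)` with anti-periodic boundary condition. -/
def freeTranslation {d : ℕ} (N : ℕ) (μ : Fin d) : ScalarOp d N :=
  Matrix.of fun x y => if y = next μ x then bcSign μ x else 0

/-- Covariant translation `T_μ = U_μ T_{μ0}`, acting trivially on the spin index. -/
def translation {d : ℕ} (L Q : ℝ) (A : Fin d → (Fin d → ℝ) → ℝ) (N : ℕ) (μ : Fin d) :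
    SpinorOp d N :=
  (Matrix.diagonal (link L Q A N μ) * freeTranslation N μ) ⊗ₖ (1 : Matrix (Spin d) (Spin d) ℂ)

/-- `D_μ = (T_μ - T_μ^*) / (2a)`. -/
def covDeriv {d : ℕ} (L Q : ℝ) (A : Fin d → (Fin d → ℝ) → ℝ) (N : ℕ) (μ : Fin d) :
    SpinorOp d N :=
  (1 / (2 * (spacing L N : ℂ))) • (translation L Q A N μ - (translation L Q A N μ)ᴴ)

/-- Wilson term `W = -∑_μ (2I - T_μ - T_μ^*)`. -/
def wilson {d : ℕ} (L Q : ℝ) (A : Fin d → (Fin d → ℝ) → ℝ) (N : ℕ) : SpinorOp d N :=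
  -∑ μ : Fin d, ((2 : ℂ) • (1 : SpinorOp d N) - translation L Q A N μ
    - (translation L Q A N μ)ᴴ)

/-- The operator `L = M I - (r/2a) W` (the period is written `L` here). -/
def opL {d : ℕ} (L M r Q : ℝ) (A : Fin d → (Fin d → ℝ) → ℝ) (N : ℕ) : SpinorOp d N :=
  (M : ℂ) • (1 : SpinorOp d N) - ((r : ℂ) / (2 * (spacing L N : ℂ))) • wilson L Q A N

/-- `X_{μν} = D_μ L⁻¹ D_ν - D_ν L⁻¹ D_μ`. -/
def opX {d : ℕ} (L M r Q : ℝ) (A : Fin d → (Fin d → ℝ) → ℝ) (N : ℕ) (μ ν : Fin d) :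
    SpinorOp d N :=
  covDeriv L Q A N μ * (opL L M r Q A N)⁻¹ * covDeriv L Q A N ν
    - covDeriv L Q A N ν * (opL L M r Q A N)⁻¹ * covDeriv L Q A N μ

/-- A spin matrix as an operator on spinor fields, acting trivially on the sites. -/
def spinOp {d : ℕ} (N : ℕ) (g : Matrix (Spin d) (Spin d) ℂ) : SpinorOp d N :=
  (1 : ScalarOp d N) ⊗ₖ g

/-- `B = ½ ∑_{μ,ν} γ_μ γ_ν X_{μν}`. -/
def opB {d : ℕ} (γ : Fin d → Matrix (Spin d) (Spin d) ℂ) (L M r Q : ℝ)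
    (A : Fin d → (Fin d → ℝ) → ℝ) (N : ℕ) : SpinorOp d N :=
  (1 / 2 : ℂ) • ∑ μ : Fin d, ∑ ν : Fin d,
    spinOp N (γ μ) * spinOp N (γ ν) * opX L M r Q A N μ ν

/-- `C = L - ∑_μ D_μ L⁻¹ D_μ`. -/
def opC {d : ℕ} (L M r Q : ℝ) (A : Fin d → (Fin d → ℝ) → ℝ) (N : ℕ) : SpinorOp d N :=
  opL L M r Q A N
    - ∑ μ : Fin d, covDeriv L Q A N μ * (opL L M r Q A N)⁻¹ * covDeriv L Q A N μ

/-- Chirality `γ_{d+1} = i^{d/2} γ_1 γ_2 ⋯ γ_d` (ordered product). -/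
def chirality {d : ℕ} (γ : Fin d → Matrix (Spin d) (Spin d) ℂ) : Matrix (Spin d) (Spin d) ℂ :=
  Complex.I ^ (d / 2) • (List.ofFn γ).prod

/-- Multiplication by a real function on the continuum torus. -/
def mulOp {d : ℕ} (L : ℝ) (ξ : (Fin d → ℝ) → ℝ) (N : ℕ) : SpinorOp d N :=
  Matrix.diagonal fun p => (ξ (point L N p.1) : ℂ)

/-- The vertex `(r/2a) (ξ W + W ξ)`. -/
def vertex {d : ℕ} (L r Q : ℝ) (A : Fin d → (Fin d → ℝ) → ℝ) (ξ : (Fin d → ℝ) → ℝ) (N : ℕ) :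
    SpinorOp d N :=
  ((r : ℂ) / (2 * (spacing L N : ℂ))) •
    (mulOp L ξ N * wilson L Q A N + wilson L Q A N * mulOp L ξ N)

/-- `⟨Y(ξ)⟩ = -i Tr[(r/2a)(ξW + Wξ)(C + B)⁻¹ γ_{d+1}]` at lattice spacing `a = L/N`. -/
def expectY {d : ℕ} (γ : Fin d → Matrix (Spin d) (Spin d) ℂ) (L M r Q : ℝ)
    (A : Fin d → (Fin d → ℝ) → ℝ) (ξ : (Fin d → ℝ) → ℝ) (N : ℕ) : ℂ :=
  -Complex.I * Matrix.trace (vertex L r Q A ξ N *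
    (opC L M r Q A N + opB γ L M r Q A N)⁻¹ * spinOp N (chirality γ))

/-- `z^{(j)} = -i Tr[(r/2a)(ξW + Wξ) C⁻¹ (-B C⁻¹)^j γ_{d+1}]` at lattice spacing `a = L/N`. -/
def zTerm {d : ℕ} (γ : Fin d → Matrix (Spin d) (Spin d) ℂ) (L M r Q : ℝ)
    (A : Fin d → (Fin d → ℝ) → ℝ) (ξ : (Fin d → ℝ) → ℝ) (j N : ℕ) : ℂ :=
  -Complex.I * Matrix.trace (vertex L r Q A ξ N * (opC L M r Q A N)⁻¹ *
    (-(opB γ L M r Q A N * (opC L M r Q A N)⁻¹)) ^ j * spinOp N (chirality γ))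

end WilsonFermion

end

open WilsonFermion

/-! Write `𝓛` for the mass operator, `G = (C+B)⁻¹` and `P_μ = (T_μ - 1)/a`. Resumming the geometric
series turns the difference into one trace, that of the vertex times `G(-BC⁻¹)^(d/2+1) γ_{d+1}`. The
vertex equals `-(ra/2)(ξ ∑ P*P + ∑ P*P ξ)`, so everything follows once the trace of `(ξ ∑ P*P + ∑
P*P ξ) G (-BC⁻¹)^(d/2+1) γ_{d+1}` is bounded uniformly in `a`: the prefactor `a` is the asserted
rate. The chirality matters only as a bounded matrix commuting with the `P_μ*`; no spin trace
identity is used.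

The uniform bound is power counting. Both `𝓛C` and `𝓛(C+B)` differ by bounded operators from `H = 𝓛²
- ∑ D²`, and `H` controls every `P_μ*P_μ` (`exists_norm_sq_le`): the symmetric differences alone
miss the doublers, and the Wilson term inside `𝓛²` supplies what is missing. Moreover `𝓛B` is
bounded. Hence `y = -C⁻¹B = (C⁻¹𝓛⁻¹)(-𝓛B)` gains two derivatives, `P_μ y` gains one, and `G` gains
one. With `d = 2(k+1)` one has `G(-BC⁻¹)^(k+2) = y · (y^k G) · y*`; cyclicity of the trace puts one
`P` of the vertex on each outer factor, and the orders add up to `1 + (2k+1) + 1 = d+1`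
(`traceBdd_remainder`).

Order `s` is measured by approximation numbers (`ApproxOrder`): rank `O(2^(jd))` reaches accuracy
`O(2^(-js))`. Such orders add under products, and order `d+1` bounds the trace because a trace is at
most rank times norm (`trace_bdd`). Bounds on `P X` become orders through a Poincaré inequality on
dyadic blocks (`HasBlockPoincare`).

The analytic inputs are: bounded single and double commutators of the `P_μ`, since the flux through
a plaquette is `O(a²)` and varies by `O(a³)` between neighbours (`isLatticeGradient_gradFam`); an
energy estimate for `a P 𝓛⁻¹ D`, which makes `[D, 𝓛] 𝓛⁻¹ D` bounded; and coercivity with constant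
`M` of `𝓛`, of `C = 𝓛 + ∑ D* 𝓛⁻¹ D` and of `C+B = 𝓛 + 𝒟 𝓛⁻¹ 𝒟`, where `𝒟 = ∑ γ_μ D_μ` is
self-adjoint. Coercivity also gives the invertibility claims. -/

namespace WilsonFermion

/-! ### Uniformly bounded families, approximation numbers and traces -/

section Families

open scoped Matrix.Norms.L2Operator

/-- Families of square complex matrices whose size depends on the parameter `n`. -/
abbrev OpFam (ι : ℕ → Type) : Type := ∀ n, Matrix (ι n) (ι n) ℂ

variable {ι : ℕ → Type} [∀ n, Fintype (ι n)] [∀ n, DecidableEq (ι n)]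

/-- A family of matrices whose operator norms are bounded uniformly in the parameter. -/
def UnifBdd (X : OpFam ι) : Prop := ∃ K : ℝ, ∀ n, ‖X n‖ ≤ K

namespace UnifBdd

variable {X Y : OpFam ι}

theorem exists_nonneg (hX : UnifBdd X) : ∃ K : ℝ, 0 ≤ K ∧ ∀ n, ‖X n‖ ≤ K := by
  obtain ⟨K, hK⟩ := hX
  exact ⟨|K|, abs_nonneg K, fun n => (hK n).trans (le_abs_self K)⟩

theorem zero : UnifBdd (0 : OpFam ι) := ⟨0, fun n => by simp⟩

theorem one : UnifBdd (1 : OpFam ι) := by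
  refine ⟨1, fun n => ?_⟩
  -- Idempotence of the norm gives at most one without assuming the index type nonempty.
  have h : ‖(1 : Matrix (ι n) (ι n) ℂ)‖ * ‖(1 : Matrix (ι n) (ι n) ℂ)‖
      = ‖(1 : Matrix (ι n) (ι n) ℂ)‖ := by
    rw [← CStarRing.norm_star_mul_self]; simp
  rw [Pi.one_apply]
  nlinarith [norm_nonneg (1 : Matrix (ι n) (ι n) ℂ)]

theorem add (hX : UnifBdd X) (hY : UnifBdd Y) : UnifBdd (X + Y) := by
  obtain ⟨K, hK⟩ := hX
  obtain ⟨K', hK'⟩ := hY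
  exact ⟨K + K', fun n => (norm_add_le _ _).trans (add_le_add (hK n) (hK' n))⟩

theorem neg (hX : UnifBdd X) : UnifBdd (-X) := by
  obtain ⟨K, hK⟩ := hX
  exact ⟨K, fun n => by rw [Pi.neg_apply, norm_neg]; exact hK n⟩

theorem sub (hX : UnifBdd X) (hY : UnifBdd Y) : UnifBdd (X - Y) := by
  rw [sub_eq_add_neg]; exact hX.add hY.neg

theorem mul (hX : UnifBdd X) (hY : UnifBdd Y) : UnifBdd (X * Y) := by
  obtain ⟨K, hK0, hK⟩ := hX.exists_nonneg
  obtain ⟨K', hK'⟩ := hY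
  exact ⟨K * K', fun n => (norm_mul_le _ _).trans
    (mul_le_mul (hK n) (hK' n) (norm_nonneg _) hK0)⟩

theorem star (hX : UnifBdd X) : UnifBdd (star X) := by
  obtain ⟨K, hK⟩ := hX
  exact ⟨K, fun n => by rw [Pi.star_apply, norm_star]; exact hK n⟩

theorem pow (hX : UnifBdd X) (k : ℕ) : UnifBdd (X ^ k) := by
  induction k with
  | zero => rw [pow_zero]; exact one
  | succ k ih => rw [pow_succ]; exact ih.mul hX

theorem smul (c : ℂ) (hX : UnifBdd X) : UnifBdd (c • X) := by
  obtain ⟨K, hK⟩ := hX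
  exact ⟨‖c‖ * K, fun n => by
    rw [Pi.smul_apply, norm_smul]; exact mul_le_mul_of_nonneg_left (hK n) (norm_nonneg c)⟩

theorem sum {J : Type*} (s : Finset J) {X : J → OpFam ι} (h : ∀ j ∈ s, UnifBdd (X j)) :
    UnifBdd (∑ j ∈ s, X j) :=
  Finset.sum_induction X UnifBdd (fun _ _ => add) zero h

end UnifBdd

theorem rank_add_le_add {m n : Type*} [Fintype m] [Fintype n] (A B : Matrix m n ℂ) :
    (A + B).rank ≤ A.rank + B.rank := by
  rw [Matrix.rank_eq_finrank_span_cols, Matrix.rank_eq_finrank_span_cols,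
    Matrix.rank_eq_finrank_span_cols]
  refine (Submodule.finrank_mono ?_).trans (Submodule.finrank_add_le_finrank_add_finrank
    (Submodule.span ℂ (Set.range A.col)) (Submodule.span ℂ (Set.range B.col)))
  rw [Submodule.span_le]
  rintro _ ⟨j, rfl⟩
  exact Submodule.add_mem_sup (Submodule.subset_span ⟨j, rfl⟩) (Submodule.subset_span ⟨j, rfl⟩)

theorem rank_sub_le_add {m : Type*} [Fintype m] [DecidableEq m]
    (A B : Matrix m m ℂ) : (A - B).rank ≤ A.rank + B.rank := by
  have h : A - B = A + B * (-1 : Matrix m m ℂ) := by rw [mul_neg, mul_one, sub_eq_add_neg]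
  rw [h]
  exact (rank_add_le_add _ _).trans (Nat.add_le_add_left (Matrix.rank_mul_le_left _ _) _)

/-- Factor the operator through its range. By cyclicity its trace is that of its compression to the
range, a sum of as many diagonal entries as the rank, each at most the operator norm. -/
theorem norm_trace_le_rank_mul_norm {m : Type*} [Fintype m] [DecidableEq m]
    (Y : Matrix m m ℂ) : ‖Y.trace‖ ≤ Y.rank * ‖Y‖ := by
  set T : EuclideanSpace ℂ m →ₗ[ℂ] EuclideanSpace ℂ m := Matrix.toEuclideanLin Y with hT
  have htr : Y.trace = LinearMap.trace ℂ _ T := by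
    rw [hT, Matrix.toEuclideanLin_eq_toLin_orthonormal, Matrix.trace_toLin_eq]
  set S := LinearMap.range T with hS
  have hrank : Y.rank = Module.finrank ℂ S := by
    rw [Matrix.rank_eq_finrank_range_toLin Y (EuclideanSpace.basisFun m ℂ).toBasis
      (EuclideanSpace.basisFun m ℂ).toBasis, hS, hT, Matrix.toEuclideanLin_eq_toLin_orthonormal]
  have hcomp : T = S.subtype ∘ₗ T.rangeRestrict := by ext x; rfl
  have htr2 : LinearMap.trace ℂ _ T
      = LinearMap.trace ℂ S (T.rangeRestrict ∘ₗ S.subtype) := by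
    conv_lhs => rw [hcomp]
    rw [LinearMap.trace_comp_comm']
  rw [htr, htr2, LinearMap.trace_eq_sum_inner _ (stdOrthonormalBasis ℂ S), hrank]
  refine (norm_sum_le _ _).trans ((Finset.sum_le_sum (g := fun _ => ‖Y‖) fun i _ => ?_).trans
    (by simp))
  refine (norm_inner_le_norm _ _).trans ?_
  have h1 : ‖(stdOrthonormalBasis ℂ S i : EuclideanSpace ℂ m)‖ = 1 :=
    (stdOrthonormalBasis ℂ S).orthonormal.1 i
  have h2 := (Matrix.toEuclideanCLM (n := m) (𝕜 := ℂ) Y).le_opNorm (stdOrthonormalBasis ℂ S i)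
  rw [h1, mul_one, Matrix.l2_opNorm_toEuclideanCLM] at h2
  rw [(stdOrthonormalBasis ℂ S).orthonormal.1 i, one_mul]
  exact h2

/-- Families whose approximation numbers decay like those of an operator of order `-s` in
dimension `d`, uniformly in the parameter. -/
def ApproxOrder (d s : ℕ) (X : OpFam ι) : Prop :=
  ∃ K : ℝ, 0 ≤ K ∧ ∀ n j, ∃ R : Matrix (ι n) (ι n) ℂ,
    (R.rank : ℝ) ≤ K * 2 ^ (j * d) ∧ ‖X n - R‖ ≤ K / 2 ^ (j * s)

namespace ApproxOrder

variable {X Y : OpFam ι} {d s t : ℕ}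

theorem of_unifBdd (hX : UnifBdd X) : ApproxOrder d 0 X := by
  obtain ⟨K, hK0, hK⟩ := hX.exists_nonneg
  exact ⟨K, hK0, fun n j => ⟨0, by simp; positivity, by simpa using hK n⟩⟩

theorem mul (hX : ApproxOrder d s X) (hY : ApproxOrder d t Y) :
    ApproxOrder d (s + t) (X * Y) := by
  obtain ⟨K, hK0, hK⟩ := hX
  obtain ⟨K', hK0', hK'⟩ := hY
  refine ⟨max (K + K') (K * K'), le_max_of_le_left (by positivity), fun n j => ?_⟩
  obtain ⟨R, hR, hR'⟩ := hK n j
  obtain ⟨S, hS, hS'⟩ := hK' n j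
  -- Chosen so that the error factors as `(X - R)(Y - S)`: the errors multiply while the ranks only
  -- add.
  refine ⟨R * Y n + (X n - R) * S, ?_, ?_⟩
  · have h1 : (R * Y n + (X n - R) * S).rank ≤ R.rank + S.rank :=
      (rank_add_le_add _ _).trans
        (add_le_add (Matrix.rank_mul_le_left _ _) (Matrix.rank_mul_le_right _ _))
    have h2 : ((R * Y n + (X n - R) * S).rank : ℝ) ≤ R.rank + S.rank := by exact_mod_cast h1
    have h3 : (K + K') * 2 ^ (j * d) ≤ max (K + K') (K * K') * 2 ^ (j * d) :=
      mul_le_mul_of_nonneg_right (le_max_left _ _) (by positivity)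
    linarith
  · have h1 : (X * Y) n - (R * Y n + (X n - R) * S) = (X n - R) * (Y n - S) := by
      rw [Pi.mul_apply]; noncomm_ring
    rw [h1]
    refine (norm_mul_le _ _).trans ((mul_le_mul hR' hS' (norm_nonneg _) (by positivity)).trans ?_)
    rw [div_mul_div_comm, ← pow_add, ← mul_add]
    exact div_le_div_of_nonneg_right (le_max_right _ _) (by positivity)

theorem mul_unifBdd (hX : ApproxOrder d s X) (hY : UnifBdd Y) : ApproxOrder d s (X * Y) := by
  simpa using hX.mul (of_unifBdd (d := d) hY)

theorem unifBdd_mul (hX : UnifBdd X) (hY : ApproxOrder d s Y) : ApproxOrder d s (X * Y) := by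
  simpa using (of_unifBdd (d := d) hX).mul hY

theorem pow (hX : ApproxOrder d s X) (k : ℕ) : ApproxOrder d (s * k) (X ^ k) := by
  induction k with
  | zero => rw [pow_zero, mul_zero]; exact of_unifBdd UnifBdd.one
  | succ k ih => rw [pow_succ, mul_add, mul_one]; exact ih.mul hX

open scoped ComplexOrder in
theorem star (hX : ApproxOrder d s X) : ApproxOrder d s (star X) := by
  obtain ⟨K, hK0, hK⟩ := hX
  refine ⟨K, hK0, fun n j => ?_⟩
  obtain ⟨R, hR, hR'⟩ := hK n j
  refine ⟨Rᴴ, by rwa [Matrix.rank_conjTranspose], ?_⟩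
  rw [Pi.star_apply, Matrix.star_eq_conjTranspose, ← Matrix.conjTranspose_sub,
    Matrix.l2_opNorm_conjTranspose]
  exact hR'

theorem mono (hX : ApproxOrder d s X) (hst : t ≤ s) : ApproxOrder d t X := by
  obtain ⟨K, hK0, hK⟩ := hX
  refine ⟨K, hK0, fun n j => ?_⟩
  obtain ⟨R, hR, hR'⟩ := hK n j
  refine ⟨R, hR, hR'.trans (div_le_div_of_nonneg_left hK0 (by positivity) ?_)⟩
  exact pow_le_pow_right₀ (by norm_num) (Nat.mul_le_mul_left j hst)

/-- Telescoping over the approximants: the `j`-th increment has rank `O(2^(jd))` and norm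
`O(2^(-j(d+1)))`, so its trace is `O(2^(-j))`, which is summable. The bound on the family itself
only serves to start with the approximant at `j = 0`. -/
theorem trace_bdd (hX : ApproxOrder d (d + 1) X) (hb : UnifBdd X) :
    ∃ K : ℝ, ∀ n, ‖(X n).trace‖ ≤ K := by
  obtain ⟨K, hK0, hK⟩ := hX
  obtain ⟨C, hC0, hC⟩ := hb.exists_nonneg
  choose R hR hR' using hK
  have hhalf : ∀ (j : ℕ), K * 2 ^ (j * d) * (K / 2 ^ (j * (d + 1))) = K * K * (1 / 2) ^ j := by
    intro j
    rw [mul_add, mul_one, pow_add, one_div, inv_pow]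
    field_simp
  have hstep : ∀ n j, ‖(R n (j + 1) - R n j).trace‖
      ≤ 2 * (K * K) * (2 ^ d + 1) * (1 / 2) ^ j := by
    intro n j
    refine (norm_trace_le_rank_mul_norm _).trans ?_
    have h1 : ((R n (j + 1) - R n j).rank : ℝ) ≤ K * 2 ^ (j * d) * (2 ^ d + 1) := by
      have h : ((R n (j + 1) - R n j).rank : ℝ) ≤ (R n (j + 1)).rank + (R n j).rank := by
        exact_mod_cast rank_sub_le_add (R n (j + 1)) (R n j)
      have h2 := hR n (j + 1)
      have h3 := hR n j
      have h4 : (2 : ℝ) ^ ((j + 1) * d) = 2 ^ (j * d) * 2 ^ d := by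
        rw [add_mul, one_mul, pow_add]
      rw [h4] at h2
      linarith
    have h2 : ‖R n (j + 1) - R n j‖ ≤ 2 * (K / 2 ^ (j * (d + 1))) := by
      have e : R n (j + 1) - R n j = (X n - R n j) - (X n - R n (j + 1)) := by abel
      have h3 : K / 2 ^ ((j + 1) * (d + 1)) ≤ K / 2 ^ (j * (d + 1)) :=
        div_le_div_of_nonneg_left hK0 (by positivity)
          (pow_le_pow_right₀ (by norm_num) (Nat.mul_le_mul_right _ (Nat.le_succ j)))
      rw [e]
      have := norm_sub_le (X n - R n j) (X n - R n (j + 1))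
      have h4 := hR' n j
      have h5 := hR' n (j + 1)
      linarith
    refine (mul_le_mul h1 h2 (norm_nonneg _) (by positivity)).trans (le_of_eq ?_)
    calc _ = 2 * (2 ^ d + 1) * (K * 2 ^ (j * d) * (K / 2 ^ (j * (d + 1)))) := by ring
      _ = _ := by rw [hhalf]; ring
  refine ⟨K * (C + K) + 4 * (K * K) * (2 ^ d + 1) + 1, fun n => ?_⟩
  have hJ : ∀ J, ‖(R n J).trace‖
      ≤ K * (C + K) + 2 * (K * K) * (2 ^ d + 1) * (2 - 2 * (1 / 2) ^ J) := by
    intro J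
    induction J with
    | zero =>
      have h1 : ‖R n 0‖ ≤ C + K := by
        have e : R n 0 = X n - (X n - R n 0) := by abel
        rw [e]
        have h4 := hR' n 0
        simp only [zero_mul, pow_zero, div_one] at h4
        exact (norm_sub_le _ _).trans (add_le_add (hC n) h4)
      have h2 := hR n 0
      simp only [zero_mul, pow_zero, mul_one] at h2
      have := (norm_trace_le_rank_mul_norm (R n 0)).trans
        (mul_le_mul h2 h1 (norm_nonneg _) hK0)
      simpa using this
    | succ J ih =>
      have e : (R n (J + 1)).trace = (R n J).trace + (R n (J + 1) - R n J).trace := by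
        rw [Matrix.trace_sub]; ring
      rw [e]
      refine (norm_add_le _ _).trans ((add_le_add ih (hstep n J)).trans (le_of_eq ?_))
      rw [pow_succ]; ring
  -- The cutoff `J` may depend on `n`: the telescoped bound is uniform in `J`, and the tail is
  -- estimated crudely by the full dimension.
  obtain ⟨J, hJ1⟩ : ∃ J : ℕ, Fintype.card (ι n) * (K * (1 / 2 : ℝ) ^ J) ≤ 1 := by
    have ht : Tendsto (fun J : ℕ => (Fintype.card (ι n) : ℝ) * (K * (1 / 2 : ℝ) ^ J)) atTop
        (𝓝 ((Fintype.card (ι n) : ℝ) * (K * 0))) :=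
      ((tendsto_pow_atTop_nhds_zero_of_lt_one (by norm_num) (by norm_num)).const_mul K).const_mul _
    rw [mul_zero, mul_zero] at ht
    exact (ht.eventually (eventually_le_nhds one_pos)).exists
  have htail : ‖(X n - R n J).trace‖ ≤ 1 := by
    refine (norm_trace_le_rank_mul_norm _).trans (le_trans ?_ hJ1)
    have h1 : ((X n - R n J).rank : ℝ) ≤ Fintype.card (ι n) := by
      exact_mod_cast Matrix.rank_le_card_width _
    refine mul_le_mul h1 ((hR' n J).trans ?_) (norm_nonneg _) (by positivity)
    rw [div_eq_mul_inv, one_div, inv_pow]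
    refine mul_le_mul_of_nonneg_left (inv_anti₀ (by positivity) ?_) hK0
    exact pow_le_pow_right₀ (by norm_num) (Nat.le_mul_of_pos_right J (Nat.succ_pos d))
  have e : (X n).trace = (R n J).trace + (X n - R n J).trace := by
    rw [Matrix.trace_sub]; ring
  rw [e]
  have h1 := hJ J
  have h2 := norm_add_le (R n J).trace (X n - R n J).trace
  have h3 : 0 ≤ 2 * (K * K) * (2 ^ d + 1) * (2 * (1 / 2 : ℝ) ^ J) := by positivity
  nlinarith

end ApproxOrder

end Families

/-! ### Quadratic forms and coercivity of matrices -/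

section QuadraticForms

open scoped Matrix.Norms.L2Operator

variable {m : Type*} [Fintype m] [DecidableEq m]

/-- The action of a square matrix on the Euclidean space. -/
noncomputable abbrev act (A : Matrix m m ℂ) (u : EuclideanSpace ℂ m) : EuclideanSpace ℂ m :=
  Matrix.toEuclideanCLM (n := m) (𝕜 := ℂ) A u

theorem act_mul (A B : Matrix m m ℂ) (u : EuclideanSpace ℂ m) :
    act (A * B) u = act A (act B u) := by
  simp [act]

theorem act_add (A B : Matrix m m ℂ) (u : EuclideanSpace ℂ m) :
    act (A + B) u = act A u + act B u := by
  simp [act]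

theorem act_sub (A B : Matrix m m ℂ) (u : EuclideanSpace ℂ m) :
    act (A - B) u = act A u - act B u := by
  simp [act]

theorem act_smul (c : ℂ) (A : Matrix m m ℂ) (u : EuclideanSpace ℂ m) :
    act (c • A) u = c • act A u := by
  simp [act]

theorem act_one (u : EuclideanSpace ℂ m) : act (1 : Matrix m m ℂ) u = u := by
  simp [act]

theorem norm_act_le (A : Matrix m m ℂ) (u : EuclideanSpace ℂ m) : ‖act A u‖ ≤ ‖A‖ * ‖u‖ := by
  rw [← Matrix.l2_opNorm_toEuclideanCLM]
  exact ContinuousLinearMap.le_opNorm _ _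

theorem norm_le_of_act {A : Matrix m m ℂ} {K : ℝ} (hK : 0 ≤ K)
    (h : ∀ u, ‖act A u‖ ≤ K * ‖u‖) : ‖A‖ ≤ K := by
  rw [← Matrix.l2_opNorm_toEuclideanCLM]
  exact ContinuousLinearMap.opNorm_le_bound _ hK h

theorem inner_act_left (A : Matrix m m ℂ) (u v : EuclideanSpace ℂ m) :
    inner ℂ (act A u) v = inner ℂ u (act (star A) v) := by
  rw [act, act, map_star, ContinuousLinearMap.star_eq_adjoint,
    ContinuousLinearMap.adjoint_inner_right]

/-- The real part of the quadratic form of a matrix. -/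
noncomputable def quad (A : Matrix m m ℂ) (u : EuclideanSpace ℂ m) : ℝ :=
  (inner ℂ u (act A u)).re

theorem quad_add (A B : Matrix m m ℂ) (u : EuclideanSpace ℂ m) :
    quad (A + B) u = quad A u + quad B u := by
  simp only [quad, act_add, inner_add_right, Complex.add_re]

theorem quad_smul (c : ℝ) (A : Matrix m m ℂ) (u : EuclideanSpace ℂ m) :
    quad ((c : ℂ) • A) u = c * quad A u := by
  simp only [quad, act_smul, inner_smul_right, Complex.re_ofReal_mul]

theorem quad_sum {J : Type*} (s : Finset J) (A : J → Matrix m m ℂ) (u : EuclideanSpace ℂ m) :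
    quad (∑ j ∈ s, A j) u = ∑ j ∈ s, quad (A j) u := by
  simp only [quad, act, map_sum, sum_apply, inner_sum, Complex.re_sum]

theorem quad_one (u : EuclideanSpace ℂ m) : quad (1 : Matrix m m ℂ) u = ‖u‖ ^ 2 := by
  rw [quad, act_one, inner_self_eq_norm_sq_to_K]
  norm_cast

theorem quad_star_mul (A B : Matrix m m ℂ) (u : EuclideanSpace ℂ m) :
    quad (star A * B) u = (inner ℂ (act A u) (act B u)).re := by
  rw [quad, inner_act_left, act_mul]

theorem quad_star_mul_self (A : Matrix m m ℂ) (u : EuclideanSpace ℂ m) :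
    quad (star A * A) u = ‖act A u‖ ^ 2 := by
  rw [quad_star_mul, inner_self_eq_norm_sq_to_K]
  norm_cast

theorem abs_quad_le (A : Matrix m m ℂ) (u : EuclideanSpace ℂ m) :
    |quad A u| ≤ ‖u‖ * ‖act A u‖ :=
  (Complex.abs_re_le_norm _).trans (norm_inner_le_norm _ _)

theorem quad_mono_of_nonneg {A : Matrix m m ℂ} {c : ℝ} (h : ∀ u, c * ‖u‖ ^ 2 ≤ quad A u)
    (u : EuclideanSpace ℂ m) : c * ‖u‖ ≤ ‖act A u‖ := by
  rcases eq_or_ne u 0 with rfl | hu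
  · simp
  · have hu' : 0 < ‖u‖ := norm_pos_iff.mpr hu
    have h1 := h u
    have h2 := (le_abs_self _).trans (abs_quad_le A u)
    nlinarith

theorem isUnit_of_coercive {A : Matrix m m ℂ} {c : ℝ} (hc : 0 < c)
    (h : ∀ u, c * ‖u‖ ^ 2 ≤ quad A u) : IsUnit A := by
  rw [← Matrix.mulVec_injective_iff_isUnit, ← Matrix.coe_mulVecLin, ← LinearMap.ker_eq_bot,
    LinearMap.ker_eq_bot']
  intro x hx
  have h1 := quad_mono_of_nonneg h (WithLp.toLp 2 x)
  have h2 : act A (WithLp.toLp 2 x) = 0 := by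
    rw [act, Matrix.toEuclideanCLM_toLp, ← Matrix.mulVecLin_apply, hx]; rfl
  rw [h2, norm_zero] at h1
  have h3 : ‖(WithLp.toLp 2 x : EuclideanSpace ℂ m)‖ = 0 := by
    nlinarith [norm_nonneg (WithLp.toLp 2 x : EuclideanSpace ℂ m)]
  have h4 := norm_eq_zero.mp h3
  simpa using congrArg WithLp.ofLp h4

theorem norm_inverse_le_of_coercive {A B : Matrix m m ℂ} {c : ℝ} (hc : 0 < c)
    (h : ∀ u, c * ‖u‖ ^ 2 ≤ quad A u) (hAB : A * B = 1) : ‖B‖ ≤ c⁻¹ := by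
  refine norm_le_of_act (by positivity) fun u => ?_
  have h1 := quad_mono_of_nonneg h (act B u)
  rw [← act_mul, hAB, act_one] at h1
  rwa [← div_eq_inv_mul, le_div_iff₀ hc, mul_comm]

end QuadraticForms

/-! ### Abstract lattice gradients and the ellipticity estimate -/

section Gradient

set_option linter.unusedSectionVars false

open scoped Matrix.Norms.L2Operator

variable {ι : ℕ → Type} [∀ n, Fintype (ι n)] [∀ n, DecidableEq (ι n)]

/-- Multiplication of a family of matrices by a sequence of real numbers. -/
noncomputable def scale (a : ℕ → ℝ) (X : OpFam ι) : OpFam ι := fun n => (a n : ℂ) • X n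

section scale

variable (a : ℕ → ℝ) (X Y : OpFam ι)

theorem scale_mul : scale a X * Y = scale a (X * Y) := by
  funext n; simp [scale]

theorem mul_scale : X * scale a Y = scale a (X * Y) := by
  funext n; simp [scale]

theorem scale_add : scale a (X + Y) = scale a X + scale a Y := by
  funext n; simp [scale]

theorem scale_sub : scale a (X - Y) = scale a X - scale a Y := by
  funext n; simp [scale, smul_sub]

theorem scale_neg : scale a (-X) = -scale a X := by
  funext n; simp [scale]

theorem scale_smul (c : ℂ) : scale a (c • X) = c • scale a X := by
  funext n; simp [scale, smul_comm c]

theorem star_scale : star (scale a X) = scale a (star X) := by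
  funext n; simp [scale]

theorem scale_sum {J : Type*} (s : Finset J) (Z : J → OpFam ι) :
    scale a (∑ j ∈ s, Z j) = ∑ j ∈ s, scale a (Z j) := by
  funext n; simp [scale, Finset.smul_sum]

end scale

theorem UnifBdd.scale {a : ℕ → ℝ} {X : OpFam ι} (hX : UnifBdd X) (ha : ∀ n, 0 < a n)
    (ha' : ∃ a₀, ∀ n, a n ≤ a₀) : UnifBdd (scale a X) := by
  obtain ⟨a₀, ha₀⟩ := ha'
  obtain ⟨K, hK0, hK⟩ := hX.exists_nonneg
  refine ⟨a₀ * K, fun n => ?_⟩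
  have h1 : ‖(a n : ℂ)‖ = a n := by simp [abs_of_pos (ha n)]
  rw [WilsonFermion.scale, norm_smul, h1]
  exact mul_le_mul (ha₀ n) (hK n) (norm_nonneg _) ((ha n).le.trans (ha₀ n))

/-- The properties of covariant forward differences `P μ = (T_μ - 1) / a` of unitary translations
`T_μ` in a smooth background field that are used in the estimates. -/
structure IsLatticeGradient {J : Type} (a : ℕ → ℝ) (P : J → OpFam ι) : Prop where
  pos : ∀ n, 0 < a n
  normal : ∀ μ, star (P μ) * P μ = P μ * star (P μ)
  add_star : ∀ μ, P μ + star (P μ) = -scale a (star (P μ) * P μ)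
  comm : ∀ μ ν, UnifBdd (P μ * P ν - P ν * P μ)
  comm_star : ∀ μ ν, UnifBdd (P μ * star (P ν) - star (P ν) * P μ)
  comm_comm : ∀ μ ν, UnifBdd (star (P ν) * (P μ * P ν - P ν * P μ)
    - (P μ * P ν - P ν * P μ) * star (P ν))
  comm_comm_star : ∀ μ ν, UnifBdd (star (P ν) * (star (P μ) * P ν - P ν * star (P μ))
    - (star (P μ) * P ν - P ν * star (P μ)) * star (P ν))

/-- The symmetric difference `D = (P - P^*) / 2`. -/
noncomputable def symmDiff {J : Type} (P : J → OpFam ι) (μ : J) : OpFam ι :=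
  (1 / 2 : ℂ) • (P μ - star (P μ))

/-- The operator `M + (r a / 2) ∑ P^* P`. -/
noncomputable def massOp {J : Type} [Fintype J] (a : ℕ → ℝ) (P : J → OpFam ι) (M r : ℝ) :
    OpFam ι :=
  (M : ℂ) • (1 : OpFam ι) + ((r / 2 : ℝ) : ℂ) • scale a (∑ μ, star (P μ) * P μ)

namespace IsLatticeGradient

variable {J : Type} {a : ℕ → ℝ} {P : J → OpFam ι}

/-- The field `add_star` is unitarity of `1 + aP` in disguise. It gives `(aP)*(aP) = -(aP + (aP)*)`,
and the C*-identity turns this into `‖aP‖² ≤ 2‖aP‖`. -/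
theorem unifBdd_scale_self (h : IsLatticeGradient a P) (μ : J) : UnifBdd (scale a (P μ)) := by
  refine ⟨2, fun n => ?_⟩
  have h1 : star (scale a (P μ)) * scale a (P μ) = -(scale a (P μ) + star (scale a (P μ))) := by
    rw [star_scale, ← scale_add, h.add_star, scale_neg, neg_neg, scale_mul, mul_scale]
  have h2 := congrFun h1 n
  have h3 : ‖scale a (P μ) n‖ * ‖scale a (P μ) n‖ ≤ 2 * ‖scale a (P μ) n‖ := by
    rw [← CStarRing.norm_star_mul_self]
    simp only [Pi.mul_apply, Pi.star_apply, Pi.neg_apply, Pi.add_apply] at h2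
    rw [h2, norm_neg]
    refine (norm_add_le _ _).trans ?_
    rw [norm_star]; linarith
  by_contra hc
  push Not at hc
  nlinarith

theorem star_symmDiff (μ : J) : star (symmDiff P μ) = -symmDiff P μ := by
  rw [symmDiff, star_smul, star_sub, star_star, ← smul_neg, neg_sub]
  simp

theorem unifBdd_scale_symmDiff (h : IsLatticeGradient a P) (μ : J) :
    UnifBdd (scale a (symmDiff P μ)) := by
  rw [symmDiff, scale_smul, scale_sub, ← star_scale]
  exact ((h.unifBdd_scale_self μ).sub (h.unifBdd_scale_self μ).star).smul _

/-- The operator version of `4 sin²(θ/2) = sin² θ + 4 sin⁴(θ/2)`. The last term is what the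
symmetric difference fails to see near the doublers. -/
theorem star_mul_self_eq (h : IsLatticeGradient a P) (μ : J) :
    star (P μ) * P μ = star (symmDiff P μ) * symmDiff P μ
      + (1 / 4 : ℂ) • (scale a (star (P μ) * P μ) * scale a (star (P μ) * P μ)) := by
  have h1 : scale a (star (P μ) * P μ) = -(P μ + star (P μ)) := by rw [h.add_star, neg_neg]
  rw [h1, star_symmDiff, symmDiff]
  have h2 := h.normal μ
  have h3 : (-(P μ + star (P μ))) * (-(P μ + star (P μ)))
      = (P μ - star (P μ)) * (P μ - star (P μ)) + (4 : ℂ) • (star (P μ) * P μ) := by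
    rw [show (4 : ℂ) • (star (P μ) * P μ)
        = (2 : ℂ) • (star (P μ) * P μ) + (2 : ℂ) • (star (P μ) * P μ) by
      rw [← add_smul]; norm_num]
    nth_rw 2 [h2]
    simp only [two_smul]
    noncomm_ring
  rw [h3, neg_mul, smul_mul_smul_comm, smul_add, smul_smul]
  norm_num

theorem comm_star_star (h : IsLatticeGradient a P) (μ ν : J) :
    UnifBdd (star (P μ) * star (P ν) - star (P ν) * star (P μ)) := by
  have := (h.comm ν μ).star
  rwa [star_sub, star_mul, star_mul] at this

theorem comm_star' (h : IsLatticeGradient a P) (μ ν : J) :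
    UnifBdd (star (P μ) * P ν - P ν * star (P μ)) := by
  have := (h.comm_star ν μ).neg
  rwa [neg_sub] at this

theorem symmDiff_comm (h : IsLatticeGradient a P) (μ ν : J) :
    UnifBdd (symmDiff P μ * P ν - P ν * symmDiff P μ) := by
  have : symmDiff P μ * P ν - P ν * symmDiff P μ
      = (1 / 2 : ℂ) • ((P μ * P ν - P ν * P μ) - (star (P μ) * P ν - P ν * star (P μ))) := by
    simp only [symmDiff, smul_mul_assoc, mul_smul_comm, ← smul_sub]
    congr 1; noncomm_ring
  rw [this]
  exact ((h.comm μ ν).sub (h.comm_star' μ ν)).smul _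

theorem symmDiff_comm_star (h : IsLatticeGradient a P) (μ ν : J) :
    UnifBdd (symmDiff P μ * star (P ν) - star (P ν) * symmDiff P μ) := by
  have : symmDiff P μ * star (P ν) - star (P ν) * symmDiff P μ
      = (1 / 2 : ℂ) • ((P μ * star (P ν) - star (P ν) * P μ)
        - (star (P μ) * star (P ν) - star (P ν) * star (P μ))) := by
    simp only [symmDiff, smul_mul_assoc, mul_smul_comm, ← smul_sub]
    congr 1; noncomm_ring
  rw [this]
  exact ((h.comm_star μ ν).sub (h.comm_star_star μ ν)).smul _

theorem symmDiff_comm_symmDiff (h : IsLatticeGradient a P) (μ ν : J) :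
    UnifBdd (symmDiff P μ * symmDiff P ν - symmDiff P ν * symmDiff P μ) := by
  have : symmDiff P μ * symmDiff P ν - symmDiff P ν * symmDiff P μ
      = (1 / 2 : ℂ) • ((symmDiff P μ * P ν - P ν * symmDiff P μ)
        - (symmDiff P μ * star (P ν) - star (P ν) * symmDiff P μ)) := by
    rw [symmDiff.eq_1 P ν]
    simp only [smul_mul_assoc, mul_smul_comm, ← smul_sub]
    congr 1; noncomm_ring
  rw [this]
  exact ((h.symmDiff_comm μ ν).sub (h.symmDiff_comm_star μ ν)).smul _

/-- Needed when `P*` is moved across `[D, P]` in the expansion of `[D, 𝓛]`. -/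
theorem comm_symmDiff_comm (h : IsLatticeGradient a P) (μ ν : J) :
    UnifBdd (star (P ν) * (symmDiff P μ * P ν - P ν * symmDiff P μ)
      - (symmDiff P μ * P ν - P ν * symmDiff P μ) * star (P ν)) := by
  have : star (P ν) * (symmDiff P μ * P ν - P ν * symmDiff P μ)
      - (symmDiff P μ * P ν - P ν * symmDiff P μ) * star (P ν)
      = (1 / 2 : ℂ) • ((star (P ν) * (P μ * P ν - P ν * P μ)
        - (P μ * P ν - P ν * P μ) * star (P ν))
        - (star (P ν) * (star (P μ) * P ν - P ν * star (P μ))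
        - (star (P μ) * P ν - P ν * star (P μ)) * star (P ν))) := by
    simp only [symmDiff, smul_mul_assoc, mul_smul_comm, ← smul_sub]
    congr 1; noncomm_ring
  rw [this]
  exact ((h.comm_comm μ ν).sub (h.comm_comm_star μ ν)).smul _

section MassOp

variable [Fintype J]

theorem quad_massOp (n : ℕ) (M r : ℝ) (u : EuclideanSpace ℂ (ι n)) :
    quad (massOp a P M r n) u
      = M * ‖u‖ ^ 2 + r / 2 * (a n * ∑ μ, ‖act (P μ n) u‖ ^ 2) := by
  simp only [massOp, Pi.add_apply, Pi.smul_apply, Pi.one_apply, scale, Finset.sum_apply,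
    Pi.mul_apply, Pi.star_apply]
  rw [quad_add, quad_smul, quad_smul, quad_smul, quad_one, quad_sum]
  simp only [quad_star_mul_self]

theorem le_quad_massOp (h : IsLatticeGradient a P) {M r : ℝ} (hr : 0 < r) (n : ℕ)
    (u : EuclideanSpace ℂ (ι n)) : M * ‖u‖ ^ 2 ≤ quad (massOp a P M r n) u := by
  rw [quad_massOp]
  have := h.pos n
  have : 0 ≤ r / 2 * (a n * ∑ μ, ‖act (P μ n) u‖ ^ 2) := by positivity
  linarith

theorem star_massOp (M r : ℝ) : star (massOp a P M r) = massOp a P M r := by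
  simp only [massOp, star_add, star_smul, star_scale, star_sum, star_mul, star_star, star_one]
  simp

/-- The positive operator `L² + ∑ D^* D`. -/
noncomputable def ellipticOp (a : ℕ → ℝ) (P : J → OpFam ι) (M r : ℝ) : OpFam ι :=
  massOp a P M r * massOp a P M r - ∑ μ, symmDiff P μ * symmDiff P μ

theorem star_ellipticOp (M r : ℝ) : star (ellipticOp a P M r) = ellipticOp a P M r := by
  simp only [ellipticOp, star_sub, star_mul, star_massOp, star_sum, star_symmDiff, neg_mul_neg]

theorem quad_ellipticOp (n : ℕ) (M r : ℝ) (u : EuclideanSpace ℂ (ι n)) :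
    quad (ellipticOp a P M r n) u
      = ‖act (massOp a P M r n) u‖ ^ 2 + ∑ μ, ‖act (symmDiff P μ n) u‖ ^ 2 := by
  have h1 : ellipticOp a P M r = star (massOp a P M r) * massOp a P M r
      + ∑ μ, star (symmDiff P μ) * symmDiff P μ := by
    simp only [ellipticOp, star_massOp, star_symmDiff, neg_mul, Finset.sum_neg_distrib,
      sub_eq_add_neg]
  simp only [h1, Pi.add_apply, Pi.mul_apply, Pi.star_apply, Finset.sum_apply]
  rw [quad_add, quad_sum, quad_star_mul_self]
  simp only [quad_star_mul_self]

theorem norm_le_massOp (h : IsLatticeGradient a P) {M r : ℝ} (hr : 0 < r) (n : ℕ)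
    (u : EuclideanSpace ℂ (ι n)) : M * ‖u‖ ≤ ‖act (massOp a P M r n) u‖ :=
  quad_mono_of_nonneg (h.le_quad_massOp hr n) u

/-- `k_μ = a P_μ^* P_μ` satisfies `k_μ k_ν ≥ -C` up to a uniformly bounded error. -/
theorem exists_quad_mul_ge (h : IsLatticeGradient a P) (μ ν : J) :
    ∃ C : ℝ, 0 ≤ C ∧ ∀ n (u : EuclideanSpace ℂ (ι n)), -(C * ‖u‖ ^ 2) ≤
      quad ((scale a (star (P μ) * P μ) * scale a (star (P ν) * P ν)) n) u := by
  set Y := scale a (P μ * P ν) with hY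
  have e : scale a (star (P μ) * P μ) * scale a (star (P ν) * P ν) = star Y * Y
      + (star (scale a (P μ)) * (P μ * star (P ν) - star (P ν) * P μ)
        + (star (P μ) * star (P ν) - star (P ν) * star (P μ)) * scale a (P μ))
          * scale a (P ν) := by
    simp only [hY, star_scale, scale_mul, mul_scale, star_mul, ← scale_add, add_mul]
    congr 2
    noncomm_ring
  obtain ⟨C, hC0, hC⟩ := (((((h.unifBdd_scale_self μ).star.mul (h.comm_star μ ν)).add
    ((h.comm_star_star μ ν).mul (h.unifBdd_scale_self μ))).mul
      (h.unifBdd_scale_self ν))).exists_nonneg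
  refine ⟨C, hC0, fun n u => ?_⟩
  rw [e, Pi.add_apply, quad_add, Pi.mul_apply, Pi.star_apply, quad_star_mul_self]
  have h1 := abs_quad_le (((star (scale a (P μ)) * (P μ * star (P ν) - star (P ν) * P μ)
        + (star (P μ) * star (P ν) - star (P ν) * star (P μ)) * scale a (P μ))
          * scale a (P ν)) n) u
  have h2 := norm_act_le (((star (scale a (P μ)) * (P μ * star (P ν) - star (P ν) * P μ)
        + (star (P μ) * star (P ν) - star (P ν) * star (P μ)) * scale a (P μ))
          * scale a (P ν)) n) u
  have h3 := h2.trans (mul_le_mul_of_nonneg_right (hC n) (norm_nonneg u))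
  have h4 := h1.trans (mul_le_mul_of_nonneg_left h3 (norm_nonneg u))
  have h5 := neg_le_of_abs_le h4
  nlinarith [sq_nonneg ‖act (Y n) u‖]

/-- Ellipticity of `H`. By `star_mul_self_eq`, `P*P` is `D*D`, which occurs in `H`, plus a quarter
of `k_μ²` with `k_μ = aP_μ*P_μ`. Since the products `k_μ k_ν` are bounded below, `k_μ²` is dominated
by `(∑ k)²` up to a constant, and both are dominated by `𝓛²` because `𝓛 = M + (r/2) ∑ k` and `𝓛 ≥
M`. -/
theorem exists_norm_sq_le (h : IsLatticeGradient a P) {M r : ℝ} (hM : 0 < M) (hr : 0 < r)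
    (μ : J) : ∃ K : ℝ, 0 ≤ K ∧ ∀ n (u : EuclideanSpace ℂ (ι n)),
      ‖act (P μ n) u‖ ^ 2 ≤ K * quad (ellipticOp a P M r n) u := by
  classical
  choose C hC0 hC using fun p : J × J => h.exists_quad_mul_ge p.1 p.2
  set k : J → OpFam ι := fun μ => scale a (star (P μ) * P μ) with hk
  have hks : ∀ μ, star (k μ) = k μ := fun μ => by simp [hk, star_scale]
  set C' := ∑ p, C p with hC'
  have hC'0 : 0 ≤ C' := Finset.sum_nonneg fun p _ => hC0 p
  refine ⟨1 + (16 / r ^ 2 + C' / M ^ 2) / 4, by positivity, fun n u => ?_⟩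
  have h1 : ‖act (P μ n) u‖ ^ 2
      = ‖act (symmDiff P μ n) u‖ ^ 2 + 1 / 4 * ‖act (k μ n) u‖ ^ 2 := by
    have := congrFun (h.star_mul_self_eq μ) n
    change _ = (star (symmDiff P μ) * symmDiff P μ + (1 / 4 : ℂ) • (k μ * k μ)) n at this
    nth_rw 1 [← hks μ] at this
    simp only [Pi.mul_apply, Pi.add_apply, Pi.star_apply, Pi.smul_apply] at this
    rw [← quad_star_mul_self, this, quad_add, quad_star_mul_self]
    rw [show (1 / 4 : ℂ) = ((1 / 4 : ℝ) : ℂ) by norm_num, quad_smul, quad_star_mul_self]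
  have h2 : ‖act ((∑ ν, k ν) n) u‖ ^ 2 = ∑ p : J × J, quad ((k p.1 * k p.2) n) u := by
    rw [← quad_star_mul_self, ← Pi.star_apply, star_sum]
    simp only [hks]
    rw [← Pi.mul_apply, Finset.sum_mul_sum, Fintype.sum_prod_type, Finset.sum_apply, quad_sum]
    refine Finset.sum_congr rfl fun i _ => ?_
    rw [Finset.sum_apply, quad_sum]
  -- In the double sum for `(∑ k)²` only the entry `(μ, μ)` is kept; all the others are bounded
  -- below by `exists_quad_mul_ge`.
  have h3 : ‖act (k μ n) u‖ ^ 2 - C' * ‖u‖ ^ 2 ≤ ‖act ((∑ ν, k ν) n) u‖ ^ 2 := by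
    rw [h2]
    have h4 : ∀ p : J × J, (if p = (μ, μ) then ‖act (k μ n) u‖ ^ 2 else 0) - C p * ‖u‖ ^ 2
        ≤ quad ((k p.1 * k p.2) n) u := by
      intro p
      split_ifs with hp
      · subst hp
        have : quad ((k μ * k μ) n) u = ‖act (k μ n) u‖ ^ 2 := by
          nth_rw 1 [← hks μ]
          rw [Pi.mul_apply, Pi.star_apply, quad_star_mul_self]
        rw [this]
        have := mul_nonneg (hC0 (μ, μ)) (sq_nonneg ‖u‖)
        linarith
      · rw [zero_sub]
        exact hC p n u
    refine le_trans (le_of_eq ?_) (Finset.sum_le_sum fun p _ => h4 p)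
    rw [Finset.sum_sub_distrib, Finset.sum_ite_eq' Finset.univ (μ, μ), ← Finset.sum_mul]
    simp [hC']
  have h5 : act (massOp a P M r n) u = (M : ℂ) • u + ((r / 2 : ℝ) : ℂ) • act ((∑ ν, k ν) n) u := by
    rw [massOp, scale_sum]
    simp only [Pi.add_apply, Pi.smul_apply, Pi.one_apply]
    rw [act_add, act_smul, act_smul, act_one]
  obtain ⟨x, hx⟩ : ∃ x, x = ‖act (massOp a P M r n) u‖ := ⟨_, rfl⟩
  have h6 : M * ‖u‖ ≤ x := hx ▸ h.norm_le_massOp hr n u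
  -- Triangle inequality for `(r/2) ∑ k = 𝓛 - M`, with `M‖u‖ ≤ x`; this is the origin of the
  -- constant `16 / r²`.
  have h7 : r / 2 * ‖act ((∑ ν, k ν) n) u‖ ≤ 2 * x := by
    have e : ((r / 2 : ℝ) : ℂ) • act ((∑ ν, k ν) n) u
        = act (massOp a P M r n) u - (M : ℂ) • u := by rw [h5]; abel
    have e2 := norm_sub_le (act (massOp a P M r n) u) ((M : ℂ) • u)
    rw [← e, norm_smul, norm_smul, Complex.norm_real, Complex.norm_real,
      ← hx, Real.norm_of_nonneg hM.le, Real.norm_of_nonneg (by positivity)] at e2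
    linarith
  have h8 : ‖act ((∑ ν, k ν) n) u‖ ^ 2 ≤ 16 / r ^ 2 * x ^ 2 := by
    have e : ‖act ((∑ ν, k ν) n) u‖ ≤ 4 / r * x := by
      rw [div_mul_eq_mul_div, le_div_iff₀ hr]; linarith
    have := pow_le_pow_left₀ (norm_nonneg _) e 2
    rwa [mul_pow, div_pow, show (4 : ℝ) ^ 2 = 16 by norm_num] at this
  have h9 : C' * ‖u‖ ^ 2 ≤ C' / M ^ 2 * x ^ 2 := by
    have := pow_le_pow_left₀ (by positivity) h6 2
    rw [div_mul_eq_mul_div, le_div_iff₀ (by positivity), mul_assoc, mul_comm (‖u‖ ^ 2), ← mul_pow]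
    exact mul_le_mul_of_nonneg_left this hC'0
  rw [quad_ellipticOp, h1, ← hx]
  have h10 : ‖act (symmDiff P μ n) u‖ ^ 2 ≤ ∑ ν, ‖act (symmDiff P ν n) u‖ ^ 2 :=
    Finset.single_le_sum (f := fun ν => ‖act (symmDiff P ν n) u‖ ^ 2)
      (fun ν _ => sq_nonneg _) (Finset.mem_univ μ)
  have arith : ∀ p q w α β y c : ℝ, p ≤ w → q - c ≤ y → y ≤ α * x ^ 2 → c ≤ β * x ^ 2 →
      0 ≤ (α + β) * w → p + 1 / 4 * q ≤ (1 + (α + β) / 4) * (x ^ 2 + w) := by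
    intro p q w α β y c h1 h2 h3 h4 h5
    have : (1 + (α + β) / 4) * (x ^ 2 + w)
      = x ^ 2 + w + (α * x ^ 2 + β * x ^ 2) / 4 + (α + β) * w / 4 := by ring
    linarith [sq_nonneg x]
  exact arith _ _ _ _ _ _ _ h10 h3 h8 h9 (mul_nonneg
    (add_nonneg (by positivity) (div_nonneg hC'0 (sq_nonneg M)))
    (Finset.sum_nonneg fun _ _ => sq_nonneg _))

end MassOp

end IsLatticeGradient

end Gradient

/-! ### Energy estimates and coercivity for the Schur complement -/

section Resolvent

set_option linter.unusedSectionVars false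

open scoped Matrix.Norms.L2Operator

variable {ι : ℕ → Type} [∀ n, Fintype (ι n)] [∀ n, DecidableEq (ι n)]

theorem star_inverse_eq {R : Type*} [Ring R] [StarRing R] {x y : R} (hx : star x = x)
    (hxy : x * y = 1) : star y = y := by
  have h1 : star y * x = 1 := by rw [← hx, ← star_mul, hxy, star_one]
  calc star y = star y * (x * y) := by rw [hxy, mul_one]
    _ = y := by rw [← mul_assoc, h1, one_mul]

namespace IsLatticeGradient

variable {J : Type} [Fintype J] {a : ℕ → ℝ} {P : J → OpFam ι}

theorem norm_act_star (h : IsLatticeGradient a P) (μ : J) (n : ℕ)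
    (u : EuclideanSpace ℂ (ι n)) : ‖act (star (P μ n)) u‖ = ‖act (P μ n) u‖ := by
  have h1 := congrFun (h.normal μ) n
  simp only [Pi.mul_apply, Pi.star_apply] at h1
  have h2 := quad_star_mul_self (star (P μ n)) u
  rw [star_star, ← h1, quad_star_mul_self] at h2
  exact ((sq_eq_sq₀ (norm_nonneg _) (norm_nonneg _)).mp h2).symm

theorem norm_act_symmDiff_le (h : IsLatticeGradient a P) (μ : J) (n : ℕ)
    (u : EuclideanSpace ℂ (ι n)) : ‖act (symmDiff P μ n) u‖ ≤ ‖act (P μ n) u‖ := by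
  rw [symmDiff, Pi.smul_apply, act_smul, norm_smul, Pi.sub_apply, act_sub, Pi.star_apply]
  have h1 := norm_sub_le (act (P μ n) u) (act (star (P μ n)) u)
  rw [h.norm_act_star] at h1
  have h2 : ‖(1 / 2 : ℂ)‖ = 1 / 2 := by norm_num
  rw [h2]
  linarith

theorem unifBdd_massInv (h : IsLatticeGradient a P) {M r : ℝ} (hM : 0 < M) (hr : 0 < r)
    {Li : OpFam ι} (hLi : massOp a P M r * Li = 1) : UnifBdd Li :=
  ⟨M⁻¹, fun n => norm_inverse_le_of_coercive hM (h.le_quad_massOp hr n) (congrFun hLi n)⟩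

/-- Energy estimate: test `𝓛 v = D_ν f` with `v`. The form of `𝓛` contains `(r/2) a ∑ ‖P v‖²`, while
skewness of `D_ν` bounds the right side by `‖P_ν v‖ ‖f‖`. -/
theorem unifBdd_scale_grad_massInv_symmDiff (h : IsLatticeGradient a P) {M r : ℝ} (hM : 0 < M)
    (hr : 0 < r) {Li : OpFam ι} (hLi : massOp a P M r * Li = 1) (ρ ν : J) :
    UnifBdd (scale a (P ρ * Li * symmDiff P ν)) := by
  refine ⟨2 / r, fun n => norm_le_of_act (by positivity) fun f => ?_⟩
  have ha := h.pos n
  set v := act (Li n) (act (symmDiff P ν n) f) with hv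
  have h0 : act (massOp a P M r n) v = act (symmDiff P ν n) f := by
    have := congrFun hLi n
    simp only [Pi.mul_apply, Pi.one_apply] at this
    rw [hv, ← act_mul, this, act_one]
  have h1 : quad (massOp a P M r n) v ≤ ‖act (P ν n) v‖ * ‖f‖ := by
    rw [quad, h0]
    have h2 : inner ℂ v (act (symmDiff P ν n) f)
        = -inner ℂ (act (symmDiff P ν n) v) f := by
      rw [inner_act_left (symmDiff P ν n) v f, ← Pi.star_apply, star_symmDiff, Pi.neg_apply]
      simp [act]
    rw [h2, Complex.neg_re]
    refine (neg_le_abs _).trans ((Complex.abs_re_le_norm _).trans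
      ((norm_inner_le_norm _ _).trans ?_))
    exact mul_le_mul_of_nonneg_right (h.norm_act_symmDiff_le ν n v) (norm_nonneg f)
  rw [quad_massOp] at h1
  have h3 : ∀ μ, r / 2 * (a n * ‖act (P μ n) v‖ ^ 2) ≤ ‖act (P ν n) v‖ * ‖f‖ := by
    intro μ
    have h4 : ‖act (P μ n) v‖ ^ 2 ≤ ∑ μ, ‖act (P μ n) v‖ ^ 2 :=
      Finset.single_le_sum (f := fun μ => ‖act (P μ n) v‖ ^ 2)
        (fun _ _ => sq_nonneg _) (Finset.mem_univ μ)
    have h5 : r / 2 * (a n * ‖act (P μ n) v‖ ^ 2)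
        ≤ r / 2 * (a n * ∑ μ, ‖act (P μ n) v‖ ^ 2) := by gcongr
    have : 0 ≤ M * ‖v‖ ^ 2 := by positivity
    linarith
  have e : act (scale a (P ρ * Li * symmDiff P ν) n) f = (a n : ℂ) • act (P ρ n) v := by
    rw [scale, act_smul, Pi.mul_apply, Pi.mul_apply, act_mul, act_mul]
  have e2 : ‖(a n : ℂ)‖ = a n := by simp [abs_of_pos ha]
  rw [e, norm_smul, e2]
  have hx := h3 ν
  have hy := h3 ρ
  obtain ⟨x, hxe⟩ : ∃ x, x = ‖act (P ν n) v‖ := ⟨_, rfl⟩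
  obtain ⟨y, hye⟩ : ∃ y, y = ‖act (P ρ n) v‖ := ⟨_, rfl⟩
  have hx0 : 0 ≤ x := hxe ▸ norm_nonneg _
  have hy0 : 0 ≤ y := hye ▸ norm_nonneg _
  have hF := norm_nonneg f
  rw [← hxe] at hx hy
  rw [← hye] at hy ⊢
  generalize ‖f‖ = F at *
  generalize a n = α at *
  -- Taking `ρ = ν` first allows one factor `‖P_ν v‖` to be cancelled; the result is then inserted
  -- in the estimate for general `ρ`.
  have hx1 : r / 2 * (α * x) ≤ F := by
    rcases hx0.eq_or_lt with h0 | h0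
    · rw [← h0]; simpa using hF
    · have : x * (r / 2 * (α * x)) ≤ x * F := by linarith
      exact le_of_mul_le_mul_left this h0
  have hy1 : (r / 2 * (α * y)) ^ 2 ≤ F ^ 2 := by
    have h6 : (r / 2 * (α * y)) ^ 2 = r / 2 * α * (r / 2 * (α * y ^ 2)) := by ring
    have h7 : r / 2 * α * (r / 2 * (α * y ^ 2)) ≤ r / 2 * α * (x * F) :=
      mul_le_mul_of_nonneg_left hy (by positivity)
    have h8 : r / 2 * α * (x * F) = r / 2 * (α * x) * F := by ring
    have h9 : r / 2 * (α * x) * F ≤ F * F := mul_le_mul_of_nonneg_right hx1 hF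
    rw [h6]; linarith [sq F]
  have hy2 := abs_le_of_sq_le_sq hy1 hF
  have hy3 := (abs_le.mp hy2).2
  rw [div_mul_eq_mul_div, le_div_iff₀ hr]
  linarith

theorem unifBdd_scale_star_grad_massInv_symmDiff (h : IsLatticeGradient a P) {M r : ℝ}
    (hM : 0 < M) (hr : 0 < r) {Li : OpFam ι} (hLi : massOp a P M r * Li = 1) (ρ ν : J) :
    UnifBdd (scale a (star (P ρ) * Li * symmDiff P ν)) := by
  obtain ⟨K, hK0, hK⟩ :=
    (h.unifBdd_scale_grad_massInv_symmDiff hM hr hLi ρ ν).exists_nonneg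
  refine ⟨K, fun n => norm_le_of_act hK0 fun f => ?_⟩
  refine le_trans (le_of_eq ?_) ((norm_act_le _ f).trans
    (mul_le_mul_of_nonneg_right (hK n) (norm_nonneg f)))
  simp only [scale, act_smul, Pi.mul_apply, Pi.star_apply, mul_assoc]
  rw [act_mul _ (Li n * symmDiff P ν n), act_mul _ (Li n * symmDiff P ν n), norm_smul, norm_smul,
    h.norm_act_star]

/-- The commutator `[D_μ, L]` is of first order with a coefficient of size `a`. -/
theorem unifBdd_massComm_massInv_symmDiff (h : IsLatticeGradient a P) {M r : ℝ}
    (hM : 0 < M) (hr : 0 < r) {Li : OpFam ι} (hLi : massOp a P M r * Li = 1) (μ ν : J) :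
    UnifBdd ((symmDiff P μ * massOp a P M r - massOp a P M r * symmDiff P μ)
      * Li * symmDiff P ν) := by
  -- Leibniz rule for `[D, P*P]`, with `P*` moved to the right of `[D, P]`, so that each remaining
  -- difference stands next to `𝓛⁻¹ D`, where the energy estimate absorbs it together with the
  -- factor `a`. The price is a double commutator, for which `aD` is bounded.
  have e1 : symmDiff P μ * massOp a P M r - massOp a P M r * symmDiff P μ
      = ((r / 2 : ℝ) : ℂ) • scale a (∑ ρ, ((symmDiff P μ * star (P ρ)
          - star (P ρ) * symmDiff P μ) * P ρ
        + ((symmDiff P μ * P ρ - P ρ * symmDiff P μ) * star (P ρ)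
        + (star (P ρ) * (symmDiff P μ * P ρ - P ρ * symmDiff P μ)
          - (symmDiff P μ * P ρ - P ρ * symmDiff P μ) * star (P ρ))))) := by
    have e2 : ∀ X : OpFam ι, X * massOp a P M r - massOp a P M r * X
        = ((r / 2 : ℝ) : ℂ) • scale a (∑ ρ, (X * (star (P ρ) * P ρ)
          - (star (P ρ) * P ρ) * X)) := by
      intro X
      rw [massOp, mul_add, add_mul, mul_smul_comm, smul_mul_assoc, mul_one, one_mul,
        mul_smul_comm, smul_mul_assoc, scale_mul, mul_scale, Finset.mul_sum, Finset.sum_mul,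
        Finset.sum_sub_distrib, scale_sub, smul_sub]
      abel
    rw [e2]
    congr 2
    refine Finset.sum_congr rfl fun ρ _ => ?_
    noncomm_ring
  have e3 : (symmDiff P μ * massOp a P M r - massOp a P M r * symmDiff P μ)
      * Li * symmDiff P ν = ((r / 2 : ℝ) : ℂ) • ∑ ρ,
        ((symmDiff P μ * star (P ρ) - star (P ρ) * symmDiff P μ)
          * scale a (P ρ * Li * symmDiff P ν)
        + ((symmDiff P μ * P ρ - P ρ * symmDiff P μ)
          * scale a (star (P ρ) * Li * symmDiff P ν)
        + (star (P ρ) * (symmDiff P μ * P ρ - P ρ * symmDiff P μ)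
          - (symmDiff P μ * P ρ - P ρ * symmDiff P μ) * star (P ρ))
            * Li * scale a (symmDiff P ν))) := by
    rw [e1, smul_mul_assoc, smul_mul_assoc, scale_mul, scale_mul, Finset.sum_mul, Finset.sum_mul,
      scale_sum]
    congr 1
    refine Finset.sum_congr rfl fun ρ _ => ?_
    simp only [mul_scale, ← scale_add]
    congr 1
    simp only [add_mul, mul_assoc]
  rw [e3]
  refine (UnifBdd.sum _ fun ρ _ => ?_).smul _
  exact ((h.symmDiff_comm_star μ ρ).mul
      (h.unifBdd_scale_grad_massInv_symmDiff hM hr hLi ρ ν)).add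
    (((h.symmDiff_comm μ ρ).mul
      (h.unifBdd_scale_star_grad_massInv_symmDiff hM hr hLi ρ ν)).add
    (((h.comm_symmDiff_comm μ ρ).mul (h.unifBdd_massInv hM hr hLi)).mul
      (h.unifBdd_scale_symmDiff ν)))

/-- The operator `L - ∑ D L⁻¹ D`. -/
noncomputable def schurOp (a : ℕ → ℝ) (P : J → OpFam ι) (M r : ℝ) (Li : OpFam ι) : OpFam ι :=
  massOp a P M r - ∑ μ, symmDiff P μ * Li * symmDiff P μ

/-- The operator `½ ∑ g_μ g_ν (D_μ L⁻¹ D_ν - D_ν L⁻¹ D_μ)`. -/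
noncomputable def curvOp (P g : J → OpFam ι) (Li : OpFam ι) : OpFam ι :=
  (1 / 2 : ℂ) • ∑ μ, ∑ ν, g μ * g ν * (symmDiff P μ * Li * symmDiff P ν
    - symmDiff P ν * Li * symmDiff P μ)

variable {M r : ℝ} {Li : OpFam ι}

theorem star_schurOp (hLi : massOp a P M r * Li = 1) :
    star (schurOp a P M r Li) = schurOp a P M r Li := by
  have h1 := star_inverse_eq (star_massOp M r) hLi
  simp only [schurOp, star_sub, star_sum, star_mul, star_massOp, star_symmDiff, h1]
  congr 1
  refine Finset.sum_congr rfl fun μ _ => ?_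
  noncomm_ring

/-- Commuting the mass operator through the left `D` cancels the inverse: `𝓛 D 𝓛⁻¹ D = D² - [D, 𝓛]
𝓛⁻¹ D`. -/
theorem mass_mul_schurOp (hLi : massOp a P M r * Li = 1) :
    massOp a P M r * schurOp a P M r Li = ellipticOp a P M r
      + ∑ μ, (symmDiff P μ * massOp a P M r - massOp a P M r * symmDiff P μ)
        * Li * symmDiff P μ := by
  rw [schurOp, ellipticOp, mul_sub, Finset.mul_sum, sub_add, ← Finset.sum_sub_distrib]
  congr 1
  refine Finset.sum_congr rfl fun μ _ => ?_
  have : symmDiff P μ * massOp a P M r * Li * symmDiff P μ = symmDiff P μ * symmDiff P μ := by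
    rw [mul_assoc (symmDiff P μ), hLi, mul_one]
  rw [sub_mul, sub_mul, this]
  noncomm_ring

theorem unifBdd_mass_mul_schurOp_sub (h : IsLatticeGradient a P) (hM : 0 < M) (hr : 0 < r)
    (hLi : massOp a P M r * Li = 1) :
    UnifBdd (massOp a P M r * schurOp a P M r Li - ellipticOp a P M r) := by
  rw [mass_mul_schurOp hLi, add_sub_cancel_left]
  exact UnifBdd.sum _ fun μ _ => h.unifBdd_massComm_massInv_symmDiff hM hr hLi μ μ

theorem commute_massOp {g : OpFam ι} (hg : ∀ ν, Commute g (P ν))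
    (hg' : ∀ ν, Commute g (star (P ν))) : Commute g (massOp a P M r) := by
  rw [massOp]
  refine Commute.add_right ((Commute.one_right g).smul_right _) (Commute.smul_right ?_ _)
  have : Commute g (∑ μ, star (P μ) * P μ) :=
    Commute.sum_right _ _ _ fun μ _ => (hg' μ).mul_right (hg μ)
  rw [commute_iff_eq, scale_mul, mul_scale, this.eq]

theorem commute_symmDiff {g : OpFam ι} (hg : ∀ ν, Commute g (P ν))
    (hg' : ∀ ν, Commute g (star (P ν))) (μ : J) : Commute g (symmDiff P μ) :=
  ((hg μ).sub_right (hg' μ)).smul_right _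

theorem commute_massInv {g : OpFam ι} (hg : ∀ ν, Commute g (P ν))
    (hg' : ∀ ν, Commute g (star (P ν))) (hLi : massOp a P M r * Li = 1)
    (hLi' : Li * massOp a P M r = 1) : Commute g Li :=
  (commute_massOp (a := a) (M := M) (r := r) hg hg').units_inv_right (u := ⟨_, Li, hLi, hLi'⟩)

variable {g : J → OpFam ι}

/-- After multiplication by `𝓛` the leading part of `X_{μν}` is `[D_μ, D_ν]`, a bounded curvature
term; the rest has the form `[D, 𝓛] 𝓛⁻¹ D`. Thus `B` behaves like `𝓛⁻¹` times a bounded operator. -/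
theorem unifBdd_mass_mul_curvOp (h : IsLatticeGradient a P) (hM : 0 < M) (hr : 0 < r)
    (hLi : massOp a P M r * Li = 1) (hgb : ∀ μ, UnifBdd (g μ))
    (hg : ∀ μ ν, Commute (g μ) (P ν)) (hg' : ∀ μ ν, Commute (g μ) (star (P ν))) :
    UnifBdd (massOp a P M r * curvOp P g Li) := by
  have e : ∀ μ ν, massOp a P M r * (g μ * g ν * (symmDiff P μ * Li * symmDiff P ν
      - symmDiff P ν * Li * symmDiff P μ))
      = g μ * g ν * ((symmDiff P μ * symmDiff P ν - symmDiff P ν * symmDiff P μ)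
        - (symmDiff P μ * massOp a P M r - massOp a P M r * symmDiff P μ) * Li * symmDiff P ν
        + (symmDiff P ν * massOp a P M r - massOp a P M r * symmDiff P ν)
          * Li * symmDiff P μ) := by
    intro μ ν
    have h1 : Commute (g μ * g ν) (massOp a P M r) :=
      (commute_massOp (hg μ) (hg' μ)).mul_left (commute_massOp (hg ν) (hg' ν))
    rw [← mul_assoc, ← h1.eq, mul_assoc]
    congr 1
    have h2 : ∀ X Y : OpFam ι, X * massOp a P M r * Li * Y = X * Y := fun X Y => by
      rw [mul_assoc X, hLi, mul_one]
    simp only [sub_mul, h2]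
    noncomm_ring
  rw [curvOp, mul_smul_comm, Finset.mul_sum]
  simp only [Finset.mul_sum, e]
  refine (UnifBdd.sum _ fun μ _ => UnifBdd.sum _ fun ν _ => ?_).smul _
  exact ((hgb μ).mul (hgb ν)).mul (((h.symmDiff_comm_symmDiff μ ν).sub
    (h.unifBdd_massComm_massInv_symmDiff hM hr hLi μ ν)).add
    (h.unifBdd_massComm_massInv_symmDiff hM hr hLi ν μ))

theorem star_curvOp (hLi : massOp a P M r * Li = 1) (hLi' : Li * massOp a P M r = 1)
    (hgs : ∀ μ, star (g μ) = -g μ)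
    (hg : ∀ μ ν, Commute (g μ) (P ν)) (hg' : ∀ μ ν, Commute (g μ) (star (P ν))) :
    star (curvOp P g Li) = curvOp P g Li := by
  have h1 := star_inverse_eq (star_massOp M r) hLi
  have h2 : star (1 / 2 : ℂ) = 1 / 2 := by simp
  -- The adjoint reverses `g_μ g_ν` and interchanges the roles of `μ` and `ν`, so the two sums are
  -- exchanged before comparing terms.
  rw [curvOp, star_smul, h2, star_sum, Finset.sum_comm]
  simp only [star_sum]
  congr 1
  refine Finset.sum_congr rfl fun μ _ => Finset.sum_congr rfl fun ν _ => ?_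
  simp only [star_mul, star_sub, hgs, h1, star_symmDiff]
  have c : ∀ μ ν, Commute (g μ) (symmDiff P ν) := fun μ ν => commute_symmDiff (hg μ) (hg' μ) ν
  have c' : ∀ μ, Commute (g μ) Li := fun μ => commute_massInv (hg μ) (hg' μ) hLi hLi'
  have c2 : ∀ κ, Commute (g κ) (symmDiff P ν * Li * symmDiff P μ
      - symmDiff P μ * Li * symmDiff P ν) := fun κ =>
    (((c κ ν).mul_right (c' κ)).mul_right (c κ μ)).sub_right
      (((c κ μ).mul_right (c' κ)).mul_right (c κ ν))
  rw [((c2 ν).mul_left (c2 μ)).eq]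
  noncomm_ring

/-- `C + B = L + 𝒟 L⁻¹ 𝒟` with `𝒟 = ∑ g_μ D_μ`. -/
theorem schurOp_add_curvOp [DecidableEq J] (hLi : massOp a P M r * Li = 1)
    (hLi' : Li * massOp a P M r = 1)
    (hgc : ∀ μ ν, g μ * g ν + g ν * g μ = (if μ = ν then (-2 : ℂ) else 0) • 1)
    (hg : ∀ μ ν, Commute (g μ) (P ν)) (hg' : ∀ μ ν, Commute (g μ) (star (P ν))) :
    schurOp a P M r Li + curvOp P g Li = massOp a P M r
      + (∑ μ, g μ * symmDiff P μ) * Li * ∑ μ, g μ * symmDiff P μ := by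
  have c : ∀ μ ν, Commute (g μ) (symmDiff P ν) := fun μ ν => commute_symmDiff (hg μ) (hg' μ) ν
  have c' : ∀ μ, Commute (g μ) Li := fun μ => commute_massInv (hg μ) (hg' μ) hLi hLi'
  set Y : J → J → OpFam ι := fun μ ν => symmDiff P μ * Li * symmDiff P ν with hY
  have e1 : (∑ μ, g μ * symmDiff P μ) * Li * ∑ μ, g μ * symmDiff P μ
      = ∑ μ, ∑ ν, g μ * g ν * Y μ ν := by
    rw [Finset.sum_mul, Finset.sum_mul]
    simp only [Finset.mul_sum]
    refine Finset.sum_congr rfl fun μ _ => Finset.sum_congr rfl fun ν _ => ?_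
    have : Commute (g ν) (symmDiff P μ * Li) := (c ν μ).mul_right (c' ν)
    calc _ = g μ * ((symmDiff P μ * Li) * g ν) * symmDiff P ν := by noncomm_ring
      _ = g μ * (g ν * (symmDiff P μ * Li)) * symmDiff P ν := by rw [this.eq]
      _ = _ := by simp only [hY]; noncomm_ring
  have e2 : curvOp P g Li = (1 / 2 : ℂ) • ∑ μ, ∑ ν, (g μ * g ν - g ν * g μ) * Y μ ν := by
    have : ∑ μ, ∑ ν, g μ * g ν * (Y μ ν - Y ν μ)
        = ∑ μ, ∑ ν, (g μ * g ν - g ν * g μ) * Y μ ν := by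
      simp only [mul_sub, sub_mul, Finset.sum_sub_distrib]
      congr 1
      rw [Finset.sum_comm]
    rw [curvOp, ← this]
  -- The Clifford relation makes the antisymmetrised product `2 g_μ g_ν + 2δ_{μν}`; the diagonal
  -- part later cancels the sum subtracted in `C`.
  have e3 : ∀ μ ν, (g μ * g ν - g ν * g μ) * Y μ ν
      = (2 : ℂ) • (g μ * g ν * Y μ ν) + (if μ = ν then (2 : ℂ) else 0) • Y μ ν := by
    intro μ ν
    have h1 : g ν * g μ = (if μ = ν then (-2 : ℂ) else 0) • 1 - g μ * g ν := by
      rw [← hgc μ ν]; abel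
    rw [h1]
    split_ifs
    · rw [two_smul, sub_mul, sub_mul, smul_mul_assoc, one_mul, neg_smul]; abel
    · rw [two_smul, zero_smul, zero_smul, zero_sub, sub_neg_eq_add, add_mul, add_zero]
  have e4 : curvOp P g Li = (∑ μ, ∑ ν, g μ * g ν * Y μ ν) + ∑ μ, Y μ μ := by
    rw [e2]
    simp only [e3, Finset.sum_add_distrib, ← Finset.smul_sum, smul_add, smul_smul, ite_smul,
      zero_smul, Finset.sum_ite_eq, Finset.mem_univ, if_true]
    norm_num
  rw [e1, e4, schurOp]
  abel

/-- Each added term is nonnegative: with `z = 𝓛⁻¹ Z u` its form at `u` is the form of `𝓛` at `z`.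
Used with `Z = D_μ` for `C` and with the single `Z = ∑ g_μ D_μ` for `C+B`. -/
theorem coercive_of_eq_add_star_mul (h : IsLatticeGradient a P) (hM : 0 < M) (hr : 0 < r)
    (hLi : massOp a P M r * Li = 1) {K : Type*} (s : Finset K) (Z : K → OpFam ι) (n : ℕ)
    (u : EuclideanSpace ℂ (ι n)) :
    M * ‖u‖ ^ 2 ≤ quad ((massOp a P M r + ∑ k ∈ s, star (Z k) * Li * Z k) n) u := by
  rw [Pi.add_apply, quad_add, Finset.sum_apply, quad_sum]
  have h1 : ∀ k ∈ s, 0 ≤ quad ((star (Z k) * Li * Z k) n) u := by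
    intro k _
    set z := act (Li n) (act (Z k n) u) with hz
    have h2 : act (massOp a P M r n) z = act (Z k n) u := by
      have := congrFun hLi n
      simp only [Pi.mul_apply, Pi.one_apply] at this
      rw [hz, ← act_mul, this, act_one]
    have h3 : quad ((star (Z k) * Li * Z k) n) u = quad (massOp a P M r n) z := by
      rw [mul_assoc, Pi.mul_apply, Pi.star_apply, quad_star_mul, Pi.mul_apply, act_mul, ← hz,
        ← h2, inner_act_left, ← Pi.star_apply, star_massOp, quad]
    rw [h3]
    exact le_trans (by positivity) (h.le_quad_massOp hr n z)
  have := Finset.sum_nonneg h1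
  have := h.le_quad_massOp (M := M) hr n u
  linarith

theorem coercive_schurOp (h : IsLatticeGradient a P) (hM : 0 < M) (hr : 0 < r)
    (hLi : massOp a P M r * Li = 1) (n : ℕ) (u : EuclideanSpace ℂ (ι n)) :
    M * ‖u‖ ^ 2 ≤ quad (schurOp a P M r Li n) u := by
  have e : schurOp a P M r Li
      = massOp a P M r + ∑ μ, star (symmDiff P μ) * Li * symmDiff P μ := by
    simp only [schurOp, star_symmDiff, neg_mul, Finset.sum_neg_distrib, sub_eq_add_neg]
  rw [e]
  exact h.coercive_of_eq_add_star_mul hM hr hLi Finset.univ (symmDiff P) n u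

/-- Skew `g_μ` times skew `D_μ`, commuting, is self-adjoint, so `𝒟 𝓛⁻¹ 𝒟` is of the form `Z* 𝓛⁻¹ Z`.
No smallness of `B` is needed. -/
theorem coercive_schurOp_add_curvOp [DecidableEq J] (h : IsLatticeGradient a P) (hM : 0 < M)
    (hr : 0 < r) (hLi : massOp a P M r * Li = 1) (hLi' : Li * massOp a P M r = 1)
    (hgs : ∀ μ, star (g μ) = -g μ)
    (hgc : ∀ μ ν, g μ * g ν + g ν * g μ = (if μ = ν then (-2 : ℂ) else 0) • 1)
    (hg : ∀ μ ν, Commute (g μ) (P ν)) (hg' : ∀ μ ν, Commute (g μ) (star (P ν)))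
    (n : ℕ) (u : EuclideanSpace ℂ (ι n)) :
    M * ‖u‖ ^ 2 ≤ quad ((schurOp a P M r Li + curvOp P g Li) n) u := by
  have e : star (∑ μ, g μ * symmDiff P μ) = ∑ μ, g μ * symmDiff P μ := by
    rw [star_sum]
    refine Finset.sum_congr rfl fun μ _ => ?_
    rw [star_mul, hgs, star_symmDiff, neg_mul_neg,
      (commute_symmDiff (hg μ) (hg' μ) μ).eq]
  have := h.coercive_of_eq_add_star_mul hM hr hLi (Finset.univ : Finset Unit)
    (fun _ => ∑ μ, g μ * symmDiff P μ) n u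
  simp only [e, Finset.univ_unique, Finset.sum_singleton] at this
  rwa [schurOp_add_curvOp hLi hLi' hgc hg hg']

end IsLatticeGradient

end Resolvent

/-! ### From gradient bounds to approximation orders; elliptic regularity -/

section Smoothing

set_option linter.unusedSectionVars false

open scoped Matrix.Norms.L2Operator

variable {ι : ℕ → Type} [∀ n, Fintype (ι n)] [∀ n, DecidableEq (ι n)]

/-- A Poincaré inequality on dyadic blocks: up to an operator of rank `O(2^(jd))`, the identity
is `2^(-j)` times a first order operator. -/
def HasBlockPoincare {J : Type} [Fintype J] (d : ℕ) (P : J → OpFam ι) : Prop :=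
  ∃ K : ℝ, 0 ≤ K ∧ ∀ n j, ∃ E : Matrix (ι n) (ι n) ℂ, (E.rank : ℝ) ≤ K * 2 ^ (j * d) ∧
    ∃ (S : J → Matrix (ι n) (ι n) ℂ) (S₀ : Matrix (ι n) (ι n) ℂ), (∀ μ, ‖S μ‖ ≤ K) ∧ ‖S₀‖ ≤ K ∧
      1 - E = ((1 / 2 ^ j : ℝ) : ℂ) • (∑ μ, S μ * P μ n + S₀)

section Poincare

variable {J : Type} [Fintype J] {d : ℕ} {P : J → OpFam ι} {X : OpFam ι}

theorem norm_sum_mul_add_le {m : Type*} [Fintype m] [DecidableEq m] {S Y : J → Matrix m m ℂ}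
    {S₀ Y₀ : Matrix m m ℂ} {K C₀ : ℝ} {C : J → ℝ} (hK : 0 ≤ K) (hS : ∀ μ, ‖S μ‖ ≤ K)
    (hS₀ : ‖S₀‖ ≤ K) (hY : ∀ μ, ‖Y μ‖ ≤ C μ) (hY₀ : ‖Y₀‖ ≤ C₀) :
    ‖∑ μ, S μ * Y μ + S₀ * Y₀‖ ≤ K * (∑ μ, C μ + C₀) := by
  refine (norm_add_le _ _).trans ?_
  rw [mul_add, Finset.mul_sum]
  refine add_le_add ((norm_sum_le _ _).trans (Finset.sum_le_sum fun μ _ => ?_)) ?_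
  · exact (norm_mul_le _ _).trans (mul_le_mul (hS μ) (hY μ) (norm_nonneg _) hK)
  · exact (norm_mul_le _ _).trans (mul_le_mul hS₀ hY₀ (norm_nonneg _) hK)

/-- The approximant is `E X`; the error `(1 - E) X` is `2^(-j)` times a combination of `P_μ X` and
`X` with bounded coefficients. -/
theorem HasBlockPoincare.approxOrder_one (hP : HasBlockPoincare d P) (hX : UnifBdd X)
    (hPX : ∀ μ, UnifBdd (P μ * X)) : ApproxOrder d 1 X := by
  obtain ⟨K, hK0, hK⟩ := hP
  obtain ⟨C₀, hC₀0, hC₀⟩ := hX.exists_nonneg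
  choose C hC0 hC using fun μ => (hPX μ).exists_nonneg
  have hs : 0 ≤ ∑ μ, C μ := Finset.sum_nonneg fun μ _ => hC0 μ
  refine ⟨K + K * (∑ μ, C μ + C₀), by positivity, fun n j => ?_⟩
  obtain ⟨E, hE, S, S₀, hS, hS₀, hES⟩ := hK n j
  refine ⟨E * X n, ?_, ?_⟩
  · have h1 : ((E * X n).rank : ℝ) ≤ E.rank := by exact_mod_cast Matrix.rank_mul_le_left E (X n)
    refine (h1.trans hE).trans (mul_le_mul_of_nonneg_right ?_ (by positivity))
    linarith [mul_nonneg hK0 (add_nonneg hs hC₀0)]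
  · have e : X n - E * X n
        = ((1 / 2 ^ j : ℝ) : ℂ) • (∑ μ, S μ * (P μ * X) n + S₀ * X n) := by
      have : X n - E * X n = (1 - E) * X n := by noncomm_ring
      rw [this, hES, smul_mul_assoc, add_mul, Finset.sum_mul]
      simp only [Pi.mul_apply, mul_assoc]
    rw [e, norm_smul, Complex.norm_real, Real.norm_of_nonneg (by positivity), mul_one,
      div_mul_eq_mul_div, one_mul]
    refine div_le_div_of_nonneg_right ?_ (by positivity)
    have := norm_sum_mul_add_le hK0 hS hS₀ (fun μ => hC μ n) (hC₀ n)
    linarith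

theorem HasBlockPoincare.approxOrder_one_right (hP : HasBlockPoincare d P) (hX : UnifBdd X)
    (hPX : ∀ μ, UnifBdd (X * star (P μ))) : ApproxOrder d 1 X := by
  have := hP.approxOrder_one hX.star fun μ => by
    have := (hPX μ).star
    rwa [star_mul, star_star] at this
  simpa using this.star

/-- The Poincaré inequality is applied on both sides, so that the error is `(1 - E) X (1 - E)*`.
Only one difference on each side is then needed, never two on the same side. -/
theorem HasBlockPoincare.approxOrder_two (hP : HasBlockPoincare d P) (hX : UnifBdd X)
    (hPX : ∀ μ, UnifBdd (P μ * X)) (hXP : ∀ μ, UnifBdd (X * star (P μ)))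
    (hPXP : ∀ μ ν, UnifBdd (P μ * X * star (P ν))) : ApproxOrder d 2 X := by
  obtain ⟨K, hK0, hK⟩ := hP
  obtain ⟨C₀, hC₀0, hC₀⟩ := hX.exists_nonneg
  choose C hC0 hC using fun μ => (hPX μ).exists_nonneg
  choose C' hC'0 hC' using fun μ => (hXP μ).exists_nonneg
  choose D hD0 hD using fun p : J × J => (hPXP p.1 p.2).exists_nonneg
  have hs : 0 ≤ ∑ μ, C μ := Finset.sum_nonneg fun μ _ => hC0 μ
  set T₀ := K * (∑ μ, C μ + C₀) with hT₀
  set T : J → ℝ := fun ν => K * (∑ μ, D (μ, ν) + C' ν) with hT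
  have hT₀0 : 0 ≤ T₀ := by positivity
  have hT0 : ∀ ν, 0 ≤ T ν := fun ν =>
    mul_nonneg hK0 (add_nonneg (Finset.sum_nonneg fun μ _ => hD0 (μ, ν)) (hC'0 ν))
  have hTs : 0 ≤ ∑ ν, T ν := Finset.sum_nonneg fun μ _ => hT0 μ
  refine ⟨2 * K + K * (∑ ν, T ν + T₀), by positivity, fun n j => ?_⟩
  obtain ⟨E, hE, S, S₀, hS, hS₀, hES⟩ := hK n j
  refine ⟨E * X n + (1 - E) * X n * star E, ?_, ?_⟩
  · have h1 : (E * X n + (1 - E) * X n * star E).rank ≤ E.rank + E.rank := by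
      refine (rank_add_le_add _ _).trans (add_le_add (Matrix.rank_mul_le_left _ _) ?_)
      refine (Matrix.rank_mul_le_right _ _).trans (le_of_eq ?_)
      open scoped ComplexOrder in
      rw [Matrix.star_eq_conjTranspose, Matrix.rank_conjTranspose]
    have h2 : ((E * X n + (1 - E) * X n * star E).rank : ℝ) ≤ E.rank + E.rank := by
      exact_mod_cast h1
    have h3 : 0 ≤ K * (∑ ν, T ν + T₀) * 2 ^ (j * d) := by positivity
    rw [add_mul]
    linarith
  · set F := ∑ μ, S μ * P μ n + S₀ with hF
    have e : X n - (E * X n + (1 - E) * X n * star E)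
        = ((1 / 2 ^ (j * 2) : ℝ) : ℂ) • (F * X n * star F) := by
      have h1 : X n - (E * X n + (1 - E) * X n * star E) = (1 - E) * X n * star (1 - E) := by
        rw [star_sub, star_one]; noncomm_ring
      rw [h1, hES, star_smul, smul_mul_assoc, smul_mul_smul_comm]
      congr 1
      rw [Complex.star_def, Complex.conj_ofReal, ← Complex.ofReal_mul]
      congr 1
      rw [pow_mul]
      ring
    have hFX : ‖F * X n‖ ≤ T₀ := by
      have := norm_sum_mul_add_le hK0 hS hS₀ (fun μ => hC μ n) (hC₀ n)
      simp only [Pi.mul_apply, ← mul_assoc] at this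
      rwa [hF, add_mul, Finset.sum_mul]
    have hFXP : ∀ ν, ‖F * X n * star (P ν n)‖ ≤ T ν := by
      intro ν
      have := norm_sum_mul_add_le hK0 hS hS₀ (fun μ => hD (μ, ν) n) (hC' ν n)
      simp only [Pi.mul_apply, Pi.star_apply, ← mul_assoc] at this
      rwa [hF, add_mul, Finset.sum_mul, add_mul, Finset.sum_mul]
    have hFXF : ‖F * X n * star F‖ ≤ K * (∑ ν, T ν + T₀) := by
      rw [← norm_star, star_mul, star_star, hF, add_mul, Finset.sum_mul]
      simp only [mul_assoc]
      refine norm_sum_mul_add_le hK0 hS hS₀ (fun ν => ?_) ?_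
      · rw [← norm_star, star_mul, star_star]
        exact hFXP ν
      · rw [norm_star]; exact hFX
    rw [e, norm_smul, Complex.norm_real, Real.norm_of_nonneg (by positivity),
      div_mul_eq_mul_div, one_mul]
    refine div_le_div_of_nonneg_right ?_ (by positivity)
    linarith

end Poincare

namespace IsLatticeGradient

variable {J : Type} [Fintype J] {a : ℕ → ℝ} {P : J → OpFam ι} {M r : ℝ}

/-- Elliptic regularity in divergence form. -/
theorem unifBdd_grad_mul_of_ellipticOp_mul_eq (h : IsLatticeGradient a P) (hM : 0 < M)
    (hr : 0 < r) {X A S T : OpFam ι} {ν : J} (hX : UnifBdd X) (hA : UnifBdd A) (hS : UnifBdd S)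
    (hT : UnifBdd T)
    (e : ellipticOp a P M r * X = star (P ν) * A + S + massOp a P M r * T) (μ : J) :
    UnifBdd (P μ * X) := by
  obtain ⟨x, hx0, hx⟩ := hX.exists_nonneg
  obtain ⟨α, hα0, hα⟩ := hA.exists_nonneg
  obtain ⟨σ, hσ0, hσ⟩ := hS.exists_nonneg
  obtain ⟨τ, hτ0, hτ⟩ := hT.exists_nonneg
  obtain ⟨κ, hκ0, hκ⟩ := h.exists_norm_sq_le hM hr ν
  obtain ⟨κ', hκ'0, hκ'⟩ := h.exists_norm_sq_le hM hr μ
  refine ⟨Real.sqrt (κ' * ((Real.sqrt κ * α + τ) ^ 2 + 2 * (x * σ))), fun n =>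
    norm_le_of_act (Real.sqrt_nonneg _) fun f => ?_⟩
  obtain ⟨v, hv⟩ : ∃ v, v = act (X n) f := ⟨_, rfl⟩
  obtain ⟨F, hF⟩ : ∃ F, F = ‖f‖ := ⟨_, rfl⟩
  have hF0 : 0 ≤ F := hF ▸ norm_nonneg f
  have bd : ∀ {Y : OpFam ι} {c : ℝ}, (∀ n, ‖Y n‖ ≤ c) → ‖act (Y n) f‖ ≤ c * F := fun hY =>
    hF ▸ (norm_act_le _ f).trans (mul_le_mul_of_nonneg_right (hY n) (norm_nonneg f))
  have hvx : ‖v‖ ≤ x * F := hv ▸ bd hx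
  obtain ⟨q, hq⟩ : ∃ q, q = Real.sqrt (quad (ellipticOp a P M r n) v) := ⟨_, rfl⟩
  have hq0 : 0 ≤ q := hq ▸ Real.sqrt_nonneg _
  have hQ0 : 0 ≤ quad (ellipticOp a P M r n) v := by
    rw [quad_ellipticOp]
    exact add_nonneg (sq_nonneg _) (Finset.sum_nonneg fun _ _ => sq_nonneg _)
  have hqQ : q ^ 2 = quad (ellipticOp a P M r n) v := by rw [hq, Real.sq_sqrt hQ0]
  have hPv : ‖act (P ν n) v‖ ≤ Real.sqrt κ * q := by
    rw [hq, ← Real.sqrt_mul hκ0]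
    exact Real.le_sqrt_of_sq_le (hκ n v)
  have hLv : ‖act (massOp a P M r n) v‖ ≤ q := by
    rw [hq]
    refine Real.le_sqrt_of_sq_le ?_
    rw [quad_ellipticOp]
    linarith [Finset.sum_nonneg fun (ρ : J) (_ : ρ ∈ Finset.univ) =>
      sq_nonneg ‖act (symmDiff P ρ n) v‖]
  -- The equation is paired with `v = X f`. The outer `P_ν*` and `𝓛` move onto `v`, where the square
  -- root `q` of the form of `H` controls them.
  have hQ : quad (ellipticOp a P M r n) v
      ≤ ‖act (P ν n) v‖ * ‖act (A n) f‖ + ‖v‖ * ‖act (S n) f‖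
        + ‖act (massOp a P M r n) v‖ * ‖act (T n) f‖ := by
    have e1 : act (ellipticOp a P M r n) v = act (star (P ν n)) (act (A n) f)
        + act (S n) f + act (massOp a P M r n) (act (T n) f) := by
      have := congrFun e n
      simp only [Pi.mul_apply, Pi.add_apply, Pi.star_apply] at this
      rw [hv, ← act_mul, this, act_add, act_add, act_mul, act_mul]
    have e2 : inner ℂ v (act (star (P ν n)) (act (A n) f))
        = inner ℂ (act (P ν n) v) (act (A n) f) := (inner_act_left _ _ _).symm
    have e3 : inner ℂ v (act (massOp a P M r n) (act (T n) f))
        = inner ℂ (act (massOp a P M r n) v) (act (T n) f) := by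
      rw [inner_act_left (massOp a P M r n), ← Pi.star_apply, star_massOp]
    rw [quad, e1, inner_add_right, inner_add_right, e2, e3, Complex.add_re, Complex.add_re]
    have key : ∀ w z : EuclideanSpace ℂ (ι n), (inner ℂ w z).re ≤ ‖w‖ * ‖z‖ := fun w z =>
      (le_abs_self _).trans ((Complex.abs_re_le_norm _).trans (norm_inner_le_norm w z))
    exact add_le_add (add_le_add (key _ _) (key _ _)) (key _ _)
  have hQ2 : q ^ 2 ≤ (Real.sqrt κ * α + τ) * F * q + x * σ * F ^ 2 := by
    have h1 : ‖act (P ν n) v‖ * ‖act (A n) f‖ ≤ (Real.sqrt κ * q) * (α * F) :=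
      mul_le_mul hPv (bd hα) (norm_nonneg _) (by positivity)
    have h2 : ‖v‖ * ‖act (S n) f‖ ≤ (x * F) * (σ * F) :=
      mul_le_mul hvx (bd hσ) (norm_nonneg _) (by positivity)
    have h3 : ‖act (massOp a P M r n) v‖ * ‖act (T n) f‖ ≤ q * (τ * F) :=
      mul_le_mul hLv (bd hτ) (norm_nonneg _) hq0
    rw [hqQ]
    refine hQ.trans ((add_le_add (add_le_add h1 h2) h3).trans (le_of_eq ?_))
    ring
  -- Young's inequality absorbs the term linear in `q`.
  have hQ3 : q ^ 2 ≤ ((Real.sqrt κ * α + τ) ^ 2 + 2 * (x * σ)) * F ^ 2 := by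
    generalize Real.sqrt κ * α + τ = β at hQ2
    have := sq_nonneg (β * F - q)
    have e : (β * F - q) ^ 2 = β ^ 2 * F ^ 2 - 2 * (β * F * q) + q ^ 2 := by ring
    rw [e] at this
    linarith
  rw [Pi.mul_apply, act_mul, ← hv, ← hF]
  have h4 : ‖act (P μ n) v‖ ^ 2 ≤ (κ' * ((Real.sqrt κ * α + τ) ^ 2 + 2 * (x * σ))) * F ^ 2 := by
    refine (hκ' n v).trans ?_
    rw [← hqQ, mul_assoc]
    exact mul_le_mul_of_nonneg_left hQ3 hκ'0
  have h5 := Real.le_sqrt_of_sq_le h4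
  rwa [Real.sqrt_mul (by positivity), Real.sqrt_sq hF0] at h5

/-- Data of an operator `G` with `L G = H + O(1)`, together with its inverse. -/
structure IsParametrix (a : ℕ → ℝ) (P : J → OpFam ι) (M r : ℝ) (G Gi Li : OpFam ι) : Prop where
  star_eq : star G = G
  mul_inv : G * Gi = 1
  unifBdd_inv : UnifBdd Gi
  mass_mul_inv : massOp a P M r * Li = 1
  unifBdd_mass_inv : UnifBdd Li
  remainder : UnifBdd (massOp a P M r * G - ellipticOp a P M r)

namespace IsParametrix

variable {G Gi Li : OpFam ι}

/-- Here `H G⁻¹ = 𝓛 - (𝓛G - H) G⁻¹`; the term `𝓛` on the right is why the regularity estimate admits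
a source `𝓛 T`. The inverse alone thus gains only one derivative. -/
theorem unifBdd_grad_inv (h : IsLatticeGradient a P) (hM : 0 < M) (hr : 0 < r)
    (hG : IsParametrix a P M r G Gi Li) (μ : J) : UnifBdd (P μ * Gi) := by
  refine h.unifBdd_grad_mul_of_ellipticOp_mul_eq hM hr (ν := μ) (A := 0)
    (S := -((massOp a P M r * G - ellipticOp a P M r) * Gi)) (T := 1) hG.unifBdd_inv UnifBdd.zero
    (hG.remainder.mul hG.unifBdd_inv).neg UnifBdd.one ?_ μ
  have : massOp a P M r * G * Gi = massOp a P M r := by rw [mul_assoc, hG.mul_inv, mul_one]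
  rw [sub_mul, this, mul_zero, mul_one]
  abel

theorem mul_eq_one (hG : IsParametrix a P M r G Gi Li) :
    massOp a P M r * G * (Gi * Li) = 1 := by
  rw [mul_assoc, ← mul_assoc G, hG.mul_inv, one_mul, hG.mass_mul_inv]

theorem ellipticOp_mul (hG : IsParametrix a P M r G Gi Li) :
    ellipticOp a P M r * (Gi * Li)
      = 1 - (massOp a P M r * G - ellipticOp a P M r) * (Gi * Li) := by
  rw [sub_mul, hG.mul_eq_one]; abel

theorem unifBdd_grad_mul (h : IsLatticeGradient a P) (hM : 0 < M) (hr : 0 < r)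
    (hG : IsParametrix a P M r G Gi Li) (μ : J) : UnifBdd (P μ * (Gi * Li)) := by
  have hY := hG.unifBdd_inv.mul hG.unifBdd_mass_inv
  refine h.unifBdd_grad_mul_of_ellipticOp_mul_eq hM hr (ν := μ) (A := 0)
    (S := 1 - (massOp a P M r * G - ellipticOp a P M r) * (Gi * Li)) (T := 0) hY UnifBdd.zero
    (UnifBdd.one.sub (hG.remainder.mul hY)) UnifBdd.zero ?_ μ
  rw [hG.ellipticOp_mul, mul_zero, mul_zero, zero_add, add_zero]

/-- Regularity for the adjoint `𝓛⁻¹ G⁻¹`, which inverts `G𝓛`; the remainder `G𝓛 - H` is the adjoint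
of the given one. -/
theorem unifBdd_mul_star_grad (h : IsLatticeGradient a P) (hM : 0 < M) (hr : 0 < r)
    (hG : IsParametrix a P M r G Gi Li) (μ : J) : UnifBdd (Gi * Li * star (P μ)) := by
  have hY := hG.unifBdd_inv.mul hG.unifBdd_mass_inv
  have hGi : star Gi = Gi := star_inverse_eq hG.star_eq hG.mul_inv
  have hLi : star Li = Li := star_inverse_eq (star_massOp M r) hG.mass_mul_inv
  have e : star (Gi * Li) = Li * Gi := by rw [star_mul, hGi, hLi]
  have e2 : G * massOp a P M r * (Li * Gi) = 1 := by
    rw [mul_assoc, ← mul_assoc (massOp a P M r), hG.mass_mul_inv, one_mul, hG.mul_inv]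
  have hR := hG.remainder.star
  rw [star_sub, star_mul, star_massOp, star_ellipticOp, hG.star_eq] at hR
  have := h.unifBdd_grad_mul_of_ellipticOp_mul_eq hM hr (ν := μ) (A := 0) (X := Li * Gi)
    (S := 1 - (G * massOp a P M r - ellipticOp a P M r) * (Li * Gi)) (T := 0) (e ▸ hY.star)
    UnifBdd.zero (UnifBdd.one.sub (hR.mul (e ▸ hY.star))) UnifBdd.zero
    (by rw [sub_mul, e2, mul_zero, mul_zero]; abel) μ
  have := this.star
  rwa [star_mul, ← e, star_star] at this

/-- Now the source is `P_ν*` itself, in divergence form, so one difference on each side of `G⁻¹ 𝓛⁻¹`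
is allowed. -/
theorem unifBdd_grad_mul_star_grad (h : IsLatticeGradient a P) (hM : 0 < M) (hr : 0 < r)
    (hG : IsParametrix a P M r G Gi Li) (μ ν : J) :
    UnifBdd (P μ * (Gi * Li) * star (P ν)) := by
  have hY := hG.unifBdd_mul_star_grad h hM hr ν
  rw [mul_assoc]
  refine h.unifBdd_grad_mul_of_ellipticOp_mul_eq hM hr (ν := ν) (A := 1)
    (S := -((massOp a P M r * G - ellipticOp a P M r) * (Gi * Li * star (P ν)))) (T := 0) hY
    UnifBdd.one (hG.remainder.mul hY).neg UnifBdd.zero ?_ μ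
  rw [← mul_assoc, hG.ellipticOp_mul]
  noncomm_ring

end IsParametrix

end IsLatticeGradient

end Smoothing

/-! ### Power counting for the resummed remainder -/

section TraceBound

set_option linter.unusedSectionVars false

open scoped Matrix.Norms.L2Operator

variable {ι : ℕ → Type} [∀ n, Fintype (ι n)] [∀ n, DecidableEq (ι n)]

/-- Families with uniformly bounded traces. -/
def TraceBdd (X : OpFam ι) : Prop := ∃ K : ℝ, ∀ n, ‖(X n).trace‖ ≤ K

theorem TraceBdd.add {X Y : OpFam ι} (hX : TraceBdd X) (hY : TraceBdd Y) : TraceBdd (X + Y) := by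
  obtain ⟨K, hK⟩ := hX
  obtain ⟨K', hK'⟩ := hY
  exact ⟨K + K', fun n => by
    rw [Pi.add_apply, Matrix.trace_add]
    exact (norm_add_le _ _).trans (add_le_add (hK n) (hK' n))⟩

theorem TraceBdd.mul_comm {X Y : OpFam ι} (h : TraceBdd (X * Y)) : TraceBdd (Y * X) := by
  obtain ⟨K, hK⟩ := h
  exact ⟨K, fun n => by rw [Pi.mul_apply, Matrix.trace_mul_comm]; exact hK n⟩

theorem TraceBdd.sum {J : Type*} (s : Finset J) {X : J → OpFam ι}
    (h : ∀ j ∈ s, TraceBdd (X j)) : TraceBdd (∑ j ∈ s, X j) :=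
  Finset.sum_induction X TraceBdd (fun _ _ => TraceBdd.add) ⟨0, fun n => by simp⟩ h

/-- If `P G P^*`, `P G` and `G P^*` are of order below `-d`, then `ξ P^* P + P^* P ξ` is
relatively trace bounded with respect to `G`. -/
theorem traceBdd_anticomm_mul {J : Type} [Fintype J] {d : ℕ} {P : J → OpFam ι}
    {ξ G g : OpFam ι} (hξ : UnifBdd ξ) (hξs : star ξ = ξ)
    (hPξ : ∀ μ, UnifBdd (P μ * ξ - ξ * P μ)) (hg : UnifBdd g)
    (hgP : ∀ μ, Commute g (star (P μ)))
    (h1 : ∀ μ, UnifBdd (P μ * G)) (h1' : ∀ μ, ApproxOrder d (d + 1) (P μ * G))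
    (h2 : ∀ μ, UnifBdd (G * star (P μ))) (h2' : ∀ μ, ApproxOrder d (d + 1) (G * star (P μ)))
    (h3 : ∀ μ, UnifBdd (P μ * G * star (P μ)))
    (h3' : ∀ μ, ApproxOrder d (d + 1) (P μ * G * star (P μ))) :
    TraceBdd ((ξ * (∑ μ, star (P μ) * P μ) + (∑ μ, star (P μ) * P μ) * ξ) * G * g) := by
  have key : ∀ {A X B : OpFam ι}, UnifBdd A → UnifBdd X → ApproxOrder d (d + 1) X → UnifBdd B →
      TraceBdd (A * X * B) := fun hA hX hX' hB =>
    ((ApproxOrder.unifBdd_mul hA hX').mul_unifBdd hB).trace_bdd ((hA.mul hX).mul hB)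
  -- Cyclicity carries the left `P*` around the trace to the right of `G`, so the two differences of
  -- the vertex end up on opposite sides.
  have hmain : ∀ μ, TraceBdd (star (P μ) * (ξ * P μ * G * g)) := fun μ => by
    refine TraceBdd.mul_comm ?_
    have e : ξ * P μ * G * g * star (P μ) = ξ * (P μ * G * star (P μ)) * g := by
      rw [mul_assoc _ g, (hgP μ).eq]; noncomm_ring
    rw [e]
    exact key hξ (h3 μ) (h3' μ) hg
  have hs : ∀ μ, UnifBdd (ξ * star (P μ) - star (P μ) * ξ) := fun μ => by
    have := (hPξ μ).star
    rwa [star_sub, star_mul, star_mul, hξs] at this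
  rw [add_mul, add_mul, Finset.mul_sum, Finset.sum_mul, Finset.sum_mul, Finset.sum_mul,
    Finset.sum_mul, Finset.sum_mul]
  refine (TraceBdd.sum _ fun μ _ => ?_).add (TraceBdd.sum _ fun μ _ => ?_)
  · have e : ξ * (star (P μ) * P μ) * G * g = star (P μ) * (ξ * P μ * G * g)
        + (ξ * star (P μ) - star (P μ) * ξ) * (P μ * G) * g := by noncomm_ring
    rw [e]
    exact (hmain μ).add (key (hs μ) (h1 μ) (h1' μ) hg)
  · have e : star (P μ) * P μ * ξ * G * g = star (P μ) * (ξ * P μ * G * g)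
        + star (P μ) * ((P μ * ξ - ξ * P μ) * G * g) := by noncomm_ring
    rw [e]
    refine (hmain μ).add (TraceBdd.mul_comm ?_)
    have e2 : (P μ * ξ - ξ * P μ) * G * g * star (P μ)
        = (P μ * ξ - ξ * P μ) * (G * star (P μ)) * g := by
      rw [mul_assoc _ g, (hgP μ).eq]; noncomm_ring
    rw [e2]
    exact key (hPξ μ) (h2 μ) (h2' μ) hg

/-- Both `G(-BC⁻¹)` and `(-C⁻¹B)G` equal `G - C⁻¹`. This allows smoothing factors to be placed on
both sides of `G`. -/
theorem mul_neg_pow_eq_neg_pow_mul {R : Type*} [Ring R] {C B Ci Gi : R} (h1 : Ci * C = 1)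
    (h2 : C * Ci = 1) (h3 : Gi * (C + B) = 1) (h4 : (C + B) * Gi = 1) (k : ℕ) :
    Gi * (-(B * Ci)) ^ k = (-(Ci * B)) ^ k * Gi := by
  have e1 : Gi * (-(B * Ci)) = Gi - Ci := by
    calc Gi * (-(B * Ci)) = Gi * C * Ci - Gi * (C + B) * Ci := by noncomm_ring
      _ = Gi - Ci := by rw [h3, one_mul, mul_assoc, h2, mul_one]
  have e2 : (-(Ci * B)) * Gi = Gi - Ci := by
    calc (-(Ci * B)) * Gi = Ci * C * Gi - Ci * ((C + B) * Gi) := by noncomm_ring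
      _ = Gi - Ci := by rw [h4, mul_one, h1, one_mul]
  induction k with
  | zero => simp
  | succ k ih => rw [pow_succ, ← mul_assoc, ih, mul_assoc, e1, ← e2, ← mul_assoc, ← pow_succ]

namespace IsLatticeGradient

variable {J : Type} [Fintype J] [DecidableEq J] {a : ℕ → ℝ} {P : J → OpFam ι} {M r : ℝ}

/-- The power `k + 2` is split as one factor `y` on the left, `k` factors beside `G` and one factor
`y*` on the right. The outer two absorb the differences of the vertex, keeping order one each, and
the middle has order `2k + 1`. -/
theorem traceBdd_remainder (h : IsLatticeGradient a P) {k : ℕ}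
    (hP : HasBlockPoincare (2 * (k + 1)) P) (hM : 0 < M) (hr : 0 < r) {Li Ci Gi : OpFam ι}
    {g : J → OpFam ι} {ξ γ : OpFam ι}
    (hLi : massOp a P M r * Li = 1) (hLi' : Li * massOp a P M r = 1)
    (hgb : ∀ μ, UnifBdd (g μ)) (hgs : ∀ μ, star (g μ) = -g μ)
    (hgc : ∀ μ ν, g μ * g ν + g ν * g μ = (if μ = ν then (-2 : ℂ) else 0) • 1)
    (hg : ∀ μ ν, Commute (g μ) (P ν)) (hg' : ∀ μ ν, Commute (g μ) (star (P ν)))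
    (hCi : schurOp a P M r Li * Ci = 1)
    (hGi : (schurOp a P M r Li + curvOp P g Li) * Gi = 1)
    (hξ : UnifBdd ξ) (hξs : star ξ = ξ) (hPξ : ∀ μ, UnifBdd (P μ * ξ - ξ * P μ))
    (hγ : UnifBdd γ) (hγP : ∀ μ, Commute γ (star (P μ))) :
    TraceBdd ((ξ * (∑ μ, star (P μ) * P μ) + (∑ μ, star (P μ) * P μ) * ξ)
      * (Gi * (-(curvOp P g Li * Ci)) ^ (k + 2)) * γ) := by
  set C := schurOp a P M r Li with hC
  set B := curvOp P g Li with hB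
  have hCs : star C = C := star_schurOp hLi
  have hBs : star B = B := star_curvOp hLi hLi' hgs hg hg'
  have hGs : star (C + B) = C + B := by rw [star_add, hCs, hBs]
  have hCis : star Ci = Ci := star_inverse_eq hCs hCi
  have hGis : star Gi = Gi := star_inverse_eq hGs hGi
  have hCi' : Ci * C = 1 := by
    have := congrArg star hCi; rwa [star_mul, hCs, hCis, star_one] at this
  have hGi' : Gi * (C + B) = 1 := by
    have := congrArg star hGi; rwa [star_mul, hGs, hGis, star_one] at this
  have hLib := h.unifBdd_massInv hM hr hLi
  have hCib : UnifBdd Ci := ⟨M⁻¹, fun n =>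
    norm_inverse_le_of_coercive hM (h.coercive_schurOp hM hr hLi n) (congrFun hCi n)⟩
  have hGib : UnifBdd Gi := ⟨M⁻¹, fun n =>
    norm_inverse_le_of_coercive hM
      (h.coercive_schurOp_add_curvOp hM hr hLi hLi' hgs hgc hg hg' n) (congrFun hGi n)⟩
  have hLB : UnifBdd (massOp a P M r * B) := h.unifBdd_mass_mul_curvOp hM hr hLi hgb hg hg'
  have hpC : IsParametrix a P M r C Ci Li := ⟨hCs, hCi, hCib, hLi, hLib,
    h.unifBdd_mass_mul_schurOp_sub hM hr hLi⟩
  have hpG : IsParametrix a P M r (C + B) Gi Li := ⟨hGs, hGi, hGib, hLi, hLib, by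
    have e : massOp a P M r * (C + B) - ellipticOp a P M r
        = (massOp a P M r * C - ellipticOp a P M r) + massOp a P M r * B := by noncomm_ring
    rw [e]
    exact hpC.remainder.add hLB⟩
  set y := -(Ci * B) with hy
  have hys : star y = -(B * Ci) := by rw [hy, star_neg, star_mul, hCis, hBs]
  -- Inserting `𝓛⁻¹𝓛` isolates the bounded factor `𝓛B`; all smoothing comes from `C⁻¹𝓛⁻¹`.
  have hyY : y = Ci * Li * (-(massOp a P M r * B)) := by
    rw [hy, mul_neg, mul_assoc Ci, ← mul_assoc Li, hLi', one_mul]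
  have hYb := hCib.mul hLib
  have hyb : UnifBdd y := hyY ▸ hYb.mul hLB.neg
  have hy2 : ApproxOrder (2 * (k + 1)) 2 y := by
    rw [hyY]
    exact (hP.approxOrder_two hYb (hpC.unifBdd_grad_mul h hM hr)
      (hpC.unifBdd_mul_star_grad h hM hr)
      (hpC.unifBdd_grad_mul_star_grad h hM hr)).mul_unifBdd hLB.neg
  have hPyb : ∀ μ, UnifBdd (P μ * y) := fun μ => by
    rw [hyY, ← mul_assoc]
    exact (hpC.unifBdd_grad_mul h hM hr μ).mul hLB.neg
  have hPy : ∀ μ, ApproxOrder (2 * (k + 1)) 1 (P μ * y) := fun μ => by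
    rw [hyY, ← mul_assoc]
    exact (hP.approxOrder_one_right (hpC.unifBdd_grad_mul h hM hr μ)
      (hpC.unifBdd_grad_mul_star_grad h hM hr μ)).mul_unifBdd hLB.neg
  have hyPb : ∀ μ, UnifBdd (star y * star (P μ)) := fun μ => by
    rw [← star_mul]; exact (hPyb μ).star
  have hyP : ∀ μ, ApproxOrder (2 * (k + 1)) 1 (star y * star (P μ)) := fun μ => by
    rw [← star_mul]; exact (hPy μ).star
  have hG1 : ApproxOrder (2 * (k + 1)) 1 Gi :=
    hP.approxOrder_one hGib (hpG.unifBdd_grad_inv h hM hr)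
  have hmid : ApproxOrder (2 * (k + 1)) (2 * k + 1) (y ^ k * Gi) := (hy2.pow k).mul hG1
  have hmidb : UnifBdd (y ^ k * Gi) := (hyb.pow k).mul hGib
  have hfac : Gi * (-(B * Ci)) ^ (k + 2) = y * (y ^ k * Gi) * star y := by
    rw [pow_succ, ← mul_assoc, mul_neg_pow_eq_neg_pow_mul hCi' hCi hGi' hGi, ← hy, hys, pow_succ',
      mul_assoc y]
  rw [hfac]
  have e1 : ∀ μ, P μ * (y * (y ^ k * Gi) * star y) = P μ * y * (y ^ k * Gi) * star y :=
    fun μ => by simp only [mul_assoc]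
  have e2 : ∀ μ, y * (y ^ k * Gi) * star y * star (P μ)
      = y * (y ^ k * Gi) * (star y * star (P μ)) := fun μ => by simp only [mul_assoc]
  have e3 : ∀ μ, P μ * (y * (y ^ k * Gi) * star y) * star (P μ)
      = P μ * y * (y ^ k * Gi) * (star y * star (P μ)) := fun μ => by simp only [mul_assoc]
  refine traceBdd_anticomm_mul (d := 2 * (k + 1)) hξ hξs hPξ hγ hγP
    (fun μ => ?_) (fun μ => ?_) (fun μ => ?_) (fun μ => ?_) (fun μ => ?_) (fun μ => ?_)
  · rw [e1]; exact ((hPyb μ).mul hmidb).mul hyb.star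
  · rw [e1]; exact (((hPy μ).mul hmid).mul hy2.star).mono (by omega)
  · rw [e2]; exact (hyb.mul hmidb).mul (hyPb μ)
  · rw [e2]; exact ((hy2.mul hmid).mul (hyP μ)).mono (by omega)
  · rw [e3]; exact ((hPyb μ).mul hmidb).mul (hyPb μ)
  -- The critical case: `1 + (2k+1) + 1` is exactly one more than the dimension `2(k+1)`.
  · rw [e3]; exact (((hPy μ).mul hmid).mul (hyP μ)).mono (by omega)

end IsLatticeGradient

end TraceBound

/-! ### Uniform bounds for smooth periodic functions -/

section Periodic

variable {d : ℕ} {L : ℝ}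

theorem periodic_add_sum {F : Type*} {g : (Fin d → ℝ) → F}
    (hp : ∀ ν x, g (x + Pi.single ν L) = g x) (k : Fin d → ℤ) (x : Fin d → ℝ) :
    g (x + fun ν => k ν * L) = g x := by
  have h1 : (fun ν => k ν * L) = ∑ ν, k ν • (Pi.single ν L : Fin d → ℝ) := by
    funext μ
    simp [Finset.sum_apply, Pi.single_apply]
  have h2 : ∀ s : Finset (Fin d),
      g (x + ∑ ν ∈ s, k ν • (Pi.single ν L : Fin d → ℝ)) = g x := by
    classical
    intro s
    induction s using Finset.induction_on with
    | empty => simp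
    | insert ν s hν ih =>
      have hper : Function.Periodic g (Pi.single ν L : Fin d → ℝ) := hp ν
      rw [Finset.sum_insert hν, add_comm (k ν • _), ← add_assoc, hper.zsmul (k ν), ih]
  rw [h1, h2]

theorem exists_bound_of_periodic {F : Type*} [NormedAddCommGroup F] {g : (Fin d → ℝ) → F}
    (hL : 0 < L) (hg : Continuous g) (hp : ∀ ν x, g (x + Pi.single ν L) = g x) :
    ∃ K : ℝ, 0 ≤ K ∧ ∀ x, ‖g x‖ ≤ K := by
  obtain ⟨K, hK⟩ := (isCompact_Icc (a := (0 : Fin d → ℝ)) (b := fun _ => L)).exists_bound_of_continuousOn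
    hg.continuousOn
  refine ⟨|K|, abs_nonneg K, fun x => ?_⟩
  have h1 := periodic_add_sum hp (fun ν => -⌊x ν / L⌋) x
  rw [← h1]
  refine (hK _ ⟨fun ν => ?_, fun ν => ?_⟩).trans (le_abs_self K)
  · have := (le_div_iff₀ hL).mp (Int.floor_le (x ν / L))
    simp only [Pi.zero_apply, Pi.add_apply, Int.cast_neg]
    linarith
  · have := (div_lt_iff₀ hL).mp (Int.lt_floor_add_one (x ν / L))
    simp only [Pi.add_apply, Int.cast_neg]
    linarith

theorem periodic_fderiv {F : Type*} [NormedAddCommGroup F] [NormedSpace ℝ F]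
    {f : (Fin d → ℝ) → F} (hp : ∀ ν x, f (x + Pi.single ν L) = f x) (ν : Fin d)
    (x : Fin d → ℝ) : fderiv ℝ f (x + Pi.single ν L) = fderiv ℝ f x := by
  rw [← fderiv_comp_add_right]
  congr 1
  funext y
  exact hp ν y

theorem exists_lipschitz_of_periodic {F : Type*} [NormedAddCommGroup F] [NormedSpace ℝ F]
    {f : (Fin d → ℝ) → F} (hL : 0 < L) (hf : ContDiff ℝ ∞ f)
    (hp : ∀ ν x, f (x + Pi.single ν L) = f x) :
    ∃ K : ℝ, 0 ≤ K ∧ ∀ x y, ‖f y - f x‖ ≤ K * ‖y - x‖ := by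
  obtain ⟨K, hK0, hK⟩ := exists_bound_of_periodic hL (hf.continuous_fderiv (by simp))
    (periodic_fderiv hp)
  refine ⟨K, hK0, fun x y => ?_⟩
  exact convex_univ.norm_image_sub_le_of_norm_fderiv_le
    (fun z _ => (hf.differentiable (by simp)).differentiableAt) (fun z _ => hK z)
    (Set.mem_univ x) (Set.mem_univ y)

/-- Mean value inequality for `y ↦ f (y + k) - f y`, whose derivative is `O(‖k‖)` because the
derivative of `f` is Lipschitz. -/
theorem exists_second_difference_bound {f : (Fin d → ℝ) → ℝ} (hL : 0 < L)
    (hf : ContDiff ℝ ∞ f) (hp : ∀ ν x, f (x + Pi.single ν L) = f x) :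
    ∃ K : ℝ, 0 ≤ K ∧ ∀ x h k : Fin d → ℝ,
      |(f (x + h + k) - f (x + h)) - (f (x + k) - f x)| ≤ K * ‖h‖ * ‖k‖ := by
  have hf' : ContDiff ℝ ∞ (fderiv ℝ f) := hf.fderiv_right (by simp)
  obtain ⟨K, hK0, hK⟩ := exists_lipschitz_of_periodic hL hf' (periodic_fderiv hp)
  refine ⟨K, hK0, fun x h k => ?_⟩
  have hd : Differentiable ℝ f := hf.differentiable (by simp)
  have hdk : Differentiable ℝ fun y => f (y + k) := hd.comp (differentiable_id.add_const k)
  have h1 := convex_univ.norm_image_sub_le_of_norm_fderiv_le (𝕜 := ℝ)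
    (f := fun y => f (y + k) - f y) (C := K * ‖k‖)
    (fun z _ => (hdk.sub hd).differentiableAt) (fun z _ => ?_)
    (Set.mem_univ x) (Set.mem_univ (x + h))
  · rw [add_sub_cancel_left] at h1
    rw [← Real.norm_eq_abs]
    refine h1.trans (le_of_eq ?_)
    ring
  · have e : fderiv ℝ (fun y => f (y + k) - f y) z = fderiv ℝ f (z + k) - fderiv ℝ f z := by
      rw [fderiv_fun_sub (hdk z) (hd z), fderiv_comp_add_right]
    rw [e]
    simpa using hK z (z + k)

end Periodic

/-! ### Commutator bounds for differences of unitary translations -/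

section Unitary

set_option linter.unusedSectionVars false

open scoped Matrix.Norms.L2Operator

variable {ι : ℕ → Type} [∀ n, Fintype (ι n)] [∀ n, DecidableEq (ι n)]

theorem unifBdd_of_star_mul_self {X : OpFam ι} (h : star X * X = 1) : UnifBdd X := by
  obtain ⟨K, hK⟩ := UnifBdd.one (ι := ι)
  refine ⟨K + 1, fun n => ?_⟩
  have h1 := congrFun h n
  simp only [Pi.mul_apply, Pi.star_apply] at h1
  have h2 : ‖X n‖ * ‖X n‖ ≤ K := by
    rw [← CStarRing.norm_star_mul_self, h1]; exact hK n
  nlinarith [norm_nonneg (X n), sq_nonneg (‖X n‖ - 1)]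

theorem scale_scale (a b : ℕ → ℝ) (X : OpFam ι) : scale a (scale b X) = scale (a * b) X := by
  funext n
  simp only [scale, smul_smul, Pi.mul_apply, Complex.ofReal_mul]

/-- Covariant differences of unitary families with small commutators form a lattice gradient. -/
theorem isLatticeGradient_of_unitary {J : Type} {a : ℕ → ℝ} {T : J → OpFam ι}
    (ha : ∀ n, 0 < a n) (ha' : ∃ a₀, ∀ n, a n ≤ a₀)
    (hT : ∀ μ, star (T μ) * T μ = 1) (hT' : ∀ μ, T μ * star (T μ) = 1)
    (hc : ∀ μ ν, UnifBdd (scale (a⁻¹ * a⁻¹) (T μ * T ν - T ν * T μ)))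
    (hcc : ∀ μ ν ρ, UnifBdd (scale (a⁻¹ * a⁻¹ * a⁻¹)
      ((T μ * T ν - T ν * T μ) * T ρ - T ρ * (T μ * T ν - T ν * T μ)))) :
    IsLatticeGradient a fun μ => scale a⁻¹ (T μ - 1) := by
  have hTb : ∀ μ, UnifBdd (T μ) := fun μ => unifBdd_of_star_mul_self (hT μ)
  have hsb : ∀ μ, UnifBdd (star (T μ)) := fun μ => (hTb μ).star
  have hone : a * a⁻¹ = 1 := by funext n; simp [(ha n).ne']
  have e2 : ∀ X Y : OpFam ι, scale a⁻¹ (X - 1) * scale a⁻¹ (Y - 1)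
      - scale a⁻¹ (Y - 1) * scale a⁻¹ (X - 1) = scale (a⁻¹ * a⁻¹) (X * Y - Y * X) := by
    intro X Y
    simp only [scale_mul, mul_scale, scale_scale, ← scale_sub]
    congr 1; noncomm_ring
  have e3 : ∀ X Y : OpFam ι, scale a⁻¹ (X - 1) * scale (a⁻¹ * a⁻¹) Y
      - scale (a⁻¹ * a⁻¹) Y * scale a⁻¹ (X - 1)
      = scale (a⁻¹ * a⁻¹ * a⁻¹) (X * Y - Y * X) := by
    intro X Y
    simp only [scale_mul, mul_scale, scale_scale]
    rw [← mul_assoc, ← scale_sub]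
    congr 1; noncomm_ring
  have es : ∀ μ, star (scale a⁻¹ (T μ - 1)) = scale a⁻¹ (star (T μ) - 1) := fun μ => by
    rw [star_scale, star_sub, star_one]
  -- By unitarity a commutator with `T*` is a conjugated commutator with `T`, so all adjoint
  -- versions reduce to the given bounds.
  have c1 : ∀ (X : OpFam ι) ν, X * star (T ν) - star (T ν) * X
      = star (T ν) * (T ν * X - X * T ν) * star (T ν) := by
    intro X ν
    calc X * star (T ν) - star (T ν) * X
        = (star (T ν) * T ν) * X * star (T ν) - star (T ν) * X * (T ν * star (T ν)) := by
          rw [hT, hT', one_mul, mul_one]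
      _ = _ := by noncomm_ring
  have hcs : ∀ μ ν, UnifBdd (scale (a⁻¹ * a⁻¹) (T μ * star (T ν) - star (T ν) * T μ)) := by
    intro μ ν
    rw [c1, ← scale_mul, ← mul_scale]
    exact ((hsb ν).mul (hc ν μ)).mul (hsb ν)
  have c2 : ∀ (X : OpFam ι) ν, UnifBdd (scale (a⁻¹ * a⁻¹ * a⁻¹) (X * T ν - T ν * X)) →
      UnifBdd (scale (a⁻¹ * a⁻¹ * a⁻¹) (star (T ν) * X - X * star (T ν))) := by
    intro X ν hX
    have e : star (T ν) * X - X * star (T ν)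
        = star (T ν) * (X * T ν - T ν * X) * star (T ν) := by
      rw [← neg_sub (X * star (T ν)), c1]; noncomm_ring
    rw [e, ← scale_mul, ← mul_scale]
    exact ((hsb ν).mul hX).mul (hsb ν)
  have hprod : a * (a⁻¹ * a⁻¹) * (a⁻¹ * a⁻¹) = a⁻¹ * a⁻¹ * a⁻¹ := by
    calc a * (a⁻¹ * a⁻¹) * (a⁻¹ * a⁻¹) = (a * a⁻¹) * (a⁻¹ * a⁻¹ * a⁻¹) := by ring
      _ = _ := by rw [hone, one_mul]
  refine ⟨ha, fun μ => ?_, fun μ => ?_, fun μ ν => ?_, fun μ ν => ?_, fun μ ν => ?_,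
    fun μ ν => ?_⟩
  · simp only [es, scale_mul, mul_scale]
    congr 2
    simp only [sub_mul, mul_sub, hT, hT', one_mul, mul_one]
    abel
  · have h1 : scale a⁻¹ (T μ - 1) + scale a⁻¹ (star (T μ) - 1)
        = scale (a * a⁻¹ * a⁻¹) (T μ - 1 + (star (T μ) - 1)) := by
      rw [hone, one_mul, scale_add]
    rw [es, h1]
    simp only [scale_mul, mul_scale, scale_scale, ← mul_assoc, ← scale_neg]
    congr 1
    simp only [sub_mul, mul_sub, hT, one_mul, mul_one]
    abel
  · rw [e2]; exact hc μ ν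
  · rw [es, e2]; exact hcs μ ν
  · rw [e2, es, e3]
    exact c2 _ _ (hcc μ ν ν)
  · rw [es, es, e2, e3]
    refine c2 _ _ ?_
    set Z := T μ * T ν - T ν * T μ with hZ
    have hz : star (T μ) * T ν - T ν * star (T μ) = -(star (T μ) * Z * star (T μ)) := by
      rw [← neg_sub, c1]
    have hz' : T ν * star (T μ) = star (T μ) * T ν + star (T μ) * Z * star (T μ) := by
      rw [← neg_eq_iff_eq_neg, neg_sub] at hz
      rw [← hz]; abel
    have hz'' : star (T μ) * T ν = T ν * star (T μ) - star (T μ) * Z * star (T μ) := by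
      rw [hz']; abel
    -- With `[T_μ*, T_ν] = -T_μ* Z T_μ*`, a further commutator with `T_ν` meets `Z`, giving a double
    -- commutator of size `a³`, and the two outer `T_μ*`, each giving a term quadratic in `Z`.
    have e : (star (T μ) * T ν - T ν * star (T μ)) * T ν
        - T ν * (star (T μ) * T ν - T ν * star (T μ))
        = -(star (T μ) * (Z * T ν - T ν * Z) * star (T μ))
          + (star (T μ) * Z * star (T μ) * Z * star (T μ)
            + star (T μ) * Z * star (T μ) * Z * star (T μ)) := by
      rw [hz]
      have h1 : star (T μ) * Z * star (T μ) * T ν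
          = star (T μ) * Z * (T ν * star (T μ) - star (T μ) * Z * star (T μ)) := by
        rw [mul_assoc _ (star (T μ)), hz'']
      have h2 : T ν * (star (T μ) * Z * star (T μ))
          = (star (T μ) * T ν + star (T μ) * Z * star (T μ)) * Z * star (T μ) := by
        rw [← hz']; noncomm_ring
      rw [neg_mul, h1, mul_neg, h2]
      noncomm_ring
    -- Two factors `Z` are worth `a⁴`, one power more than required; boundedness of `a` disposes of
    -- it.
    have hq : UnifBdd (scale (a⁻¹ * a⁻¹ * a⁻¹) (star (T μ) * Z * star (T μ) * Z * star (T μ))) := by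
      have e4 : scale (a⁻¹ * a⁻¹ * a⁻¹) (star (T μ) * Z * star (T μ) * Z * star (T μ))
          = scale a (star (T μ) * scale (a⁻¹ * a⁻¹) Z * star (T μ)
            * scale (a⁻¹ * a⁻¹) Z * star (T μ)) := by
        simp only [scale_mul, mul_scale, scale_scale]
        rw [← hprod, mul_assoc a]
      rw [e4]
      exact UnifBdd.scale (((((hsb μ).mul (hc μ ν)).mul (hsb μ)).mul (hc μ ν)).mul (hsb μ)) ha ha'
    rw [e, scale_add, scale_neg, scale_add]
    refine UnifBdd.add (UnifBdd.neg ?_) (hq.add hq)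
    rw [← scale_mul, ← mul_scale]
    exact ((hsb μ).mul (hcc μ ν ν)).mul (hsb μ)

end Unitary

/-! ### Sites, free translations and link phases -/

section Lattice

variable {d N : ℕ} {L : ℝ}

theorem next_injective (μ : Fin d) : Function.Injective (next (N := N) μ) := by
  intro x y hxy
  have h1 : ∀ ν, ν ≠ μ → x ν = y ν := fun ν hν => by
    have := congrFun hxy ν
    simpa [next, Function.update_of_ne hν] using this
  have h2 : x μ = y μ := by
    have := congrFun hxy μ
    simpa [next] using this
  funext ν
  by_cases hν : ν = μ
  · rw [hν, h2]
  · exact h1 ν hν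

theorem next_comm (μ ν : Fin d) (x : Site d N) : next μ (next ν x) = next ν (next μ x) := by
  rcases eq_or_ne μ ν with rfl | h
  · rfl
  · simp only [next, Function.update_of_ne h, Function.update_of_ne h.symm]
    exact Function.update_comm h.symm _ _ x

theorem bcSign_next_of_ne {μ ν : Fin d} (h : μ ≠ ν) (x : Site d N) :
    bcSign μ (next ν x) = bcSign μ x := by
  simp only [bcSign, next, Function.update_of_ne h]

theorem norm_bcSign (μ : Fin d) (x : Site d N) : ‖bcSign μ x‖ = 1 := by
  rw [bcSign]; split_ifs <;> simp

theorem freeTranslation_mul_diagonal (μ : Fin d) (v : Site d N → ℂ) :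
    freeTranslation N μ * Matrix.diagonal v
      = Matrix.diagonal (fun x => v (next μ x)) * freeTranslation N μ := by
  ext x y
  rw [Matrix.mul_diagonal, Matrix.diagonal_mul]
  simp only [freeTranslation, Matrix.of_apply]
  split_ifs with h
  · rw [h, mul_comm]
  · simp

/-- The anti-periodic sign in direction `μ` depends on the coordinate `x μ` alone, so a step in
another direction leaves it unchanged: the boundary condition creates no flux. -/
theorem freeTranslation_comm (μ ν : Fin d) :
    freeTranslation N μ * freeTranslation N ν = freeTranslation N ν * freeTranslation N μ := by
  rcases eq_or_ne μ ν with rfl | h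
  · rfl
  · ext x z
    simp only [Matrix.mul_apply, freeTranslation, Matrix.of_apply, ite_mul, zero_mul,
      Finset.sum_ite_eq', Finset.mem_univ, if_true]
    rw [next_comm ν μ, bcSign_next_of_ne h.symm, bcSign_next_of_ne h]
    split_ifs
    · rw [mul_comm]
    · simp

theorem freeTranslation_mul_conjTranspose (μ : Fin d) :
    freeTranslation N μ * (freeTranslation N μ)ᴴ = 1 := by
  ext x z
  simp only [Matrix.mul_apply, freeTranslation, Matrix.conjTranspose_apply, Matrix.of_apply,
    ite_mul, zero_mul, Finset.sum_ite_eq', Finset.mem_univ, if_true,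
    Matrix.one_apply, (next_injective μ).eq_iff]
  split_ifs with h
  · subst h
    rw [Complex.star_def, Complex.mul_conj, Complex.normSq_eq_norm_sq, norm_bcSign]
    simp
  · simp

/-- Sum of the potential along the link in direction `μ` starting at `y`. -/
noncomputable def lineIntegral (A : Fin d → (Fin d → ℝ) → ℝ) (a : ℝ) (μ : Fin d)
    (y : Fin d → ℝ) : ℝ :=
  ∫ s in (0 : ℝ)..a, A μ (y + Pi.single μ s)

theorem link_eq (Q : ℝ) (A : Fin d → (Fin d → ℝ) → ℝ) (μ : Fin d) (x : Site d N) :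
    link L Q A N μ x
      = Complex.exp (Complex.I * ((-Q * lineIntegral A (spacing L N) μ (point L N x) : ℝ) : ℂ)) := by
  rw [link, lineIntegral]
  congr 1
  push_cast
  ring

theorem norm_exp_I_mul (x : ℝ) : ‖Complex.exp (Complex.I * x)‖ = 1 := by
  rw [mul_comm, Complex.norm_exp_ofReal_mul_I]

theorem norm_exp_I_mul_sub_exp_I_mul_le (x y : ℝ) :
    ‖Complex.exp (Complex.I * x) - Complex.exp (Complex.I * y)‖ ≤ |x - y| := by
  have h : Complex.exp (Complex.I * x) - Complex.exp (Complex.I * y)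
      = Complex.exp (Complex.I * y) * (Complex.exp (Complex.I * ((x - y : ℝ) : ℂ)) - 1) := by
    rw [mul_sub, ← Complex.exp_add, mul_one]
    congr 2
    push_cast
    ring
  rw [h, norm_mul, norm_exp_I_mul, one_mul]
  exact Real.norm_exp_I_mul_ofReal_sub_one_le

theorem norm_link (Q : ℝ) (A : Fin d → (Fin d → ℝ) → ℝ) (μ : Fin d) (x : Site d N) :
    ‖link L Q A N μ x‖ = 1 := by
  rw [link_eq, norm_exp_I_mul]

/-- On a link that wraps around, the represented point jumps back by the period `L`; for periodic
functions the jump is invisible. -/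
theorem apply_point_next {F : Type*} {f : (Fin d → ℝ) → F} (hL : L ≠ 0)
    (hf : ∀ ν x, f (x + Pi.single ν L) = f x) (n : ℕ) (μ : Fin d) (x : Site d (n + 1)) :
    f (point L (n + 1) (next μ x))
      = f (point L (n + 1) x + Pi.single μ (spacing L (n + 1))) := by
  by_cases h : x μ = Fin.last n
  · rw [← hf μ (point L (n + 1) (next μ x))]
    congr 1
    funext ν
    by_cases hν : ν = μ
    · subst hν
      have : ((n : ℝ) + 1) ≠ 0 := by positivity
      simp only [Pi.add_apply, Pi.single_eq_same, point, next, Function.update_self, spacing, h]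
      rw [finRotate_last]
      simp only [Fin.val_zero, Fin.val_last, Nat.cast_zero, mul_zero, zero_add, Nat.cast_add,
        Nat.cast_one]
      field_simp
    · simp [point, next, Function.update_of_ne hν, Pi.single_eq_of_ne hν]
  · congr 1
    funext ν
    by_cases hν : ν = μ
    · subst hν
      simp only [Pi.add_apply, Pi.single_eq_same, point, next, Function.update_self]
      have h2 : x ν < Fin.last n := lt_of_le_of_ne (Fin.le_last _) h
      rw [finRotate_apply, Fin.val_add_one_of_lt h2]
      push_cast
      ring
    · simp [point, next, Function.update_of_ne hν, Pi.single_eq_of_ne hν]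

end Lattice

/-! ### Flux and holonomy of the background field -/

section Plaquette

variable {d : ℕ} {L : ℝ} {A : Fin d → (Fin d → ℝ) → ℝ}

theorem lineIntegral_add_period (hper : ∀ μ ν x, A μ (x + Pi.single ν L) = A μ x) (a : ℝ)
    (μ ν : Fin d) (y : Fin d → ℝ) :
    lineIntegral A a μ (y + Pi.single ν L) = lineIntegral A a μ y := by
  rw [lineIntegral, lineIntegral]
  congr 1
  funext s
  rw [add_right_comm, hper]

theorem intervalIntegrable_line (hA : ∀ μ, Continuous (A μ)) (a : ℝ) (μ : Fin d)
    (y : Fin d → ℝ) :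
    IntervalIntegrable (fun s => A μ (y + Pi.single μ s)) MeasureTheory.volume 0 a := by
  have h : Continuous fun s : ℝ => (Pi.single μ s : Fin d → ℝ) :=
    continuous_const.update μ continuous_id
  exact ((hA μ).comp (continuous_const.add h)).intervalIntegrable _ _

theorem abs_lineIntegral_le {K a : ℝ} (ha : 0 ≤ a) {μ : Fin d} (hK : ∀ x, ‖A μ x‖ ≤ K)
    (y : Fin d → ℝ) : |lineIntegral A a μ y| ≤ K * a := by
  have := intervalIntegral.norm_integral_le_of_norm_le_const (a := 0) (b := a)
    (f := fun s => A μ (y + Pi.single μ s)) (C := K) fun s _ => hK _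
  rwa [sub_zero, abs_of_nonneg ha] at this

theorem abs_lineIntegral_sub_le (hA : ∀ μ, Continuous (A μ)) {K a : ℝ} (ha : 0 ≤ a) {μ : Fin d}
    (hK : ∀ x y, ‖A μ y - A μ x‖ ≤ K * ‖y - x‖) (y h : Fin d → ℝ) :
    |lineIntegral A a μ (y + h) - lineIntegral A a μ y| ≤ K * ‖h‖ * a := by
  rw [lineIntegral, lineIntegral, ← intervalIntegral.integral_sub
    (intervalIntegrable_line hA a μ _) (intervalIntegrable_line hA a μ _)]
  have := intervalIntegral.norm_integral_le_of_norm_le_const (a := 0) (b := a)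
    (f := fun s => A μ (y + h + Pi.single μ s) - A μ (y + Pi.single μ s)) (C := K * ‖h‖)
    fun s _ => by
      refine (hK _ _).trans (le_of_eq ?_)
      congr 2; abel
  rwa [sub_zero, abs_of_nonneg ha] at this

theorem abs_lineIntegral_second_difference_le (hA : ∀ μ, Continuous (A μ)) {K a : ℝ}
    (ha : 0 ≤ a) {μ : Fin d}
    (hK : ∀ x h k : Fin d → ℝ,
      |(A μ (x + h + k) - A μ (x + h)) - (A μ (x + k) - A μ x)| ≤ K * ‖h‖ * ‖k‖)
    (y h k : Fin d → ℝ) :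
    |(lineIntegral A a μ (y + h + k) - lineIntegral A a μ (y + h))
      - (lineIntegral A a μ (y + k) - lineIntegral A a μ y)| ≤ K * ‖h‖ * ‖k‖ * a := by
  simp only [lineIntegral]
  have hi := fun z => intervalIntegrable_line hA a μ z
  rw [← intervalIntegral.integral_sub (hi _) (hi _), ← intervalIntegral.integral_sub (hi _) (hi _),
    ← intervalIntegral.integral_sub ((hi _).sub (hi _)) ((hi _).sub (hi _))]
  have := intervalIntegral.norm_integral_le_of_norm_le_const (a := 0) (b := a)
    (f := fun s => (A μ (y + h + k + Pi.single μ s) - A μ (y + h + Pi.single μ s))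
      - (A μ (y + k + Pi.single μ s) - A μ (y + Pi.single μ s))) (C := K * ‖h‖ * ‖k‖)
    fun s _ => by
      have := hK (y + Pi.single μ s) h k
      rwa [add_right_comm y (Pi.single μ s) h, add_right_comm (y + h) (Pi.single μ s) k,
        add_right_comm y (Pi.single μ s) k, ← Real.norm_eq_abs] at this
  rwa [sub_zero, abs_of_nonneg ha] at this

/-- The flux of the potential through the plaquette at `y` in directions `μ`, `ν`. -/
noncomputable def flux (A : Fin d → (Fin d → ℝ) → ℝ) (a : ℝ) (μ ν : Fin d)
    (y : Fin d → ℝ) : ℝ :=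
  lineIntegral A a μ y + lineIntegral A a ν (y + Pi.single μ a)
    - lineIntegral A a ν y - lineIntegral A a μ (y + Pi.single ν a)

/-- The flux is a difference of two first differences of line integrals: one power of `a` from the
length of the link, one from the Lipschitz bound. -/
theorem exists_abs_flux_le (hL : 0 < L) (hA : ∀ μ, ContDiff ℝ ∞ (A μ))
    (hper : ∀ μ ν x, A μ (x + Pi.single ν L) = A μ x) (μ ν : Fin d) :
    ∃ K : ℝ, 0 ≤ K ∧ ∀ a, 0 ≤ a → ∀ y, |flux A a μ ν y| ≤ K * a ^ 2 := by
  obtain ⟨K, hK0, hK⟩ := exists_lipschitz_of_periodic hL (hA μ) (hper μ)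
  obtain ⟨K', hK'0, hK'⟩ := exists_lipschitz_of_periodic hL (hA ν) (hper ν)
  refine ⟨K + K', by positivity, fun a ha y => ?_⟩
  have hc : ∀ μ, Continuous (A μ) := fun μ => (hA μ).continuous
  have h1 := abs_lineIntegral_sub_le hc ha hK y (Pi.single ν a)
  have h2 := abs_lineIntegral_sub_le hc ha hK' y (Pi.single μ a)
  rw [Pi.norm_single, Real.norm_of_nonneg ha] at h1 h2
  rw [abs_le] at h1 h2 ⊢
  rw [flux]
  have : (K + K') * a ^ 2 = K * a * a + K' * a * a := by ring
  rw [this]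
  constructor <;> linarith [h1.1, h1.2, h2.1, h2.2]

/-- Shifting the plaquette produces second differences of the line integrals, hence a further power
of `a`. -/
theorem exists_abs_flux_sub_le (hL : 0 < L) (hA : ∀ μ, ContDiff ℝ ∞ (A μ))
    (hper : ∀ μ ν x, A μ (x + Pi.single ν L) = A μ x) (μ ν ρ : Fin d) :
    ∃ K : ℝ, 0 ≤ K ∧ ∀ a, 0 ≤ a → ∀ y,
      |flux A a μ ν (y + Pi.single ρ a) - flux A a μ ν y| ≤ K * a ^ 3 := by
  obtain ⟨K, hK0, hK⟩ := exists_second_difference_bound hL (hA μ) (hper μ)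
  obtain ⟨K', hK'0, hK'⟩ := exists_second_difference_bound hL (hA ν) (hper ν)
  refine ⟨K + K', by positivity, fun a ha y => ?_⟩
  have hc : ∀ μ, Continuous (A μ) := fun μ => (hA μ).continuous
  have h1 := abs_lineIntegral_second_difference_le hc ha hK y (Pi.single ρ a) (Pi.single ν a)
  have h2 := abs_lineIntegral_second_difference_le hc ha hK' y (Pi.single ρ a) (Pi.single μ a)
  rw [Pi.norm_single, Pi.norm_single, Real.norm_of_nonneg ha] at h1 h2
  rw [abs_le] at h1 h2 ⊢
  rw [flux, flux]
  have : (K + K') * a ^ 3 = K * a * a * a + K' * a * a * a := by ring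
  rw [this]
  constructor <;> linarith [h1.1, h1.2, h2.1, h2.2]

theorem flux_add_period (hper : ∀ μ ν x, A μ (x + Pi.single ν L) = A μ x) (a : ℝ)
    (μ ν ρ : Fin d) (y : Fin d → ℝ) :
    flux A a μ ν (y + Pi.single ρ L) = flux A a μ ν y := by
  have h : ∀ κ σ, lineIntegral A a κ (y + Pi.single ρ L + Pi.single σ a)
      = lineIntegral A a κ (y + Pi.single σ a) := fun κ σ => by
    rw [add_right_comm, lineIntegral_add_period hper]
  simp only [flux, lineIntegral_add_period hper, h]

/-- The holonomy around the plaquette at `x` in directions `μ`, `ν`. -/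
noncomputable def holonomy (L Q : ℝ) (A : Fin d → (Fin d → ℝ) → ℝ) (N : ℕ) (μ ν : Fin d)
    (x : Site d N) : ℂ :=
  Complex.exp (Complex.I * ((-Q * flux A (spacing L N) μ ν (point L N x) : ℝ) : ℂ))

theorem link_mul_link_next (hL : 0 < L) (Q : ℝ)
    (hper : ∀ μ ν x, A μ (x + Pi.single ν L) = A μ x) (n : ℕ) (μ ν : Fin d)
    (x : Site d (n + 1)) :
    link L Q A (n + 1) μ x * link L Q A (n + 1) ν (next μ x)
      = holonomy L Q A (n + 1) μ ν x
        * (link L Q A (n + 1) ν x * link L Q A (n + 1) μ (next ν x)) := by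
  have h : ∀ κ σ, lineIntegral A (spacing L (n + 1)) κ (point L (n + 1) (next σ x))
      = lineIntegral A (spacing L (n + 1)) κ
        (point L (n + 1) x + Pi.single σ (spacing L (n + 1))) := fun κ σ =>
    apply_point_next hL.ne' (fun ν y => lineIntegral_add_period hper _ κ ν y) n σ x
  rw [link_eq, link_eq, link_eq, link_eq, holonomy, flux, h, h, ← Complex.exp_add,
    ← Complex.exp_add, ← Complex.exp_add]
  congr 1
  push_cast
  ring

end Plaquette

/-! ### Covariant translations on spinor fields -/

section Spinor

variable {d N : ℕ} {L Q : ℝ} {A : Fin d → (Fin d → ℝ) → ℝ}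

/-- Multiplication of spinor fields by a function on the sites. -/
def siteDiag (v : Site d N → ℂ) : SpinorOp d N := Matrix.diagonal fun p => v p.1

theorem siteDiag_eq_kronecker (v : Site d N → ℂ) :
    siteDiag v = Matrix.diagonal v ⊗ₖ (1 : Matrix (Spin d) (Spin d) ℂ) := by
  rw [← Matrix.diagonal_one, Matrix.diagonal_kronecker_diagonal]
  simp [siteDiag]

theorem translation_mul_siteDiag (μ : Fin d) (v : Site d N → ℂ) :
    translation L Q A N μ * siteDiag v
      = siteDiag (fun x => v (next μ x)) * translation L Q A N μ := by
  rw [translation, siteDiag_eq_kronecker, siteDiag_eq_kronecker, ← Matrix.mul_kronecker_mul,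
    ← Matrix.mul_kronecker_mul, Matrix.mul_assoc, freeTranslation_mul_diagonal,
    ← Matrix.mul_assoc, ← Matrix.mul_assoc, Matrix.diagonal_mul_diagonal,
    Matrix.diagonal_mul_diagonal]
  congr 4
  funext x
  rw [mul_comm]

theorem translation_mul_conjTranspose (μ : Fin d) :
    translation L Q A N μ * (translation L Q A N μ)ᴴ = 1 := by
  rw [translation, Matrix.conjTranspose_kronecker, ← Matrix.mul_kronecker_mul,
    Matrix.conjTranspose_mul, Matrix.mul_assoc, ← Matrix.mul_assoc (freeTranslation N μ),
    freeTranslation_mul_conjTranspose, Matrix.one_mul, Matrix.diagonal_conjTranspose,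
    Matrix.diagonal_mul_diagonal, Matrix.conjTranspose_one, Matrix.one_mul]
  have : (fun i => link L Q A N μ i * star (link L Q A N μ) i) = 1 := by
    funext x
    rw [Pi.star_apply, Complex.star_def, Complex.mul_conj, Complex.normSq_eq_norm_sq, norm_link]
    simp
  rw [this, Matrix.diagonal_one', Matrix.one_kronecker_one]

theorem conjTranspose_mul_translation (μ : Fin d) :
    (translation L Q A N μ)ᴴ * translation L Q A N μ = 1 :=
  mul_eq_one_comm.mp (translation_mul_conjTranspose μ)

/-- Free translations commute, so the only obstruction is the ratio of link phases along the two
routes to the opposite corner of the plaquette. -/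
theorem translation_mul_translation (hL : 0 < L)
    (hper : ∀ μ ν x, A μ (x + Pi.single ν L) = A μ x) (n : ℕ) (μ ν : Fin d) :
    translation L Q A (n + 1) μ * translation L Q A (n + 1) ν
      = siteDiag (holonomy L Q A (n + 1) μ ν)
        * (translation L Q A (n + 1) ν * translation L Q A (n + 1) μ) := by
  have h : ∀ κ σ : Fin d, translation L Q A (n + 1) κ * translation L Q A (n + 1) σ
      = siteDiag (fun x => link L Q A (n + 1) κ x * link L Q A (n + 1) σ (next κ x))
        * ((freeTranslation (n + 1) κ * freeTranslation (n + 1) σ) ⊗ₖ 1) := by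
    intro κ σ
    rw [translation, translation, siteDiag_eq_kronecker, ← Matrix.mul_kronecker_mul,
      ← Matrix.mul_kronecker_mul, Matrix.mul_assoc, ← Matrix.mul_assoc (freeTranslation _ κ),
      freeTranslation_mul_diagonal, Matrix.mul_assoc, ← Matrix.mul_assoc (Matrix.diagonal _),
      Matrix.diagonal_mul_diagonal]
  rw [h, h, ← Matrix.mul_assoc, freeTranslation_comm μ ν]
  congr 1
  rw [siteDiag, siteDiag, siteDiag, Matrix.diagonal_mul_diagonal]
  congr 1
  funext p
  exact link_mul_link_next hL Q hper n μ ν p.1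

theorem siteDiag_sub (v w : Site d N → ℂ) :
    siteDiag v - siteDiag w = siteDiag fun x => v x - w x := by
  rw [siteDiag, siteDiag, siteDiag, Matrix.diagonal_sub]

theorem siteDiag_one : siteDiag (fun _ => 1 : Site d N → ℂ) = 1 := Matrix.diagonal_one

open scoped Matrix.Norms.L2Operator in
theorem norm_siteDiag_le {v : Site d N → ℂ} {c : ℝ} (hc : 0 ≤ c) (hv : ∀ x, ‖v x‖ ≤ c) :
    ‖siteDiag v‖ ≤ c := by
  rw [siteDiag, Matrix.l2_opNorm_diagonal]
  exact (pi_norm_le_iff_of_nonneg hc).mpr fun p => hv p.1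

end Spinor

/-! ### The Wilson lattice gradient as a family -/

section LatticeFamilies

open scoped Matrix.Norms.L2Operator

variable {d : ℕ} {L Q : ℝ} {A : Fin d → (Fin d → ℝ) → ℝ}

/-- Index type of spinor fields on the lattice with `n + 1` sites per direction. -/
abbrev SpinorIndex (d n : ℕ) : Type := Site d (n + 1) × Spin d

/-- The lattice spacings `L / (n + 1)`. -/
noncomputable def spacingSeq (L : ℝ) (n : ℕ) : ℝ := spacing L (n + 1)

theorem spacingSeq_pos (hL : 0 < L) (n : ℕ) : 0 < spacingSeq L n := by
  rw [spacingSeq, spacing]; positivity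

theorem spacingSeq_le (hL : 0 < L) (n : ℕ) : spacingSeq L n ≤ L := by
  rw [spacingSeq, spacing]
  refine div_le_self hL.le ?_
  push_cast
  linarith [Nat.cast_nonneg (α := ℝ) n]

/-- The covariant translations as families. -/
noncomputable def translationFam (L Q : ℝ) (A : Fin d → (Fin d → ℝ) → ℝ) (μ : Fin d) :
    OpFam (SpinorIndex d) := fun n => translation L Q A (n + 1) μ

/-- The covariant forward differences as families. -/
noncomputable def gradFam (L Q : ℝ) (A : Fin d → (Fin d → ℝ) → ℝ) (μ : Fin d) :
    OpFam (SpinorIndex d) := scale (spacingSeq L)⁻¹ (translationFam L Q A μ - 1)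

/-- Multiplication by functions on the sites, as families. -/
def siteFam (v : ∀ n, Site d (n + 1) → ℂ) : OpFam (SpinorIndex d) := fun n => siteDiag (v n)

theorem unifBdd_scale_siteFam {b : ℕ → ℝ} {v : ∀ n, Site d (n + 1) → ℂ} {K : ℝ} (hK : 0 ≤ K)
    (h : ∀ n x, |b n| * ‖v n x‖ ≤ K) : UnifBdd (scale b (siteFam v)) := by
  refine ⟨K, fun n => ?_⟩
  have : scale b (siteFam v) n = siteDiag fun x => (b n : ℂ) * v n x := by
    rw [scale, siteFam, siteDiag, siteDiag, ← Matrix.diagonal_smul]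
    rfl
  rw [this]
  refine norm_siteDiag_le hK fun x => ?_
  rw [norm_mul, Complex.norm_real, Real.norm_eq_abs]
  exact h n x

theorem unifBdd_siteFam {v : ∀ n, Site d (n + 1) → ℂ} {K : ℝ} (hK : 0 ≤ K)
    (h : ∀ n x, ‖v n x‖ ≤ K) : UnifBdd (siteFam v) :=
  ⟨K, fun n => norm_siteDiag_le hK (h n)⟩

theorem star_mul_translationFam (μ : Fin d) :
    star (translationFam L Q A μ) * translationFam L Q A μ = 1 := by
  funext n
  exact conjTranspose_mul_translation μ

theorem translationFam_mul_star (μ : Fin d) :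
    translationFam L Q A μ * star (translationFam L Q A μ) = 1 := by
  funext n
  exact translation_mul_conjTranspose μ

theorem translationFam_mul_siteFam (μ : Fin d) (v : ∀ n, Site d (n + 1) → ℂ) :
    translationFam L Q A μ * siteFam v
      = siteFam (fun n x => v n (next μ x)) * translationFam L Q A μ := by
  funext n
  exact translation_mul_siteDiag μ (v n)

theorem siteFam_sub (v w : ∀ n, Site d (n + 1) → ℂ) :
    siteFam v - siteFam w = siteFam fun n x => v n x - w n x := by
  funext n
  exact siteDiag_sub (v n) (w n)

/-- Commutators of translations are `Ω = holonomy - 1` times unitaries. Thus `Ω = O(a²)` bounds the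
single commutators after division by `a²`, and `O(a³)` variation of the holonomy bounds the double
ones after division by `a³`. -/
theorem isLatticeGradient_gradFam (hL : 0 < L) (hA : ∀ μ, ContDiff ℝ ∞ (A μ))
    (hper : ∀ μ ν x, A μ (x + Pi.single ν L) = A μ x) :
    IsLatticeGradient (spacingSeq L) (gradFam L Q A) := by
  have hT : ∀ μ, UnifBdd (translationFam L Q A μ) := fun μ =>
    unifBdd_of_star_mul_self (star_mul_translationFam μ)
  set a := spacingSeq L with ha
  have ha0 : ∀ n, 0 < a n := spacingSeq_pos hL
  set Ω : Fin d → Fin d → OpFam (SpinorIndex d) := fun μ ν =>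
    siteFam fun n x => holonomy L Q A (n + 1) μ ν x - 1 with hΩ
  have hZ : ∀ μ ν, translationFam L Q A μ * translationFam L Q A ν
      - translationFam L Q A ν * translationFam L Q A μ
      = Ω μ ν * (translationFam L Q A ν * translationFam L Q A μ) := by
    intro μ ν
    have h1 : translationFam L Q A μ * translationFam L Q A ν
        = siteFam (fun n => holonomy L Q A (n + 1) μ ν)
          * (translationFam L Q A ν * translationFam L Q A μ) := by
      funext n
      exact translation_mul_translation hL hper n μ ν
    have h2 : siteFam (fun n (_ : Site d (n + 1)) => (1 : ℂ)) = 1 := by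
      funext n
      exact siteDiag_one
    rw [h1, hΩ]
    simp only
    rw [← siteFam_sub, sub_mul, h2, one_mul]
  have hΩb : ∀ μ ν, UnifBdd (scale (a⁻¹ * a⁻¹) (Ω μ ν)) := by
    intro μ ν
    obtain ⟨K, hK0, hK⟩ := exists_abs_flux_le hL hA hper μ ν
    refine unifBdd_scale_siteFam (K := |Q| * K) (by positivity) fun n x => ?_
    have h1 : ‖holonomy L Q A (n + 1) μ ν x - 1‖ ≤ |Q| * (K * a n ^ 2) := by
      have := norm_exp_I_mul_sub_exp_I_mul_le
        (-Q * flux A (spacing L (n + 1)) μ ν (point L (n + 1) x)) 0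
      rw [Complex.ofReal_zero, mul_zero, Complex.exp_zero, sub_zero, abs_mul, abs_neg] at this
      exact this.trans (mul_le_mul_of_nonneg_left (hK _ (ha0 n).le _) (abs_nonneg Q))
    have h2 : |(a⁻¹ * a⁻¹) n| = (a n ^ 2)⁻¹ := by
      rw [Pi.mul_apply, Pi.inv_apply, abs_of_pos (by have := ha0 n; positivity), sq, mul_inv]
    rw [h2, inv_mul_le_iff₀ (by have := ha0 n; positivity)]
    linarith
  have hΩb2 : ∀ μ ν ρ, UnifBdd (scale (a⁻¹ * a⁻¹ * a⁻¹)
      (siteFam fun n x => holonomy L Q A (n + 1) μ ν (next ρ x)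
        - holonomy L Q A (n + 1) μ ν x)) := by
    intro μ ν ρ
    obtain ⟨K, hK0, hK⟩ := exists_abs_flux_sub_le hL hA hper μ ν ρ
    refine unifBdd_scale_siteFam (K := |Q| * K) (by positivity) fun n x => ?_
    have h1 : ‖holonomy L Q A (n + 1) μ ν (next ρ x) - holonomy L Q A (n + 1) μ ν x‖
        ≤ |Q| * (K * a n ^ 3) := by
      have := norm_exp_I_mul_sub_exp_I_mul_le
        (-Q * flux A (spacing L (n + 1)) μ ν (point L (n + 1) (next ρ x)))
        (-Q * flux A (spacing L (n + 1)) μ ν (point L (n + 1) x))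
      refine this.trans ?_
      rw [← mul_sub, abs_mul, abs_neg,
        apply_point_next hL.ne' (fun κ y => flux_add_period hper _ μ ν κ y)]
      exact mul_le_mul_of_nonneg_left (hK _ (ha0 n).le _) (abs_nonneg Q)
    have h2 : |(a⁻¹ * a⁻¹ * a⁻¹) n| = (a n ^ 3)⁻¹ := by
      rw [Pi.mul_apply, Pi.mul_apply, Pi.inv_apply, abs_of_pos (by have := ha0 n; positivity)]
      rw [pow_succ, sq, mul_inv, mul_inv]
    rw [h2, inv_mul_le_iff₀ (by have := ha0 n; positivity)]
    linarith
  refine isLatticeGradient_of_unitary ha0 ⟨L, spacingSeq_le hL⟩ star_mul_translationFam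
    translationFam_mul_star (fun μ ν => ?_) (fun μ ν ρ => ?_)
  · rw [hZ, ← scale_mul]
    exact (hΩb μ ν).mul ((hT ν).mul (hT μ))
  · rw [hZ μ ν]
    have h1 : translationFam L Q A ρ * Ω μ ν
        = Ω μ ν * translationFam L Q A ρ
          + (siteFam fun n x => holonomy L Q A (n + 1) μ ν (next ρ x)
            - holonomy L Q A (n + 1) μ ν x) * translationFam L Q A ρ := by
      simp only [hΩ]
      rw [translationFam_mul_siteFam, ← add_mul]
      congr 1
      funext n
      simp only [siteFam, Pi.add_apply, siteDiag, Matrix.diagonal_add]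
      congr 1
      funext p
      ring
    -- Either `T_ρ` passes the translations, producing a second `Ω` and hence `O(a⁴)`, or it passes
    -- the multiplication operator, producing the `O(a³)` variation of the holonomy.
    have h2 : Ω μ ν * (translationFam L Q A ν * translationFam L Q A μ) * translationFam L Q A ρ
        - translationFam L Q A ρ * (Ω μ ν * (translationFam L Q A ν * translationFam L Q A μ))
        = Ω μ ν * (translationFam L Q A ν * (Ω μ ρ * (translationFam L Q A ρ
              * translationFam L Q A μ))
            + Ω ν ρ * (translationFam L Q A ρ * translationFam L Q A ν)
              * translationFam L Q A μ)
          - (siteFam fun n x => holonomy L Q A (n + 1) μ ν (next ρ x)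
            - holonomy L Q A (n + 1) μ ν x)
            * (translationFam L Q A ρ * translationFam L Q A ν * translationFam L Q A μ) := by
      rw [← mul_assoc (translationFam L Q A ρ) (Ω μ ν), h1, ← hZ μ ρ, ← hZ ν ρ]
      noncomm_ring
    have h3 : a⁻¹ * a⁻¹ * a⁻¹ = a * (a⁻¹ * a⁻¹) * (a⁻¹ * a⁻¹) := by
      funext n
      have := (ha0 n).ne'
      simp only [Pi.mul_apply, Pi.inv_apply]
      field_simp
    rw [h2, scale_sub]
    refine UnifBdd.sub ?_ ?_
    · have h4 : scale (a⁻¹ * a⁻¹ * a⁻¹) (Ω μ ν * (translationFam L Q A ν * (Ω μ ρ *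
            (translationFam L Q A ρ * translationFam L Q A μ))
            + Ω ν ρ * (translationFam L Q A ρ * translationFam L Q A ν)
              * translationFam L Q A μ))
          = scale a (scale (a⁻¹ * a⁻¹) (Ω μ ν) * (translationFam L Q A ν *
            (scale (a⁻¹ * a⁻¹) (Ω μ ρ) * (translationFam L Q A ρ * translationFam L Q A μ))
            + scale (a⁻¹ * a⁻¹) (Ω ν ρ) * (translationFam L Q A ρ * translationFam L Q A ν)
              * translationFam L Q A μ)) := by
        simp only [scale_mul, mul_scale, ← scale_add]
        rw [scale_scale, scale_scale, h3]
      rw [h4]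
      exact UnifBdd.scale ((hΩb μ ν).mul (((hT ν).mul ((hΩb μ ρ).mul ((hT ρ).mul (hT μ)))).add
        (((hΩb ν ρ).mul ((hT ρ).mul (hT ν))).mul (hT μ)))) ha0 ⟨L, spacingSeq_le hL⟩
    · rw [← scale_mul]
      exact (hΩb2 μ ν ρ).mul (((hT ρ).mul (hT ν)).mul (hT μ))

/-- Multiplication by a function on the continuum, restricted to the lattices. -/
noncomputable def mulFam (L : ℝ) (ξ : (Fin d → ℝ) → ℝ) : OpFam (SpinorIndex d) :=
  siteFam fun n x => (ξ (point L (n + 1) x) : ℂ)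

theorem star_mulFam (ξ : (Fin d → ℝ) → ℝ) : star (mulFam L ξ) = mulFam L ξ := by
  funext n
  rw [Pi.star_apply, mulFam, siteFam, siteDiag, Matrix.star_eq_conjTranspose,
    Matrix.diagonal_conjTranspose]
  congr 1
  funext p
  simp

theorem unifBdd_mulFam (hL : 0 < L) {ξ : (Fin d → ℝ) → ℝ} (hξ : ContDiff ℝ ∞ ξ)
    (hper : ∀ ν x, ξ (x + Pi.single ν L) = ξ x) : UnifBdd (mulFam L ξ) := by
  obtain ⟨K, hK0, hK⟩ := exists_bound_of_periodic hL hξ.continuous hper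
  exact unifBdd_siteFam hK0 fun n x => by rw [Complex.norm_real]; exact hK _

theorem unifBdd_gradFam_mulFam_comm (hL : 0 < L) {ξ : (Fin d → ℝ) → ℝ} (hξ : ContDiff ℝ ∞ ξ)
    (hper : ∀ ν x, ξ (x + Pi.single ν L) = ξ x) (μ : Fin d) :
    UnifBdd (gradFam L Q A μ * mulFam L ξ - mulFam L ξ * gradFam L Q A μ) := by
  obtain ⟨K, hK0, hK⟩ := exists_lipschitz_of_periodic hL hξ hper
  have e : gradFam L Q A μ * mulFam L ξ - mulFam L ξ * gradFam L Q A μ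
      = scale (spacingSeq L)⁻¹ (siteFam fun n x => (ξ (point L (n + 1) (next μ x)) : ℂ)
          - (ξ (point L (n + 1) x) : ℂ)) * translationFam L Q A μ := by
    have h := translationFam_mul_siteFam (L := L) (Q := Q) (A := A) μ
      fun n x => (ξ (point L (n + 1) x) : ℂ)
    rw [gradFam, mulFam, scale_mul, mul_scale, ← scale_sub, scale_mul]
    congr 1
    rw [← siteFam_sub, sub_mul (siteFam _), ← h]
    noncomm_ring
  rw [e]
  refine UnifBdd.mul (unifBdd_scale_siteFam hK0 fun n x => ?_)
    (unifBdd_of_star_mul_self (star_mul_translationFam μ))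
  have ha := spacingSeq_pos hL n
  rw [Pi.inv_apply, abs_of_pos (by positivity), inv_mul_le_iff₀ ha, ← Complex.ofReal_sub,
    Complex.norm_real, apply_point_next hL.ne' hper]
  have := hK (point L (n + 1) x) (point L (n + 1) x + Pi.single μ (spacing L (n + 1)))
  rw [add_sub_cancel_left, Pi.norm_single] at this
  change _ ≤ spacing L (n + 1) * K
  rw [mul_comm]
  rwa [Real.norm_of_nonneg (r := spacing L (n + 1)) ha.le] at this

end LatticeFamilies

/-! ### Norm criteria: the Schur test and projections -/

section Schur

open scoped Matrix.Norms.L2Operator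

variable {m : Type*} [Fintype m] [DecidableEq m]

/-- Schur's test. -/
theorem norm_le_of_sum_norm_le {X : Matrix m m ℂ} {c : ℝ} (hc : 0 ≤ c)
    (hrow : ∀ x, ∑ y, ‖X x y‖ ≤ c) (hcol : ∀ y, ∑ x, ‖X x y‖ ≤ c) : ‖X‖ ≤ c := by
  refine norm_le_of_act hc fun u => ?_
  refine (sq_le_sq₀ (norm_nonneg _) (by positivity)).mp ?_
  rw [mul_pow, EuclideanSpace.norm_sq_eq, EuclideanSpace.norm_sq_eq]
  have h1 : ∀ x, ‖act X u x‖ ^ 2 ≤ c * ∑ y, ‖X x y‖ * ‖u y‖ ^ 2 := by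
    intro x
    have e : act X u x = ∑ y, X x y * u y := by
      rw [act, Matrix.ofLp_toEuclideanCLM]; rfl
    have h2 : ‖act X u x‖ ≤ ∑ y, ‖X x y‖ * ‖u y‖ := by
      rw [e]
      refine (norm_sum_le _ _).trans (le_of_eq ?_)
      simp only [norm_mul]
    have h3 : (∑ y, ‖X x y‖ * ‖u y‖) ^ 2 ≤ (∑ y, ‖X x y‖) * ∑ y, ‖X x y‖ * ‖u y‖ ^ 2 :=
      Finset.sum_sq_le_sum_mul_sum_of_sq_le_mul _ (fun _ _ => norm_nonneg _)
        (fun _ _ => by positivity) (fun _ _ => le_of_eq (by ring))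
    refine (pow_le_pow_left₀ (norm_nonneg _) h2 2).trans (h3.trans ?_)
    exact mul_le_mul_of_nonneg_right (hrow x) (Finset.sum_nonneg fun _ _ => by positivity)
  refine (Finset.sum_le_sum fun x _ => h1 x).trans ?_
  rw [← Finset.mul_sum, Finset.sum_comm, sq, mul_assoc]
  refine mul_le_mul_of_nonneg_left ?_ hc
  rw [Finset.mul_sum]
  refine Finset.sum_le_sum fun y _ => ?_
  rw [← Finset.sum_mul]
  exact mul_le_mul_of_nonneg_right (hcol y) (sq_nonneg _)

theorem norm_le_one_of_isProj {X : Matrix m m ℂ} (h1 : Xᴴ = X) (h2 : X * X = X) : ‖X‖ ≤ 1 := by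
  have h : ‖X‖ * ‖X‖ = ‖X‖ := by
    rw [← CStarRing.norm_star_mul_self, Matrix.star_eq_conjTranspose, h1, h2]
  nlinarith [norm_nonneg X]

end Schur

/-! ### One-dimensional block averages and their Poincaré identity -/

section Block

variable {N l : ℕ}

/-- The number of sites in the block of length `l` containing `i`. -/
def blockCard (l : ℕ) (i : Fin N) : ℕ :=
  (Finset.univ.filter fun k : Fin N => (k : ℕ) / l = i / l).card

/-- Averaging over blocks of length `l`. -/
noncomputable def blockAvg (N l : ℕ) : Matrix (Fin N) (Fin N) ℂ :=
  Matrix.of fun i k => if (k : ℕ) / l = i / l then ((blockCard l i : ℂ))⁻¹ else 0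

/-- Partial sums inside blocks of length `l`. -/
def blockSum (N l : ℕ) : Matrix (Fin N) (Fin N) ℂ :=
  Matrix.of fun i k => if (k : ℕ) / l = i / l ∧ k < i then 1 else 0

/-- Indicator function of the sites whose right neighbour lies in the same block. -/
def blockInner (l : ℕ) (i : Fin N) : ℂ :=
  if (i : ℕ) + 1 < N ∧ ((i : ℕ) + 1) / l = i / l then 1 else 0

/-- Differences inside blocks of length `l`. -/
def blockDiff (N l : ℕ) : Matrix (Fin N) (Fin N) ℂ :=
  Matrix.of fun i k => blockInner l i *
    ((if k = finRotate N i then 1 else 0) - (if k = i then 1 else 0))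

/-- The first site in the block containing `i`. -/
def blockStart (l : ℕ) (i : Fin N) : Fin N :=
  ⟨l * (i / l), (Nat.mul_div_le _ _).trans_lt i.2⟩

/-- Sampling at the first site of each block. -/
def blockSample (N l : ℕ) : Matrix (Fin N) (Fin N) ℂ :=
  Matrix.of fun i k => if k = blockStart l i then 1 else 0

theorem blockCard_congr {i k : Fin N} (h : (k : ℕ) / l = i / l) :
    blockCard l k = blockCard l i := by
  rw [blockCard, blockCard, h]

theorem blockCard_ne_zero (i : Fin N) : (blockCard l i : ℂ) ≠ 0 := by
  rw [Nat.cast_ne_zero, blockCard]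
  exact (Finset.card_pos.mpr ⟨i, by simp⟩).ne'

theorem blockCard_le (hl : 0 < l) (i : Fin N) : blockCard l i ≤ l := by
  rw [blockCard]
  calc _ ≤ (Finset.range l).card := by
        refine Finset.card_le_card_of_injOn (fun k => (k : ℕ) % l) (fun k _ => ?_) ?_
        · simpa using Nat.mod_lt _ hl
        · intro k hk k' hk' h
          simp only [Finset.coe_filter, Finset.mem_univ, true_and, Set.mem_ofPred_eq] at hk hk'
          simp only at h
          rw [Fin.ext_iff, ← Nat.div_add_mod (k : ℕ) l, ← Nat.div_add_mod (k' : ℕ) l, hk, hk', h]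
    _ = l := Finset.card_range l

theorem conjTranspose_blockAvg : (blockAvg N l)ᴴ = blockAvg N l := by
  ext i k
  simp only [Matrix.conjTranspose_apply, blockAvg, Matrix.of_apply]
  by_cases h : (k : ℕ) / l = i / l
  · rw [if_pos h, if_pos h.symm, blockCard_congr h]; simp
  · rw [if_neg h, if_neg fun h' => h h'.symm]; simp

theorem sum_blockAvg_mul {f : Fin N → ℂ} {i : Fin N}
    (hf : ∀ k : Fin N, (k : ℕ) / l = i / l → f k = f i) :
    ∑ k, blockAvg N l i k * f k = f i := by
  have h : ∀ k, blockAvg N l i k * f k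
      = if (k : ℕ) / l = i / l then ((blockCard l i : ℂ))⁻¹ * f i else 0 := by
    intro k
    simp only [blockAvg, Matrix.of_apply]
    split_ifs with h
    · rw [hf k h]
    · rw [zero_mul]
  simp only [h]
  rw [← Finset.sum_filter, Finset.sum_const, nsmul_eq_mul, ← mul_assoc]
  change (blockCard l i : ℂ) * _ * _ = _
  rw [mul_inv_cancel₀ (blockCard_ne_zero i), one_mul]

theorem blockAvg_mul_blockAvg : blockAvg N l * blockAvg N l = blockAvg N l := by
  ext i k
  rw [Matrix.mul_apply]
  refine sum_blockAvg_mul (f := fun m => blockAvg N l m k) fun m hm => ?_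
  simp only [blockAvg, Matrix.of_apply]
  rw [hm, blockCard_congr hm]

theorem blockAvg_mul_blockSample : blockAvg N l * blockSample N l = blockSample N l := by
  ext i k
  rw [Matrix.mul_apply]
  refine sum_blockAvg_mul (f := fun m => blockSample N l m k) fun m hm => ?_
  have : blockStart l m = blockStart l i := Fin.ext (by simp only [blockStart, hm])
  simp only [blockSample, Matrix.of_apply, this]

/-- Telescoping from the first site of the block up to `i`. Every link used stays inside the block,
so the factor `blockInner` equals one and the link that wraps around never occurs. -/
theorem sum_blockSum_mul_diff (n : ℕ) (hl : 0 < l) (f : Fin (n + 1) → ℂ) (i : Fin (n + 1)) :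
    ∑ m, blockSum (n + 1) l i m * (blockInner l m * (f (finRotate (n + 1) m) - f m))
      = f i - f (blockStart l i) := by
  set g : ℕ → ℂ := fun m => if h : m < n + 1 then f ⟨m, h⟩ else 0 with hg
  have h1 : ∀ m : Fin (n + 1),
      blockSum (n + 1) l i m * (blockInner l m * (f (finRotate (n + 1) m) - f m))
      = if l * (i / l) ≤ (m : ℕ) ∧ (m : ℕ) < i then g (m + 1) - g m else 0 := by
    intro m
    have hiff : ((m : ℕ) / l = i / l ∧ m < i) ↔ (l * (i / l) ≤ (m : ℕ) ∧ (m : ℕ) < i) := by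
      rw [Fin.lt_def]
      constructor
      · rintro ⟨h2, h3⟩
        exact ⟨h2 ▸ Nat.mul_div_le _ _, h3⟩
      · rintro ⟨h2, h3⟩
        refine ⟨le_antisymm (Nat.div_le_div_right h3.le) ?_, h3⟩
        rwa [Nat.le_div_iff_mul_le hl, mul_comm]
    simp only [blockSum, Matrix.of_apply]
    by_cases h : l * (i / l) ≤ (m : ℕ) ∧ (m : ℕ) < i
    · have h' := hiff.mpr h
      rw [if_pos h', if_pos h, one_mul]
      have h2 : (m : ℕ) + 1 < n + 1 := lt_of_le_of_lt h.2 i.2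
      have h3 : ((m : ℕ) + 1) / l = m / l :=
        le_antisymm (h'.1 ▸ Nat.div_le_div_right h.2) (Nat.div_le_div_right (Nat.le_succ _))
      rw [blockInner, if_pos ⟨h2, h3⟩, one_mul, hg]
      simp only [dif_pos h2, dif_pos m.2]
      congr 2
      rw [Fin.ext_iff, finRotate_apply, Fin.val_add_one_of_lt]
      rw [Fin.lt_def, Fin.val_last]
      omega
    · rw [if_neg (fun h' => h (hiff.mp h')), if_neg h, zero_mul]
  simp only [h1]
  rw [Fin.sum_univ_eq_sum_range
    (fun m => if l * ((i : ℕ) / l) ≤ m ∧ m < i then g (m + 1) - g m else 0) (n + 1),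
    ← Finset.sum_filter]
  have h2 : (Finset.range (n + 1)).filter (fun m => l * ((i : ℕ) / l) ≤ m ∧ m < i)
      = Finset.Ico (l * ((i : ℕ) / l)) i := by
    ext m
    simp only [Finset.mem_filter, Finset.mem_range, Finset.mem_Ico]
    have := i.2
    constructor
    · exact fun h => h.2
    · exact fun h => ⟨by omega, h⟩
  rw [h2, Finset.sum_Ico_sub g (Nat.mul_div_le _ _), hg]
  simp only [dif_pos i.2]
  rw [dif_pos ((Nat.mul_div_le _ _).trans_lt i.2)]
  rfl

theorem one_sub_blockSample (n : ℕ) (hl : 0 < l) :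
    1 - blockSample (n + 1) l = blockSum (n + 1) l * blockDiff (n + 1) l := by
  ext i k
  rw [Matrix.mul_apply]
  have := sum_blockSum_mul_diff n hl (fun m => if k = m then (1 : ℂ) else 0) i
  simp only [blockDiff, Matrix.of_apply]
  rw [this, Matrix.sub_apply, Matrix.one_apply, blockSample, Matrix.of_apply]
  simp only [eq_comm]

/-- Sampled functions are constant on blocks, so `1 - blockAvg` kills them; multiplying the
telescoping identity by it from the left replaces sampling by averaging, an orthogonal projection.
-/
theorem one_sub_blockAvg (n : ℕ) (hl : 0 < l) : 1 - blockAvg (n + 1) l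
    = (1 - blockAvg (n + 1) l) * blockSum (n + 1) l * blockDiff (n + 1) l := by
  rw [mul_assoc, ← one_sub_blockSample n hl, mul_sub, sub_mul _ _ (blockSample _ _),
    blockAvg_mul_blockSample, one_mul, sub_self, mul_one, sub_zero]

-- Schur's test: each row and column has at most `l - 1` entries equal to one, the strict inequality
-- excluding the site itself. The bound `l - 1` rather than `l` makes blocks of length one exact.
open scoped Matrix.Norms.L2Operator in
theorem norm_blockSum_le (hl : 0 < l) : ‖blockSum N l‖ ≤ (l - 1 : ℕ) := by
  have key : ∀ (i : Fin N) (p : Fin N → Prop) [DecidablePred p], ¬ p i →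
      ((Finset.univ.filter fun k : Fin N => (k : ℕ) / l = i / l ∧ p k).card) ≤ l - 1 := by
    intro i p _ hi
    have h1 : (Finset.univ.filter fun k : Fin N => (k : ℕ) / l = i / l ∧ p k)
        ⊆ (Finset.univ.filter fun k : Fin N => (k : ℕ) / l = i / l).erase i := by
      intro k hk
      simp only [Finset.mem_filter, Finset.mem_univ, true_and] at hk
      simp only [Finset.mem_erase, Finset.mem_filter, Finset.mem_univ, true_and]
      exact ⟨fun h => hi (h ▸ hk.2), hk.1⟩
    refine (Finset.card_le_card h1).trans ?_
    rw [Finset.card_erase_of_mem (by simp)]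
    exact Nat.sub_le_sub_right (blockCard_le hl i) 1
  have hn : ∀ i k, ‖blockSum N l i k‖ = if (k : ℕ) / l = i / l ∧ k < i then 1 else 0 := by
    intro i k
    simp only [blockSum, Matrix.of_apply]
    split_ifs <;> simp
  refine norm_le_of_sum_norm_le (Nat.cast_nonneg _) (fun i => ?_) (fun k => ?_)
  · simp only [hn]
    rw [Finset.sum_boole]
    exact_mod_cast key i (fun k => k < i) (lt_irrefl i)
  · simp only [hn]
    rw [Finset.sum_boole]
    have := key k (fun i => k < i) (lt_irrefl k)
    simp only [eq_comm (a := (k : ℕ) / l)]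
    exact_mod_cast this

open scoped Matrix.Norms.L2Operator in
theorem norm_one_sub_blockAvg_mul_blockSum_le (hl : 0 < l) :
    ‖(1 - blockAvg N l) * blockSum N l‖ ≤ (l - 1 : ℕ) := by
  have h1 : ‖1 - blockAvg N l‖ ≤ 1 := by
    refine norm_le_one_of_isProj ?_ ?_
    · rw [Matrix.conjTranspose_sub, Matrix.conjTranspose_one, conjTranspose_blockAvg]
    · rw [mul_sub, sub_mul, sub_mul, blockAvg_mul_blockAvg]; simp
  refine (norm_mul_le _ _).trans ?_
  calc _ ≤ 1 * ((l - 1 : ℕ) : ℝ) :=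
        mul_le_mul h1 (norm_blockSum_le hl) (norm_nonneg _) zero_le_one
    _ = _ := one_mul _

/-- Membership of the sites in the blocks. -/
def blockIndicator (N l b : ℕ) : Matrix (Fin N) (Fin b) ℂ :=
  Matrix.of fun i k => if (k : ℕ) = i / l then 1 else 0

/-- Averages over the blocks, as a function of the block. -/
noncomputable def blockMean (N l b : ℕ) : Matrix (Fin b) (Fin N) ℂ :=
  Matrix.of fun i k => if (i : ℕ) = k / l then ((blockCard l k : ℂ))⁻¹ else 0

/-- Factorisation through functions on `b` blocks; this is what bounds the rank. -/
theorem blockAvg_eq_mul {b : ℕ} (h : N ≤ l * b) :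
    blockAvg N l = blockIndicator N l b * blockMean N l b := by
  ext i k
  have hi : (i : ℕ) / l < b := Nat.div_lt_of_lt_mul (i.2.trans_le h)
  have h1 : ∀ c : Fin b, (c : ℕ) = i / l ↔ c = ⟨i / l, hi⟩ := fun c => by
    rw [Fin.ext_iff]
  simp only [Matrix.mul_apply, blockIndicator, blockMean, blockAvg, Matrix.of_apply, h1, ite_mul,
    one_mul, zero_mul, Finset.sum_ite_eq', Finset.mem_univ, if_true]
  by_cases hk : (k : ℕ) / l = i / l
  · rw [if_pos hk, if_pos hk.symm, blockCard_congr hk]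
  · rw [if_neg hk, if_neg fun h' => hk h'.symm]

end Block

/-! ### Tensor products of matrices and amplification -/

section Tensor

set_option linter.unusedSectionVars false

variable {d : ℕ} {p q s : Type*} [Fintype p] [Fintype q] [Fintype s] [DecidableEq p]
  [DecidableEq q]

/-- The tensor product of a finite sequence of matrices. -/
def tensorMatrix (X : Fin d → Matrix p q ℂ) : Matrix (Fin d → p) (Fin d → q) ℂ :=
  Matrix.of fun x y => ∏ μ, X μ (x μ) (y μ)

theorem tensorMatrix_mul (X : Fin d → Matrix p q ℂ) (Y : Fin d → Matrix q s ℂ) :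
    tensorMatrix X * tensorMatrix Y = tensorMatrix fun μ => X μ * Y μ := by
  ext x z
  simp only [Matrix.mul_apply, tensorMatrix, Matrix.of_apply, ← Finset.prod_mul_distrib]
  rw [Finset.prod_univ_sum, Fintype.piFinset_univ]

theorem conjTranspose_tensorMatrix (X : Fin d → Matrix p q ℂ) :
    (tensorMatrix X)ᴴ = tensorMatrix fun μ => (X μ)ᴴ := by
  ext x z
  simp [tensorMatrix, Matrix.conjTranspose_apply]

theorem tensorMatrix_one : tensorMatrix (fun _ : Fin d => (1 : Matrix p p ℂ)) = 1 := by
  ext x y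
  simp only [tensorMatrix, Matrix.of_apply, Matrix.one_apply]
  split_ifs with h
  · subst h; simp
  · obtain ⟨μ, hμ⟩ := Function.ne_iff.mp h
    exact Finset.prod_eq_zero (Finset.mem_univ μ) (if_neg hμ)

/-- A matrix acting in the direction `μ` only. -/
def along (μ : Fin d) (X : Matrix p p ℂ) : Matrix (Fin d → p) (Fin d → p) ℂ :=
  tensorMatrix (Function.update (fun _ => 1) μ X)

theorem along_apply (μ : Fin d) (X : Matrix p p ℂ) (x y : Fin d → p) :
    along μ X x y = X (x μ) (y μ) * ∏ ν ∈ Finset.univ.erase μ, (1 : Matrix p p ℂ) (x ν) (y ν) := by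
  rw [along, tensorMatrix, Matrix.of_apply, ← Finset.mul_prod_erase _ _ (Finset.mem_univ μ),
    Function.update_self]
  congr 1
  refine Finset.prod_congr rfl fun ν hν => ?_
  rw [Function.update_of_ne (Finset.ne_of_mem_erase hν)]

theorem along_mul (μ : Fin d) (X Y : Matrix p p ℂ) : along μ (X * Y) = along μ X * along μ Y := by
  rw [along, along, along, tensorMatrix_mul]
  congr 1
  funext ν
  by_cases h : ν = μ
  · subst h; simp
  · simp [Function.update_of_ne h]

theorem along_one (μ : Fin d) : along μ (1 : Matrix p p ℂ) = 1 := by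
  rw [along, Function.update_eq_self_iff.mpr rfl, tensorMatrix_one]

/-- The action in the direction `μ` as a homomorphism of star algebras. -/
def alongHom (μ : Fin d) : Matrix p p ℂ →⋆ₐ[ℂ] Matrix (Fin d → p) (Fin d → p) ℂ where
  toFun := along μ
  map_one' := along_one μ
  map_mul' := along_mul μ
  map_zero' := by ext x y; simp [along_apply]
  map_add' X Y := by ext x y; simp [along_apply, add_mul]
  commutes' c := by
    rw [Algebra.algebraMap_eq_smul_one, Algebra.algebraMap_eq_smul_one]
    have h : along μ (c • (1 : Matrix p p ℂ)) = c • along μ (1 : Matrix p p ℂ) := by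
      ext x y; simp [along_apply, mul_assoc]
    rw [h, along_one]
  map_star' X := by
    rw [Matrix.star_eq_conjTranspose, Matrix.star_eq_conjTranspose, along, along,
      conjTranspose_tensorMatrix]
    congr 1
    funext ν
    by_cases h : ν = μ
    · subst h; simp
    · simp [Function.update_of_ne h]

/-- Amplification to spinors as a homomorphism of star algebras. -/
def amplify (s : Type*) [Fintype s] [DecidableEq s] : Matrix p p ℂ →⋆ₐ[ℂ] Matrix (p × s) (p × s) ℂ where
  toFun X := X ⊗ₖ (1 : Matrix s s ℂ)
  map_one' := Matrix.one_kronecker_one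
  map_mul' X Y := by rw [← Matrix.mul_kronecker_mul, Matrix.mul_one]
  map_zero' := Matrix.zero_kronecker _
  map_add' X Y := Matrix.add_kronecker _ _ _
  commutes' c := by
    rw [Algebra.algebraMap_eq_smul_one, Algebra.algebraMap_eq_smul_one, Matrix.smul_kronecker,
      Matrix.one_kronecker_one]
  map_star' X := by
    rw [Matrix.star_eq_conjTranspose, Matrix.star_eq_conjTranspose,
      Matrix.conjTranspose_kronecker, Matrix.conjTranspose_one]

open scoped Matrix.Norms.L2Operator in
theorem norm_starAlgHom_le {m m' : Type*} [Fintype m] [DecidableEq m] [Fintype m']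
    [DecidableEq m'] (φ : Matrix m m ℂ →⋆ₐ[ℂ] Matrix m' m' ℂ) (X : Matrix m m ℂ) :
    ‖φ X‖ ≤ ‖X‖ :=
  NonUnitalStarAlgHom.norm_apply_le φ X

end Tensor

/-! ### Block averages in several directions -/

section BlockPoincare

open scoped Matrix.Norms.L2Operator

variable {d N l : ℕ}

/-- Averaging over blocks in the directions contained in `S`. -/
noncomputable def boxAvg (N l : ℕ) (S : Finset (Fin d)) : ScalarOp d N :=
  tensorMatrix fun μ => if μ ∈ S then blockAvg N l else 1

theorem norm_boxAvg_le (S : Finset (Fin d)) : ‖boxAvg N l S‖ ≤ 1 := by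
  refine norm_le_one_of_isProj ?_ ?_
  · rw [boxAvg, conjTranspose_tensorMatrix]
    congr 1
    funext μ
    split_ifs
    · exact conjTranspose_blockAvg
    · exact Matrix.conjTranspose_one
  · rw [boxAvg, tensorMatrix_mul]
    congr 1
    funext μ
    split_ifs
    · exact blockAvg_mul_blockAvg
    · exact mul_one 1

theorem boxAvg_insert {S : Finset (Fin d)} {μ : Fin d} (hμ : μ ∉ S) :
    boxAvg N l (insert μ S) = boxAvg N l S * along μ (blockAvg N l) := by
  rw [boxAvg, boxAvg, along, tensorMatrix_mul]
  congr 1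
  funext ν
  by_cases h : ν = μ
  · subst h; simp [hμ]
  · simp [h]

/-- Telescoping over directions: adding `μ` to `S` adds `E_S (1 - A_μ)`, where `E_S` is an
orthogonal projection and hence an admissible coefficient. -/
theorem one_sub_boxAvg (S : Finset (Fin d)) : ∃ X : Fin d → ScalarOp d N, (∀ μ, ‖X μ‖ ≤ 1) ∧
    1 - boxAvg N l S = ∑ μ ∈ S, X μ * along μ (1 - blockAvg N l) := by
  induction S using Finset.induction_on with
  | empty =>
    refine ⟨0, fun μ => by simp, ?_⟩
    have : boxAvg N l (∅ : Finset (Fin d)) = 1 := by simp [boxAvg, tensorMatrix_one]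
    rw [this, sub_self, Finset.sum_empty]
  | insert μ S hμ ih =>
    obtain ⟨X, hX, hS⟩ := ih
    refine ⟨Function.update X μ (boxAvg N l S), fun ν => ?_, ?_⟩
    · by_cases h : ν = μ
      · subst h; rw [Function.update_self]; exact norm_boxAvg_le S
      · rw [Function.update_of_ne h]; exact hX ν
    · rw [Finset.sum_insert hμ, Function.update_self, boxAvg_insert hμ]
      have h1 : along μ (1 - blockAvg N l) = 1 - along μ (blockAvg N l) := by
        have := map_sub (alongHom (p := Fin N) μ) 1 (blockAvg N l)
        rwa [map_one] at this
      have h2 : ∑ ν ∈ S, Function.update X μ (boxAvg N l S) ν * along ν (1 - blockAvg N l)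
          = 1 - boxAvg N l S := by
        rw [hS]
        refine Finset.sum_congr rfl fun ν hν => ?_
        rw [Function.update_of_ne (show ν ≠ μ from fun h => hμ (h ▸ hν))]
      rw [h2, h1]
      noncomm_ring

/-- The one-dimensional factorisations tensor to one through functions on the `b ^ d` boxes. -/
theorem rank_amplify_boxAvg_le {s : Type*} [Fintype s] [DecidableEq s] {b : ℕ}
    (h : N ≤ l * b) :
    (amplify s (boxAvg (d := d) N l Finset.univ)).rank ≤ b ^ d * Fintype.card s := by
  have e := tensorMatrix_mul (fun _ : Fin d => blockIndicator N l b) fun _ => blockMean N l b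
  have e1 : boxAvg (d := d) N l Finset.univ
      = tensorMatrix fun _ => blockIndicator N l b * blockMean N l b := by
    rw [boxAvg]
    congr 1
    funext μ
    rw [if_pos (Finset.mem_univ μ), blockAvg_eq_mul h]
  have e2 := Matrix.mul_kronecker_mul (tensorMatrix fun _ : Fin d => blockIndicator N l b)
    (tensorMatrix fun _ : Fin d => blockMean N l b) (1 : Matrix s s ℂ) (1 : Matrix s s ℂ)
  rw [e, ← e1, Matrix.mul_one] at e2
  change (boxAvg (d := d) N l Finset.univ ⊗ₖ (1 : Matrix s s ℂ)).rank ≤ _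
  rw [e2]
  refine (Matrix.rank_mul_le_left _ _).trans ((Matrix.rank_le_card_width _).trans (le_of_eq ?_))
  simp

/-- The anti-periodic sign sits on wrapping links only, and those are removed by `blockInner`;
inside blocks the plain difference is the free translation minus one. -/
theorem along_blockDiff (μ : Fin d) :
    along μ (blockDiff N l) = Matrix.diagonal (fun x : Site d N => blockInner l (x μ))
      * (freeTranslation N μ - 1) := by
  have hprod : ∀ (x y : Site d N), (∏ ν ∈ Finset.univ.erase μ, (1 : Matrix (Fin N) (Fin N) ℂ)
      (x ν) (y ν)) = if ∀ ν, ν ≠ μ → x ν = y ν then 1 else 0 := by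
    intro x y
    split_ifs with h
    · exact Finset.prod_eq_one fun ν hν => by
        rw [h ν (Finset.ne_of_mem_erase hν), Matrix.one_apply_eq]
    · push Not at h
      obtain ⟨ν, hν, hxy⟩ := h
      exact Finset.prod_eq_zero (Finset.mem_erase.mpr ⟨hν, Finset.mem_univ ν⟩)
        (Matrix.one_apply_ne hxy)
  ext x y
  rw [along_apply, hprod, Matrix.diagonal_mul, Matrix.sub_apply, blockDiff, Matrix.of_apply,
    mul_assoc]
  have h1 : (y = x) ↔ (y μ = x μ ∧ ∀ ν, ν ≠ μ → x ν = y ν) := by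
    constructor
    · rintro rfl; simp
    · rintro ⟨h1, h2⟩
      funext ν
      by_cases h : ν = μ
      · rw [h, h1]
      · exact (h2 ν h).symm
  have h2 : (y = next μ x) ↔ (y μ = finRotate N (x μ) ∧ ∀ ν, ν ≠ μ → x ν = y ν) := by
    constructor
    · rintro rfl
      refine ⟨by simp [next], fun ν hν => by simp [next, Function.update_of_ne hν]⟩
    · rintro ⟨h1, h2⟩
      funext ν
      by_cases h : ν = μ
      · subst h; rw [h1]; simp [next]
      · rw [next, Function.update_of_ne h, h2 ν h]
  by_cases hin : (x μ : ℕ) + 1 < N ∧ ((x μ : ℕ) + 1) / l = x μ / l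
  · have hsign : bcSign μ x = 1 := by rw [bcSign, if_neg hin.1.ne]
    rw [blockInner, if_pos hin, one_mul, one_mul, freeTranslation, Matrix.of_apply, hsign,
      Matrix.one_apply]
    simp only [h2, eq_comm (a := x) (b := y), h1]
    by_cases hc : ∀ ν, ν ≠ μ → x ν = y ν
    · simp only [and_iff_left hc]
      rw [if_pos hc, mul_one]
    · rw [if_neg hc, mul_zero, if_neg fun h => hc h.2, if_neg fun h => hc h.2, sub_zero]
  · rw [blockInner, if_neg hin, zero_mul, zero_mul]

end BlockPoincare

/-! ### The block Poincaré inequality for the covariant gradient -/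

section GradientPoincare

open scoped Matrix.Norms.L2Operator

variable {d : ℕ} {L Q : ℝ} {A : Fin d → (Fin d → ℝ) → ℝ}

theorem siteDiag_mul {N : ℕ} (v w : Site d N → ℂ) :
    siteDiag v * siteDiag w = siteDiag fun x => v x * w x := by
  rw [siteDiag, siteDiag, siteDiag, Matrix.diagonal_mul_diagonal]

/-- Since `T = U T₀` with `U` a phase, `T₀ - 1 = U*(T - 1) + (U* - 1)`. The last term is `O(a)` and
goes into the zeroth-order coefficient of the Poincaré inequality. -/
theorem amplify_along_blockDiff (N l : ℕ) (μ : Fin d) :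
    amplify (Spin d) (along μ (blockDiff N l))
      = siteDiag (fun x => blockInner l (x μ) * star (link L Q A N μ x))
          * (translation L Q A N μ - 1)
        + siteDiag fun x => blockInner l (x μ) * star (link L Q A N μ x) - blockInner l (x μ) := by
  have h1 : amplify (Spin d) (along μ (blockDiff N l))
      = siteDiag (fun x => blockInner l (x μ)) * (amplify (Spin d) (freeTranslation N μ) - 1) := by
    rw [along_blockDiff, map_mul, map_sub, map_one, siteDiag_eq_kronecker]
    rfl
  have h2 : translation L Q A N μ
      = siteDiag (link L Q A N μ) * amplify (Spin d) (freeTranslation N μ) := by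
    rw [siteDiag_eq_kronecker, translation]
    exact map_mul (amplify (Spin d)) (Matrix.diagonal (link L Q A N μ)) (freeTranslation N μ)
  have h3 : siteDiag (fun x => blockInner l (x μ) * star (link L Q A N μ x))
      * siteDiag (link L Q A N μ) = siteDiag (fun x => blockInner l (x μ)) := by
    rw [siteDiag_mul]
    congr 1
    funext x
    rw [mul_assoc, mul_comm (star _), Complex.star_def, Complex.mul_conj,
      Complex.normSq_eq_norm_sq, norm_link]
    simp
  rw [h1, ← siteDiag_sub, h2, mul_sub (siteDiag _), mul_sub (siteDiag _), ← mul_assoc, h3]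
  noncomm_ring

theorem norm_blockInner_le {N l : ℕ} (i : Fin N) : ‖blockInner l i‖ ≤ 1 := by
  rw [blockInner]; split_ifs <;> simp

theorem hasBlockPoincare_gradFam (hL : 0 < L) (hA : ∀ μ, Continuous (A μ))
    (hper : ∀ μ ν x, A μ (x + Pi.single ν L) = A μ x) :
    HasBlockPoincare d (gradFam L Q A) := by
  choose K hK0 hK using fun μ => exists_bound_of_periodic hL (hA μ) (hper μ)
  have hKs : 0 ≤ ∑ μ, K μ := Finset.sum_nonneg fun μ _ => hK0 μ
  -- The three summands bound, in turn, the rank constant, the coefficients `S μ` and the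
  -- coefficient `S₀`.
  refine ⟨Fintype.card (Spin d) + L + L * (|Q| * ∑ μ, K μ), by positivity, fun n j => ?_⟩
  set a := spacingSeq L n with ha
  have ha0 : 0 < a := spacingSeq_pos hL n
  -- With this length at most `2 ^ j` blocks cover each direction, while `2 ^ j (l - 1) a ≤ L`. For
  -- `2 ^ j > n` the blocks are single sites and `E` is the identity.
  set l := n / 2 ^ j + 1 with hl
  have hNl : n + 1 ≤ l * 2 ^ j := by
    have h1 := Nat.div_add_mod n (2 ^ j)
    have h2 := Nat.mod_lt n (show 0 < 2 ^ j by positivity)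
    rw [hl, add_mul, one_mul, mul_comm (n / 2 ^ j)]
    omega
  have hla : 2 ^ j * ((l - 1 : ℕ) : ℝ) * a ≤ L := by
    have h1 : (2 : ℝ) ^ j * ((l - 1 : ℕ) : ℝ) ≤ n + 1 := by
      have : 2 ^ j * (l - 1) ≤ n + 1 := by
        rw [hl, Nat.add_sub_cancel]
        exact (Nat.mul_div_le n (2 ^ j)).trans (Nat.le_succ n)
      exact_mod_cast this
    refine (mul_le_mul_of_nonneg_right h1 ha0.le).trans (le_of_eq ?_)
    rw [ha, spacingSeq, spacing]
    push_cast
    field_simp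
  obtain ⟨X, hX, hXs⟩ := one_sub_boxAvg (d := d) (N := n + 1) (l := l) Finset.univ
  set Y : Fin d → SpinorOp d (n + 1) := fun μ => amplify (Spin d) (X μ)
    * amplify (Spin d) (along μ ((1 - blockAvg (n + 1) l) * blockSum (n + 1) l)) with hY
  have hYn : ∀ μ, ‖Y μ‖ ≤ (l - 1 : ℕ) := fun μ => by
    refine (norm_mul_le _ _).trans ?_
    have h1 : ‖amplify (Spin d) (X μ)‖ ≤ 1 := (norm_starAlgHom_le _ _).trans (hX μ)
    have h2 : ‖amplify (Spin d) (along μ ((1 - blockAvg (n + 1) l) * blockSum (n + 1) l))‖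
        ≤ (l - 1 : ℕ) :=
      (norm_starAlgHom_le _ _).trans ((norm_starAlgHom_le (alongHom μ) _).trans
        (norm_one_sub_blockAvg_mul_blockSum_le (Nat.succ_pos _)))
    calc _ ≤ 1 * ((l - 1 : ℕ) : ℝ) := mul_le_mul h1 h2 (norm_nonneg _) zero_le_one
      _ = _ := one_mul _
  set V : Fin d → SpinorOp d (n + 1) := fun μ =>
    siteDiag fun x => blockInner l (x μ) * star (link L Q A (n + 1) μ x) with hV
  have hVn : ∀ μ, ‖V μ‖ ≤ 1 := fun μ => norm_siteDiag_le zero_le_one fun x => by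
    rw [norm_mul, norm_star, norm_link, mul_one]
    exact norm_blockInner_le _
  set R : Fin d → SpinorOp d (n + 1) := fun μ =>
    siteDiag fun x => blockInner l (x μ) * star (link L Q A (n + 1) μ x) - blockInner l (x μ)
    with hR
  have hRn : ∀ μ, ‖R μ‖ ≤ |Q| * K μ * a := fun μ => by
    refine norm_siteDiag_le (by have := hK0 μ; positivity) fun x => ?_
    have h1 : blockInner l (x μ) * star (link L Q A (n + 1) μ x) - blockInner l (x μ)
        = blockInner l (x μ) * star (link L Q A (n + 1) μ x - 1) := by
      rw [star_sub, star_one]; ring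
    have h2 : ‖link L Q A (n + 1) μ x - 1‖ ≤ |Q| * K μ * a := by
      have := norm_exp_I_mul_sub_exp_I_mul_le
        (-Q * lineIntegral A (spacing L (n + 1)) μ (point L (n + 1) x)) 0
      rw [Complex.ofReal_zero, mul_zero, Complex.exp_zero, sub_zero, abs_mul, abs_neg,
        ← link_eq] at this
      rw [mul_assoc]
      exact this.trans (mul_le_mul_of_nonneg_left (abs_lineIntegral_le ha0.le (hK μ) _)
        (abs_nonneg Q))
    rw [h1, norm_mul, norm_star]
    calc _ ≤ 1 * (|Q| * K μ * a) := mul_le_mul (norm_blockInner_le _) h2 (norm_nonneg _) zero_le_one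
      _ = _ := one_mul _
  refine ⟨amplify (Spin d) (boxAvg (n + 1) l Finset.univ), ?_,
    fun μ => ((2 ^ j * a : ℝ) : ℂ) • (Y μ * V μ), ((2 ^ j : ℝ) : ℂ) • ∑ μ, Y μ * R μ,
    fun μ => ?_, ?_, ?_⟩
  · have h1 := rank_amplify_boxAvg_le (d := d) (s := Spin d) hNl
    have h2 : ((amplify (Spin d) (boxAvg (d := d) (n + 1) l Finset.univ)).rank : ℝ)
        ≤ (2 ^ j) ^ d * Fintype.card (Spin d) := by exact_mod_cast h1
    rw [← pow_mul, mul_comm] at h2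
    refine h2.trans (mul_le_mul_of_nonneg_right ?_ (by positivity))
    rw [add_assoc]
    exact le_add_of_nonneg_right (by positivity)
  · rw [norm_smul, Complex.norm_real, Real.norm_of_nonneg (by positivity)]
    have h1 : ‖Y μ * V μ‖ ≤ ((l - 1 : ℕ) : ℝ) := by
      refine (norm_mul_le _ _).trans ?_
      calc _ ≤ ((l - 1 : ℕ) : ℝ) * 1 := mul_le_mul (hYn μ) (hVn μ) (norm_nonneg _) (Nat.cast_nonneg _)
        _ = _ := mul_one _
    calc _ ≤ 2 ^ j * a * ((l - 1 : ℕ) : ℝ) := mul_le_mul_of_nonneg_left h1 (by positivity)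
      _ = 2 ^ j * ((l - 1 : ℕ) : ℝ) * a := by ring
      _ ≤ L := hla
      _ ≤ _ := by
        have : 0 ≤ L * (|Q| * ∑ μ, K μ) := by positivity
        have : (0 : ℝ) ≤ Fintype.card (Spin d) := Nat.cast_nonneg _
        linarith
  · rw [norm_smul, Complex.norm_real, Real.norm_of_nonneg (by positivity)]
    have h1 : ‖∑ μ, Y μ * R μ‖ ≤ ∑ μ, ((l - 1 : ℕ) : ℝ) * (|Q| * K μ * a) :=
      norm_sum_le_of_le _ fun μ _ => (norm_mul_le _ _).trans
        (mul_le_mul (hYn μ) (hRn μ) (norm_nonneg _) (Nat.cast_nonneg _))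
    calc _ ≤ 2 ^ j * ∑ μ, ((l - 1 : ℕ) : ℝ) * (|Q| * K μ * a) :=
          mul_le_mul_of_nonneg_left h1 (by positivity)
      _ = 2 ^ j * ((l - 1 : ℕ) : ℝ) * a * (|Q| * ∑ μ, K μ) := by
        simp only [Finset.mul_sum]
        exact Finset.sum_congr rfl fun μ _ => by ring
      _ ≤ L * (|Q| * ∑ μ, K μ) := mul_le_mul_of_nonneg_right hla (by positivity)
      _ ≤ _ := le_add_of_nonneg_left (by positivity)
  · have hT : ∀ μ, translation L Q A (n + 1) μ - 1 = (a : ℂ) • gradFam L Q A μ n := by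
      intro μ
      have h0 : (a : ℂ) ≠ 0 := by exact_mod_cast ha0.ne'
      change _ = (a : ℂ) • (((spacingSeq L)⁻¹ n : ℝ) : ℂ) • (translation L Q A (n + 1) μ - 1)
      rw [smul_smul, Pi.inv_apply, ← ha, Complex.ofReal_inv, mul_inv_cancel₀ h0, one_smul]
    have hb : ∀ μ, amplify (Spin d) (X μ) * amplify (Spin d) (along μ (1 - blockAvg (n + 1) l))
        = (a : ℂ) • (Y μ * V μ * gradFam L Q A μ n) + Y μ * R μ := by
      intro μ
      rw [one_sub_blockAvg n (Nat.succ_pos _), along_mul, map_mul (amplify (Spin d)),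
        amplify_along_blockDiff (L := L) (Q := Q) (A := A), ← mul_assoc, mul_add, hT,
        ← mul_assoc, mul_smul_comm]
    have h1 : 1 - amplify (Spin d) (boxAvg (n + 1) l Finset.univ)
        = ∑ μ, ((a : ℂ) • (Y μ * V μ * gradFam L Q A μ n) + Y μ * R μ) := by
      have := congrArg (amplify (Spin d)) hXs
      rw [map_sub, map_one, map_sum] at this
      rw [this]
      refine Finset.sum_congr rfl fun μ _ => ?_
      rw [map_mul, hb]
    have h2 : ((1 / 2 ^ j : ℝ) : ℂ) * ((2 ^ j : ℝ) : ℂ) = 1 := by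
      rw [← Complex.ofReal_mul, one_div, inv_mul_cancel₀ (by positivity), Complex.ofReal_one]
    rw [h1, Finset.sum_add_distrib, smul_add, smul_smul, h2, one_smul, Finset.smul_sum]
    congr 1
    refine Finset.sum_congr rfl fun μ _ => ?_
    rw [smul_mul_assoc, smul_smul, Complex.ofReal_mul, ← mul_assoc, h2, one_mul]

end GradientPoincare

/-! ### Spin matrices as families commuting with the gradient -/

section SpinFamilies

open scoped Matrix.Norms.L2Operator

variable {d : ℕ} {L Q : ℝ} {A : Fin d → (Fin d → ℝ) → ℝ}

/-- Spin matrices as operators on spinor fields, as a homomorphism of star algebras. -/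
def spinHom (d N : ℕ) : Matrix (Spin d) (Spin d) ℂ →⋆ₐ[ℂ] SpinorOp d N where
  toFun := spinOp N
  map_one' := Matrix.one_kronecker_one
  map_mul' X Y := by rw [spinOp, spinOp, spinOp, ← Matrix.mul_kronecker_mul, Matrix.mul_one]
  map_zero' := Matrix.kronecker_zero _
  map_add' X Y := Matrix.kronecker_add _ _ _
  commutes' c := by
    rw [Algebra.algebraMap_eq_smul_one, Algebra.algebraMap_eq_smul_one, spinOp,
      Matrix.kronecker_smul, Matrix.one_kronecker_one]
  map_star' X := by
    rw [Matrix.star_eq_conjTranspose, Matrix.star_eq_conjTranspose, spinOp, spinOp,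
      Matrix.conjTranspose_kronecker, Matrix.conjTranspose_one]

/-- A spin matrix acting on spinor fields, as a family. -/
def spinFam (g : Matrix (Spin d) (Spin d) ℂ) : OpFam (SpinorIndex d) :=
  fun n => spinHom d (n + 1) g

theorem star_spinFam (g : Matrix (Spin d) (Spin d) ℂ) : star (spinFam g) = spinFam gᴴ := by
  funext n
  exact (map_star (spinHom d (n + 1)) g).symm

theorem unifBdd_spinFam (g : Matrix (Spin d) (Spin d) ℂ) : UnifBdd (spinFam g) :=
  ⟨‖g‖, fun n => norm_starAlgHom_le (spinHom d (n + 1)) g⟩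

theorem spinFam_anticomm {γ : Fin d → Matrix (Spin d) (Spin d) ℂ}
    (hγ : ∀ μ ν, γ μ * γ ν + γ ν * γ μ = (if μ = ν then (-2 : ℂ) else 0) • 1) (μ ν : Fin d) :
    spinFam (γ μ) * spinFam (γ ν) + spinFam (γ ν) * spinFam (γ μ)
      = (if μ = ν then (-2 : ℂ) else 0) • 1 := by
  funext n
  have := congrArg (spinHom d (n + 1)) (hγ μ ν)
  rwa [map_add, map_mul, map_mul, map_smul, map_one] at this

theorem commute_spinFam_gradFam (g : Matrix (Spin d) (Spin d) ℂ) (μ : Fin d) :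
    Commute (spinFam g) (gradFam L Q A μ) := by
  have h : Commute (spinFam g) (translationFam L Q A μ) := by
    funext n
    change spinOp (n + 1) g * translation L Q A (n + 1) μ
      = translation L Q A (n + 1) μ * spinOp (n + 1) g
    rw [spinOp, translation, ← Matrix.mul_kronecker_mul, ← Matrix.mul_kronecker_mul]
    simp only [Matrix.one_mul, Matrix.mul_one]
  have h1 := h.sub_right (Commute.one_right _)
  change _ * _ = _ * _
  rw [gradFam, mul_scale, scale_mul, h1.eq]

theorem commute_spinFam_star_gradFam (g : Matrix (Spin d) (Spin d) ℂ) (μ : Fin d) :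
    Commute (spinFam g) (star (gradFam L Q A μ)) := by
  have := (commute_spinFam_gradFam (L := L) (Q := Q) (A := A) gᴴ μ).star_star
  rwa [star_spinFam, Matrix.conjTranspose_conjTranspose] at this

end SpinFamilies

/-! ### Identification of the lattice operators with the abstract ones -/

section Identification

open scoped Matrix.Norms.L2Operator

variable {d : ℕ} {L M r Q : ℝ} {A : Fin d → (Fin d → ℝ) → ℝ}

theorem translation_eq (hL : 0 < L) (μ : Fin d) (n : ℕ) :
    translation L Q A (n + 1) μ = 1 + (spacingSeq L n : ℂ) • gradFam L Q A μ n := by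
  have h0 : (spacingSeq L n : ℂ) ≠ 0 := by exact_mod_cast (spacingSeq_pos hL n).ne'
  change _ = 1 + (spacingSeq L n : ℂ) • (((spacingSeq L)⁻¹ n : ℝ) : ℂ)
    • (translation L Q A (n + 1) μ - 1)
  rw [smul_smul, Pi.inv_apply, Complex.ofReal_inv, mul_inv_cancel₀ h0, one_smul]
  abel

theorem covDeriv_eq (hL : 0 < L) (μ : Fin d) (n : ℕ) :
    covDeriv L Q A (n + 1) μ = symmDiff (gradFam L Q A) μ n := by
  have h0 : (spacingSeq L n : ℂ) ≠ 0 := by exact_mod_cast (spacingSeq_pos hL n).ne'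
  have h1 : (spacing L (n + 1) : ℂ) = spacingSeq L n := rfl
  rw [covDeriv, translation_eq hL, h1, Matrix.conjTranspose_add, Matrix.conjTranspose_one,
    Matrix.conjTranspose_smul, Complex.star_def, Complex.conj_ofReal, add_sub_add_left_eq_sub,
    ← smul_sub, smul_smul]
  have h2 : 1 / (2 * (spacingSeq L n : ℂ)) * spacingSeq L n = 1 / 2 := by field_simp
  rw [h2]
  rfl

theorem wilson_eq (hL : 0 < L) (n : ℕ) :
    wilson L Q A (n + 1) = -((spacingSeq L n : ℂ) ^ 2
      • (∑ μ, star (gradFam L Q A μ) * gradFam L Q A μ) n) := by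
  rw [wilson, Finset.sum_apply, Finset.smul_sum]
  congr 1
  refine Finset.sum_congr rfl fun μ _ => ?_
  set T := translation L Q A (n + 1) μ with hT
  have h1 : (2 : ℂ) • (1 : SpinorOp d (n + 1)) - T - Tᴴ = star (T - 1) * (T - 1) := by
    have h2 : star T * T = 1 := conjTranspose_mul_translation μ
    have h3 : star (T - 1) * (T - 1) = star T * T - star T - T + 1 := by
      rw [star_sub, star_one]; noncomm_ring
    rw [h3, h2, two_smul, Matrix.star_eq_conjTranspose]
    abel
  rw [h1, hT, translation_eq hL, add_sub_cancel_left, star_smul, Complex.star_def,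
    Complex.conj_ofReal, smul_mul_smul_comm, ← sq]
  rfl

theorem opL_eq (hL : 0 < L) (n : ℕ) :
    opL L M r Q A (n + 1) = massOp (spacingSeq L) (gradFam L Q A) M r n := by
  have h0 : (spacingSeq L n : ℂ) ≠ 0 := by exact_mod_cast (spacingSeq_pos hL n).ne'
  have h1 : (spacing L (n + 1) : ℂ) = spacingSeq L n := rfl
  rw [opL, wilson_eq hL, h1, smul_neg, sub_neg_eq_add, smul_smul]
  have h2 : (r : ℂ) / (2 * (spacingSeq L n : ℂ)) * (spacingSeq L n : ℂ) ^ 2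
      = ((r / 2 : ℝ) : ℂ) * spacingSeq L n := by
    push_cast; field_simp
  rw [h2, ← smul_smul]
  rfl

/-- The inverses of the operators `opL`, as a family. -/
noncomputable def massInvFam (L M r Q : ℝ) (A : Fin d → (Fin d → ℝ) → ℝ) :
    OpFam (SpinorIndex d) := fun n => (opL L M r Q A (n + 1))⁻¹

theorem opC_eq (hL : 0 < L) (n : ℕ) : opC L M r Q A (n + 1)
    = IsLatticeGradient.schurOp (spacingSeq L) (gradFam L Q A) M r (massInvFam L M r Q A) n := by
  simp only [opC, IsLatticeGradient.schurOp, covDeriv_eq hL, Pi.sub_apply, Finset.sum_apply,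
    Pi.mul_apply, massInvFam]
  rw [opL_eq hL]

theorem opB_eq (hL : 0 < L) (γ : Fin d → Matrix (Spin d) (Spin d) ℂ) (n : ℕ) :
    opB γ L M r Q A (n + 1) = IsLatticeGradient.curvOp (gradFam L Q A) (fun μ => spinFam (γ μ))
      (massInvFam L M r Q A) n := by
  simp only [opB, opX, IsLatticeGradient.curvOp, covDeriv_eq hL, Pi.sub_apply, Pi.smul_apply,
    Finset.sum_apply, Pi.mul_apply, massInvFam]
  rfl

/-- The Wilson term is `-a² ∑ P*P`, so after division by `2a` one factor `a` survives; it is the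
source of the `O(a)` rate. -/
theorem vertex_eq (hL : 0 < L) (ξ : (Fin d → ℝ) → ℝ) (n : ℕ) :
    vertex L r Q A ξ (n + 1) = (-((r / 2 * spacingSeq L n : ℝ) : ℂ))
      • (mulFam L ξ * (∑ μ, star (gradFam L Q A μ) * gradFam L Q A μ)
        + (∑ μ, star (gradFam L Q A μ) * gradFam L Q A μ) * mulFam L ξ) n := by
  have h0 : (spacingSeq L n : ℂ) ≠ 0 := by exact_mod_cast (spacingSeq_pos hL n).ne'
  have h1 : (spacing L (n + 1) : ℂ) = spacingSeq L n := rfl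
  have h2 : mulOp L ξ (n + 1) = mulFam (d := d) L ξ n := rfl
  rw [vertex, wilson_eq hL, h1, h2, mul_neg, neg_mul, mul_smul_comm, smul_mul_assoc, ← neg_add,
    ← smul_add, smul_neg, smul_smul, neg_smul]
  have h3 : (r : ℂ) / (2 * (spacingSeq L n : ℂ)) * (spacingSeq L n : ℂ) ^ 2
      = ((r / 2 * spacingSeq L n : ℝ) : ℂ) := by
    push_cast; field_simp
  rw [h3]
  rfl

end Identification

/-! ### Resummation, invertibility and the final estimate -/

section Remainder

/-- With `q = -BC⁻¹` one has `C⁻¹ = G(1 - q)`, so the partial geometric sum collapses exactly. No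
convergence of the full series is involved. -/
theorem sub_sum_mul_neg_pow_eq {R : Type*} [Ring R] {C B Ci Gi : R} (hCi : C * Ci = 1)
    (hGi : Gi * (C + B) = 1) (k : ℕ) :
    Gi - ∑ j ∈ Finset.range k, Ci * (-(B * Ci)) ^ j = Gi * (-(B * Ci)) ^ k := by
  have h1 : Ci = Gi * (1 - -(B * Ci)) := by
    calc Ci = Gi * (C + B) * Ci := by rw [hGi, one_mul]
      _ = Gi * (C * Ci + B * Ci) := by noncomm_ring
      _ = _ := by rw [hCi, sub_neg_eq_add]
  have h2 : ∑ j ∈ Finset.range k, Ci * (-(B * Ci)) ^ j = Gi * (1 - (-(B * Ci)) ^ k) := by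
    rw [← Finset.mul_sum]
    nth_rewrite 1 [h1]
    rw [mul_assoc, mul_neg_geom_sum]
  rw [h2, mul_sub, mul_one, sub_sub_cancel]

variable {d : ℕ} {L M r Q : ℝ} {A : Fin d → (Fin d → ℝ) → ℝ}
  {γ : Fin d → Matrix (Spin d) (Spin d) ℂ}

theorem isUnit_opL (hL : 0 < L) (hM : 0 < M) (hr : 0 < r) (hA : ∀ μ, ContDiff ℝ ∞ (A μ))
    (hper : ∀ μ ν x, A μ (x + Pi.single ν L) = A μ x) (n : ℕ) :
    IsUnit (opL L M r Q A (n + 1)) := by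
  rw [opL_eq hL]
  exact isUnit_of_coercive hM ((isLatticeGradient_gradFam hL hA hper).le_quad_massOp hr n)

theorem massOp_mul_massInvFam (hL : 0 < L) (hM : 0 < M) (hr : 0 < r)
    (hA : ∀ μ, ContDiff ℝ ∞ (A μ)) (hper : ∀ μ ν x, A μ (x + Pi.single ν L) = A μ x) :
    massOp (spacingSeq L) (gradFam L Q A) M r * massInvFam L M r Q A = 1 := by
  funext n
  rw [Pi.mul_apply, ← opL_eq hL]
  exact Matrix.mul_nonsing_inv _
    ((Matrix.isUnit_iff_isUnit_det _).mp (isUnit_opL hL hM hr hA hper n))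

theorem massInvFam_mul_massOp (hL : 0 < L) (hM : 0 < M) (hr : 0 < r)
    (hA : ∀ μ, ContDiff ℝ ∞ (A μ)) (hper : ∀ μ ν x, A μ (x + Pi.single ν L) = A μ x) :
    massInvFam L M r Q A * massOp (spacingSeq L) (gradFam L Q A) M r = 1 := by
  funext n
  exact mul_eq_one_comm.mp (congrFun (massOp_mul_massInvFam hL hM hr hA hper) n)

theorem isUnit_opC (hL : 0 < L) (hM : 0 < M) (hr : 0 < r) (hA : ∀ μ, ContDiff ℝ ∞ (A μ))
    (hper : ∀ μ ν x, A μ (x + Pi.single ν L) = A μ x) (n : ℕ) :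
    IsUnit (opC L M r Q A (n + 1)) := by
  rw [opC_eq hL]
  exact isUnit_of_coercive hM ((isLatticeGradient_gradFam hL hA hper).coercive_schurOp hM hr
    (massOp_mul_massInvFam hL hM hr hA hper) n)

theorem star_spinFam_of_skew (hγ : ∀ μ, (γ μ)ᴴ = -γ μ) (μ : Fin d) :
    star (spinFam (γ μ)) = -spinFam (γ μ) := by
  rw [star_spinFam, hγ]
  funext n
  exact map_neg (spinHom d (n + 1)) (γ μ)

theorem isUnit_opC_add_opB (hγ : ∀ μ, (γ μ)ᴴ = -γ μ)
    (hγ' : ∀ μ ν, γ μ * γ ν + γ ν * γ μ = (if μ = ν then (-2 : ℂ) else 0) • 1)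
    (hL : 0 < L) (hM : 0 < M) (hr : 0 < r) (hA : ∀ μ, ContDiff ℝ ∞ (A μ))
    (hper : ∀ μ ν x, A μ (x + Pi.single ν L) = A μ x) (n : ℕ) :
    IsUnit (opC L M r Q A (n + 1) + opB γ L M r Q A (n + 1)) := by
  rw [opC_eq hL, opB_eq hL]
  exact isUnit_of_coercive hM
    ((isLatticeGradient_gradFam hL hA hper).coercive_schurOp_add_curvOp hM hr
      (massOp_mul_massInvFam hL hM hr hA hper) (massInvFam_mul_massOp hL hM hr hA hper)
      (star_spinFam_of_skew hγ) (spinFam_anticomm hγ')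
      (fun μ => commute_spinFam_gradFam (γ μ)) (fun μ => commute_spinFam_star_gradFam (γ μ)) n)

theorem expectY_sub_sum_zTerm (hC : ∀ n, IsUnit (opC L M r Q A (n + 1)))
    (hG : ∀ n, IsUnit (opC L M r Q A (n + 1) + opB γ L M r Q A (n + 1)))
    (ξ : (Fin d → ℝ) → ℝ) (k n : ℕ) :
    expectY γ L M r Q A ξ (n + 1) - ∑ j ∈ Finset.range k, zTerm γ L M r Q A ξ j (n + 1)
      = -Complex.I * (vertex L r Q A ξ (n + 1)
        * ((opC L M r Q A (n + 1) + opB γ L M r Q A (n + 1))⁻¹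
          * (-(opB γ L M r Q A (n + 1) * (opC L M r Q A (n + 1))⁻¹)) ^ k)
        * spinOp (n + 1) (chirality γ)).trace := by
  rw [← sub_sum_mul_neg_pow_eq
    (Matrix.mul_nonsing_inv _ ((Matrix.isUnit_iff_isUnit_det _).mp (hC n)))
    (Matrix.nonsing_inv_mul _ ((Matrix.isUnit_iff_isUnit_det _).mp (hG n))) k]
  simp only [expectY, zTerm]
  rw [← Finset.mul_sum, ← mul_sub, ← Matrix.trace_sum, ← Matrix.trace_sub, mul_sub, sub_mul,
    Finset.mul_sum, Finset.sum_mul]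
  simp only [mul_assoc]

theorem exists_norm_expectY_sub_sum_zTerm_le (hd : Even d) (hd0 : 0 < d)
    (hγ : ∀ μ, (γ μ)ᴴ = -γ μ)
    (hγ' : ∀ μ ν, γ μ * γ ν + γ ν * γ μ = (if μ = ν then (-2 : ℂ) else 0) • 1)
    (hL : 0 < L) (hM : 0 < M) (hr : 0 < r) (hA : ∀ μ, ContDiff ℝ ∞ (A μ))
    (hper : ∀ μ ν x, A μ (x + Pi.single ν L) = A μ x) {ξ : (Fin d → ℝ) → ℝ}
    (hξ : ContDiff ℝ ∞ ξ) (hξper : ∀ ν x, ξ (x + Pi.single ν L) = ξ x) :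
    ∃ K : ℝ, ∀ n, ‖expectY γ L M r Q A ξ (n + 1)
      - ∑ j ∈ Finset.range (d / 2 + 1), zTerm γ L M r Q A ξ j (n + 1)‖ ≤ K * spacing L (n + 1) := by
  obtain ⟨k, hk⟩ : ∃ k, d = 2 * (k + 1) := by
    obtain ⟨m, rfl⟩ := hd
    exact ⟨m - 1, by omega⟩
  -- Subtracting the terms `j = 0, …, d/2` leaves the power `d/2 + 1`, which is the `k + 2` of the
  -- power counting.
  have hk' : d / 2 + 1 = k + 2 := by omega
  have hP : HasBlockPoincare (2 * (k + 1)) (gradFam L Q A) := by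
    have h := hasBlockPoincare_gradFam (Q := Q) hL (fun μ => (hA μ).continuous) hper
    -- Only the rank exponent is rewritten; the `d` in the matrix index types has to stay.
    have h' : ∀ m, d = m → HasBlockPoincare m (gradFam L Q A) := fun m hm => by
      rw [← hm]; exact h
    exact h' _ hk
  have hC := isUnit_opC (Q := Q) hL hM hr hA hper
  have hG := isUnit_opC_add_opB (Q := Q) hγ hγ' hL hM hr hA hper
  set Ci : OpFam (SpinorIndex d) := fun n => (opC L M r Q A (n + 1))⁻¹ with hCi
  set Gi : OpFam (SpinorIndex d) := fun n =>
    (opC L M r Q A (n + 1) + opB γ L M r Q A (n + 1))⁻¹ with hGi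
  obtain ⟨K, hK⟩ := (isLatticeGradient_gradFam (Q := Q) hL hA hper).traceBdd_remainder hP hM hr
    (Li := massInvFam L M r Q A) (Ci := Ci) (Gi := Gi) (g := fun μ => spinFam (γ μ))
    (ξ := mulFam L ξ) (γ := spinFam (chirality γ))
    (massOp_mul_massInvFam hL hM hr hA hper) (massInvFam_mul_massOp hL hM hr hA hper)
    (fun μ => unifBdd_spinFam (γ μ)) (star_spinFam_of_skew hγ) (spinFam_anticomm hγ')
    (fun μ => commute_spinFam_gradFam (γ μ)) (fun μ => commute_spinFam_star_gradFam (γ μ))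
    (by
      funext n
      rw [Pi.mul_apply, ← opC_eq hL]
      exact Matrix.mul_nonsing_inv _ ((Matrix.isUnit_iff_isUnit_det _).mp (hC n)))
    (by
      funext n
      rw [Pi.mul_apply, Pi.add_apply, ← opC_eq hL, ← opB_eq hL]
      exact Matrix.mul_nonsing_inv _ ((Matrix.isUnit_iff_isUnit_det _).mp (hG n)))
    (unifBdd_mulFam hL hξ hξper) (star_mulFam ξ) (unifBdd_gradFam_mulFam_comm hL hξ hξper)
    (unifBdd_spinFam _) (commute_spinFam_star_gradFam _)
  refine ⟨r / 2 * K, fun n => ?_⟩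
  have ha := spacingSeq_pos hL n
  have h1 := hK n
  rw [Pi.mul_apply, Pi.mul_apply, Pi.mul_apply, Pi.pow_apply, Pi.neg_apply, Pi.mul_apply,
    ← opB_eq hL] at h1
  rw [expectY_sub_sum_zTerm hC hG, hk', vertex_eq hL, smul_mul_assoc, smul_mul_assoc,
    Matrix.trace_smul, norm_mul, norm_neg, Complex.norm_I, one_mul, smul_eq_mul, norm_mul,
    norm_neg, Complex.norm_real, Real.norm_of_nonneg (by positivity)]
  have h2 := mul_le_mul_of_nonneg_left h1 (show 0 ≤ r / 2 * spacingSeq L n by positivity)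
  refine h2.trans (le_of_eq ?_)
  change r / 2 * spacing L (n + 1) * K = _
  ring

end Remainder

end WilsonFermion

theorem proposition6p1 (d : ℕ) (hd : Even d) (hd0 : 0 < d)
    (γ : Fin d → Matrix (Spin d) (Spin d) ℂ)
    (hγ_skew : ∀ μ, (γ μ)ᴴ = -γ μ)
    (hγ_clifford : ∀ μ ν, γ μ * γ ν + γ ν * γ μ = (if μ = ν then (-2 : ℂ) else 0) • 1)
    (L M r Q : ℝ) (hL : 0 < L) (hM : 0 < M) (hr : 0 < r)
    (A : Fin d → (Fin d → ℝ) → ℝ) (hA : ∀ μ, ContDiff ℝ ∞ (A μ))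
    (hA_per : ∀ μ ν x, A μ (x + Pi.single ν L) = A μ x)
    (ξ : (Fin d → ℝ) → ℝ) (hξ : ContDiff ℝ ∞ ξ)
    (hξ_per : ∀ ν x, ξ (x + Pi.single ν L) = ξ x) :
    (∀ N : ℕ, 0 < N → IsUnit (opL L M r Q A N) ∧ IsUnit (opC L M r Q A N) ∧
      IsUnit (opC L M r Q A N + opB γ L M r Q A N)) ∧
    Tendsto (fun N : ℕ => expectY γ L M r Q A ξ N
      - ∑ j ∈ Finset.range (d / 2 + 1), zTerm γ L M r Q A ξ j N) atTop (𝓝 0) ∧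
    (fun N : ℕ => expectY γ L M r Q A ξ N
      - ∑ j ∈ Finset.range (d / 2 + 1), zTerm γ L M r Q A ξ j N)
      =O[atTop] (fun N : ℕ => spacing L N) := by
  obtain ⟨K, hK⟩ := exists_norm_expectY_sub_sum_zTerm_le (Q := Q) hd hd0 hγ_skew hγ_clifford
    hL hM hr hA hA_per hξ hξ_per
  have hO : (fun N : ℕ => expectY γ L M r Q A ξ N
      - ∑ j ∈ Finset.range (d / 2 + 1), zTerm γ L M r Q A ξ j N)
      =O[atTop] (fun N : ℕ => spacing L N) := by
    refine IsBigO.of_bound K ?_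
    -- The families are indexed by `n` with `N = n + 1`, so the meaningless case `N = 0` is
    -- discarded here.
    filter_upwards [eventually_ge_atTop 1] with N hN
    obtain ⟨n, rfl⟩ := Nat.exists_eq_add_of_le' hN
    have ha : 0 ≤ spacing L (n + 1) := (spacingSeq_pos hL n).le
    rw [Real.norm_of_nonneg ha]
    exact hK n
  refine ⟨fun N hN => ?_, hO.trans_tendsto ?_, hO⟩
  · obtain ⟨n, rfl⟩ := Nat.exists_eq_add_of_le' hN
    exact ⟨isUnit_opL hL hM hr hA hA_per n, isUnit_opC hL hM hr hA hA_per n,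
      isUnit_opC_add_opB hγ_skew hγ_clifford hL hM hr hA hA_per n⟩
  · exact tendsto_const_div_atTop_nhds_zero_nat L
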